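/- **Setting.** Let $X_i=(Y_i,W_i,Z_i)$, $i\ge 1$, be i.i.d. with $Z_i\in[0,1]$, from a conditionally parametric model: given $W=w$, $Z=z$, the variable $Y$ has density $lik(\cdot\,;\theta,\eta(z))$ (which may depend on $w,z$) with respect to a $\sigma$-finite measure, where $\theta\in\Theta\subset\mathbb R^d$ and $\eta(z)\in H\subset\mathbb R$, and the law of $(W,Z)$ does not depend on $(\theta,\eta)$. Let $\mathcal H=\{h\in C^2[0,1]: h(z)\in \mathrm{int}(H)\ \text{for all } z\}$, let $(\theta_0,\eta_0)$ with $\theta_0\in\mathrm{int}(\Theta)$, $\eta_0\in\mathcal H$ be the true parameter, and let $E$ be the expectation under it. Let $\mathcal N\subset\Theta$ be an open neighbourhood of $\theta_0$. For $\theta\in\mathcal N$ let $\eta_*(\theta)\in\mathcal H$ be a maximizer over $\eta\in\mathcal H$ of $E[\log lik(X;\theta,\eta(Z))\mid Z]$ (the least favourable curve), and let $\widehat\eta(\theta)=\widehat\eta_n(\theta)\in\mathcal H$ be its kernel estimate: for every $z\in[0,1]$, $\widehat\eta(\theta)(z)$ maximizes $$\lambda\mapsto\sum_{i=1}^n\log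 lik(X_i;\theta,\lambda)\,K\Big(\frac{z-Z_i}{b_n}\Big)$$ over $\mathrm{int}(H)$, where $K$ is a kernel ($\int K=1$) and $0<b_n\to 0$ (with probability tending to one such an estimate exists for all $\theta\in\mathcal N$). Put $$\widehat S_n(\theta)=\sum_{i=1}^n\log lik(X_i;\theta,\widehat\eta(\theta)(Z_i)),\qquad S_n(\theta)=\sum_{i=1}^n\log lik(X_i;\theta,\eta_*(\theta)(Z_i)).$$ A superscript $(s)$ denotes the $s$-th derivative in $\theta$, and $\|\cdot\|_\infty$ is the supremum over $z\in[0,1]$. Stochastic orders are understood in outer probability. **Conditions.** * **K1.** For all $\theta_1\in\Theta$, $\lambda_1\in H$, and all $\theta\in\Theta$, $\lambda\in H$ with $\theta\ne\theta_1$: $E_{\theta_1,\lambda_1}\log lik(X;\theta,\lambda)<E_{\theta_1,\lambda_1}\log lik(X;\theta_1,\lambda_1)$. * **K2.** Almost surely, $\log lik(X;\theta,\lambda)$ is finite and four times continuously differentiable in $(\theta,\lambda)$ on $\mathrm{int}(\Theta)\times\mathrm{int}(H)$, and $$E\Big\{\sup_{(\theta,\lambda)\in\mathrm{int}(\Theta)\times\mathrm{int}(H)}\Big|\frac{\partial^{r+s}\log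 lik(X;\theta,\lambda)}{\partial\theta^r\partial\lambda^s}\Big|^2\Big\}<\infty\qquad\text{for all } r,s\ge0,\ r+s\le 4.$$ * **C1.** For all $r,s\ge0$ with $r+s\le3$, the derivatives $\frac{\partial^{r+s}}{\partial z^r\partial\theta^s}\eta_*(\theta)(z)$ and, with probability tending to one, $\frac{\partial^{r+s}}{\partial z^r\partial\theta^s}\widehat\eta(\theta)(z)$ exist for $\theta\in\mathcal N$, $z\in[0,1]$, and $\sup_{\theta\in\mathcal N}\|\eta_*^{(s)}(\theta)\|_\infty<\infty$ for $s=0,1,2,3$. * **C2.** For some $g\in(1/4,1/2]$ and $2g-1/2\le\delta\le g$: $\sup_{\theta\in\mathcal N}\|\widehat\eta^{(s)}(\theta)-\eta_*^{(s)}(\theta)\|_\infty=O_P(n^{-g})$ for $s=0,1,2$; $\sup_{\theta\in\mathcal N}\|\widehat\eta^{(3)}(\theta)-\eta_*^{(3)}(\theta)\|_\infty=o_P(1)$; and $\big\|\frac{\partial}{\partial z}\widehat\eta^{(s)}(\theta_0)-\frac{\partial}{\partial z}\eta_*^{(s)}(\theta_0)\big\|_\infty=o_P(n^{-\delta})$ for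 $s=0,1$. **Theorem 4.** Assume K1, K2, C1 and C2. Then Condition G holds with the same $g$: there is an open neighbourhood $\mathcal N'\subset\mathcal N$ of $\theta_0$ (one may take $\mathcal N'=\mathcal N$ if $H$ is an interval) such that, with probability tending to one, $\widehat S_n$ and $S_n$ are three times differentiable on $\mathcal N'$, and $$\Big|\tfrac1n\widehat S_n^{(1)}(\theta_0)-\tfrac1nS_n^{(1)}(\theta_0)\Big|=O_P(n^{-2g}),$$ $$\sup_{\theta\in\mathcal N'}\Big|\tfrac1n\widehat S_n^{(2)}(\theta)-\tfrac1nS_n^{(2)}(\theta)\Big|=O_P(n^{-g}),\qquad \sup_{\theta\in\mathcal N'}\Big|\tfrac1n\widehat S_n^{(3)}(\theta)\Big|=O_P(1),$$ where $1/4<g\le1/2$. -/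

import Mathlib

open MeasureTheory ProbabilityTheory Filter Topology Set
open scoped ENNReal NNReal

noncomputable section

/-- Stochastic order `R n = O_P(r n)` for a sequence of nonnegative (possibly infinite) random
quantities. The measure of an arbitrary set is its outer measure, so no measurability is needed. -/
def BigOP {Ω : Type*} [MeasurableSpace Ω] (μ : Measure Ω) (R : ℕ → Ω → ℝ≥0∞) (r : ℕ → ℝ) : Prop :=
  ∀ ε : ℝ, 0 < ε → ∃ M : ℝ, ∀ᶠ n in atTop,
    μ {ω | ENNReal.ofReal (M * r n) < R n ω} ≤ ENNReal.ofReal ε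

/-- Stochastic order `R n = o_P(r n)`. -/
def LittleOP {Ω : Type*} [MeasurableSpace Ω] (μ : Measure Ω) (R : ℕ → Ω → ℝ≥0∞) (r : ℕ → ℝ) :
    Prop :=
  ∀ c : ℝ, 0 < c →
    Tendsto (fun n => μ {ω | ENNReal.ofReal (c * r n) < R n ω}) atTop (𝓝 0)

/-- The statement `G n ω` holds with probability tending to one as `n → ∞`. -/
def WithProbTendingToOne {Ω : Type*} [MeasurableSpace Ω] (μ : Measure Ω) (G : ℕ → Ω → Prop) :
    Prop :=
  Tendsto (fun n => μ {ω | ¬ G n ω}) atTop (𝓝 0)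

/-- `f` is three times (Fréchet) differentiable on the open set `N`. -/
def ThriceDifferentiableOn {d : ℕ} (f : EuclideanSpace ℝ (Fin d) → ℝ)
    (N : Set (EuclideanSpace ℝ (Fin d))) : Prop :=
  ∀ k < 3, DifferentiableOn ℝ (iteratedFDeriv ℝ k f) N

/-- A curve `θ ↦ η(θ)` of functions on `[0,1]` is given as `η θ z`. `thetaDeriv η s θ z` is the
`s`-th derivative of `η(θ)(z)` with respect to `θ` (an `s`-linear form). -/
def thetaDeriv {d : ℕ} (η : EuclideanSpace ℝ (Fin d) → ℝ → ℝ) (s : ℕ)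
    (θ : EuclideanSpace ℝ (Fin d)) (z : ℝ) :
    ContinuousMultilinearMap ℝ (fun _ : Fin s => EuclideanSpace ℝ (Fin d)) ℝ :=
  iteratedFDeriv ℝ s (fun t => η t z) θ

/-- All derivatives `∂^{r+s} η(θ)(z) / ∂z^r ∂θ^s` with `r + s ≤ 3` exist for `θ ∈ N` and
`z ∈ [0,1]` (one-sided in `z` at the two end points). -/
def MixedDerivsExist {d : ℕ} (η : EuclideanSpace ℝ (Fin d) → ℝ → ℝ)
    (N : Set (EuclideanSpace ℝ (Fin d))) : Prop :=
  (∀ z ∈ Icc (0 : ℝ) 1, ThriceDifferentiableOn (fun θ => η θ z) N) ∧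
  ∀ θ ∈ N, ∀ r s : ℕ, r + s < 3 →
    DifferentiableOn ℝ (iteratedDerivWithin r (fun z => thetaDeriv η s θ z) (Icc 0 1)) (Icc 0 1)

/-- A conditionally parametric model for observations `X = (Y, (W, Z))` with `Z ∈ [0,1]`: given
`W = w` and `Z = z`, the variable `Y` has a `ν`-density from a family indexed by `θ ∈ Θ ⊆ ℝ^d` and
`λ = η(z) ∈ H ⊆ ℝ`; the law `Q` of `(W, Z)` does not depend on the parameters. -/
structure CondParamModel (d : ℕ) (𝒴 𝒲 : Type*) [MeasurableSpace 𝒴] [MeasurableSpace 𝒲] where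
  /-- parameter space of `θ` -/
  Θ : Set (EuclideanSpace ℝ (Fin d))
  /-- parameter space of `λ` -/
  H : Set ℝ
  /-- dominating measure for `Y` -/
  ν : Measure 𝒴
  sigmaFinite_ν : SigmaFinite ν
  /-- joint law of the covariates `(W, Z)` -/
  Q : Measure (𝒲 × unitInterval)
  isProbabilityMeasure_Q : IsProbabilityMeasure Q
  /-- `lik (y, (w, z)) θ l`: conditional density of `Y` at `y` given `W = w`, `Z = z` -/
  lik : 𝒴 × (𝒲 × unitInterval) → EuclideanSpace ℝ (Fin d) → ℝ → ℝ≥0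
  measurable_lik : ∀ θ ∈ Θ,
    Measurable fun p : (𝒴 × (𝒲 × unitInterval)) × H => lik p.1 θ (p.2 : ℝ)
  lintegral_lik : ∀ θ ∈ Θ, ∀ l ∈ H, ∀ v : 𝒲 × unitInterval,
    ∫⁻ y, (lik (y, v) θ l : ℝ≥0∞) ∂ν = 1

namespace CondParamModel

variable {d : ℕ} {𝒴 𝒲 : Type*} [MeasurableSpace 𝒴] [MeasurableSpace 𝒲]

/-- The log-likelihood `log lik(x; θ, λ)`. -/
def loglik (M : CondParamModel d 𝒴 𝒲) (x : 𝒴 × (𝒲 × unitInterval))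
    (θ : EuclideanSpace ℝ (Fin d)) (l : ℝ) : ℝ :=
  Real.log (M.lik x θ l)

/-- The nuisance space: the twice continuously differentiable functions on `[0,1]` with values in
the interior of `H`. -/
def nuisanceSpace (M : CondParamModel d 𝒴 𝒲) : Set (ℝ → ℝ) :=
  {h | ContDiffOn ℝ 2 h (Icc 0 1) ∧ ∀ z ∈ Icc (0 : ℝ) 1, h z ∈ interior M.H}

/-- The law of one observation `X = (Y, (W, Z))` under the parameter `(θ, η)`. -/
def law (M : CondParamModel d 𝒴 𝒲) (θ : EuclideanSpace ℝ (Fin d)) (η : ℝ → ℝ) :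
    Measure (𝒴 × (𝒲 × unitInterval)) :=
  (M.ν.prod M.Q).withDensity fun x => (M.lik x θ (η x.2.2) : ℝ≥0∞)

/-- `X 0, X 1, …` are i.i.d. observations from the model at `(θ, η)`. -/
def IsSample (M : CondParamModel d 𝒴 𝒲) (θ : EuclideanSpace ℝ (Fin d)) (η : ℝ → ℝ)
    {Ω : Type*} [MeasurableSpace Ω] (μ : Measure Ω) (X : ℕ → Ω → 𝒴 × (𝒲 × unitInterval)) : Prop :=
  (∀ i, Measurable (X i)) ∧ iIndepFun X μ ∧ ∀ i, μ.map (X i) = M.law θ η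

/-- Identifiability. If `log lik(·; θ, λ)` is not integrable under `(θ₁, λ₁)`, or equals `-∞` with
positive probability, then its expectation is `-∞` and the inequality holds by convention. -/
def ConditionK1 (M : CondParamModel d 𝒴 𝒲) : Prop :=
  ∀ θ₁ ∈ M.Θ, ∀ l₁ ∈ M.H, ∀ θ ∈ M.Θ, ∀ l ∈ M.H, θ ≠ θ₁ →
    Integrable (fun x => M.loglik x θ₁ l₁) (M.law θ₁ fun _ => l₁) ∧
    ((∀ᵐ x ∂(M.law θ₁ fun _ => l₁), 0 < M.lik x θ l) →
      Integrable (fun x => M.loglik x θ l) (M.law θ₁ fun _ => l₁) →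
      ∫ x, M.loglik x θ l ∂(M.law θ₁ fun _ => l₁) <
        ∫ x, M.loglik x θ₁ l₁ ∂(M.law θ₁ fun _ => l₁))

/-- Smoothness and moments: almost surely `(θ, λ) ↦ log lik(X; θ, λ)` is finite and of class `C⁴`,
and for each `k ≤ 4` the supremum over `(θ, λ)` of the norm of its `k`-th derivative, whose
components are the partial derivatives `∂^{r+s} / ∂θ^r ∂λ^s` with `r + s = k`, has a finite
(outer) second moment under `(θ₀, η₀)`. Derivatives are taken at interior points. -/
def ConditionK2 (M : CondParamModel d 𝒴 𝒲) (θ₀ : EuclideanSpace ℝ (Fin d)) (η₀ : ℝ → ℝ) : Prop :=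
  (∀ᵐ x ∂(M.law θ₀ η₀), ∀ θ ∈ interior M.Θ, ∀ l ∈ interior M.H, 0 < M.lik x θ l) ∧
  (∀ᵐ x ∂(M.law θ₀ η₀), ContDiffOn ℝ 4
    (fun p : EuclideanSpace ℝ (Fin d) × ℝ => M.loglik x p.1 p.2)
    (interior M.Θ ×ˢ interior M.H)) ∧
  ∀ k ≤ 4, ∃ A : 𝒴 × (𝒲 × unitInterval) → ℝ, MemLp A 2 (M.law θ₀ η₀) ∧
    ∀ᵐ x ∂(M.law θ₀ η₀), ∀ θ ∈ interior M.Θ, ∀ l ∈ interior M.H,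
      ‖iteratedFDeriv ℝ k
        (fun p : EuclideanSpace ℝ (Fin d) × ℝ => M.loglik x p.1 p.2) (θ, l)‖ ≤ A x

/-- The least favorable curve at `θ`: `ηs` belongs to the nuisance space and maximizes
`E[log lik(X; θ, η(Z)) | Z]` over it, the expectation being taken under `(θ₀, η₀)`. -/
def IsLeastFavorableAt (M : CondParamModel d 𝒴 𝒲) (θ₀ : EuclideanSpace ℝ (Fin d)) (η₀ : ℝ → ℝ)
    (θ : EuclideanSpace ℝ (Fin d)) (ηs : ℝ → ℝ) : Prop :=
  ηs ∈ M.nuisanceSpace ∧ ∀ η ∈ M.nuisanceSpace,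
    condExp (MeasurableSpace.comap (fun x : 𝒴 × (𝒲 × unitInterval) => x.2.2) inferInstance)
        (M.law θ₀ η₀) (fun x => M.loglik x θ (η x.2.2))
      ≤ᵐ[M.law θ₀ η₀]
    condExp (MeasurableSpace.comap (fun x : 𝒴 × (𝒲 × unitInterval) => x.2.2) inferInstance)
        (M.law θ₀ η₀) (fun x => M.loglik x θ (ηs x.2.2))

/-- The kernel estimate at `θ` from the observations `x 0, …, x (n-1)` with kernel `K` and
bandwidth `b`: `ηh` belongs to the nuisance space and, for every `z ∈ [0,1]`, the number `ηh z`
maximizes `∑ log lik(xᵢ; θ, λ) K((z - zᵢ) / b)` over `λ` in the interior of `H`. -/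
def IsKernelEstimateAt (M : CondParamModel d 𝒴 𝒲) (K : ℝ → ℝ) (b : ℝ) (n : ℕ)
    (x : ℕ → 𝒴 × (𝒲 × unitInterval)) (θ : EuclideanSpace ℝ (Fin d)) (ηh : ℝ → ℝ) : Prop :=
  ηh ∈ M.nuisanceSpace ∧ ∀ z ∈ Icc (0 : ℝ) 1, ∀ l ∈ interior M.H,
    ∑ i ∈ Finset.range n, M.loglik (x i) θ l * K ((z - (x i).2.2) / b) ≤
      ∑ i ∈ Finset.range n, M.loglik (x i) θ (ηh z) * K ((z - (x i).2.2) / b)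

/-- The log-likelihood `∑ log lik(xᵢ; θ, η(θ)(zᵢ))` of the first `n` observations along a curve
`θ ↦ η(θ)`. -/
def profile (M : CondParamModel d 𝒴 𝒲) (n : ℕ) (x : ℕ → 𝒴 × (𝒲 × unitInterval))
    (η : EuclideanSpace ℝ (Fin d) → ℝ → ℝ) (θ : EuclideanSpace ℝ (Fin d)) : ℝ :=
  ∑ i ∈ Finset.range n, M.loglik (x i) θ (η θ (x i).2.2)

end CondParamModel

/-- A kernel: an integrable function of total integral one. -/
def IsKernel (K : ℝ → ℝ) : Prop := Integrable K ∧ ∫ u, K u = 1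

/-- Smoothness of the curve `ηs` and of its estimate `ηh` on a neighborhood `N` of `θ₀`. -/
def ConditionC1 {d : ℕ} {Ω : Type*} [MeasurableSpace Ω] (μ : Measure Ω)
    (ηs : EuclideanSpace ℝ (Fin d) → ℝ → ℝ)
    (ηh : ℕ → Ω → EuclideanSpace ℝ (Fin d) → ℝ → ℝ)
    (N : Set (EuclideanSpace ℝ (Fin d))) : Prop :=
  MixedDerivsExist ηs N ∧
  WithProbTendingToOne μ (fun n ω => MixedDerivsExist (ηh n ω) N) ∧
  ∀ s ≤ 3, ∃ C : ℝ, ∀ θ ∈ N, ∀ z ∈ Icc (0 : ℝ) 1, ‖thetaDeriv ηs s θ z‖ ≤ C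

/-- Uniform convergence rates of the estimate `ηh` of the curve `ηs`. -/
def ConditionC2 {d : ℕ} {Ω : Type*} [MeasurableSpace Ω] (μ : Measure Ω)
    (ηs : EuclideanSpace ℝ (Fin d) → ℝ → ℝ)
    (ηh : ℕ → Ω → EuclideanSpace ℝ (Fin d) → ℝ → ℝ)
    (θ₀ : EuclideanSpace ℝ (Fin d)) (N : Set (EuclideanSpace ℝ (Fin d))) (g δ : ℝ) : Prop :=
  (1 / 4 < g ∧ g ≤ 1 / 2) ∧ (2 * g - 1 / 2 ≤ δ ∧ δ ≤ g) ∧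
  (∀ s ≤ 2, BigOP μ
    (fun n ω => ⨆ θ ∈ N, ⨆ z ∈ Icc (0 : ℝ) 1,
      ‖thetaDeriv (ηh n ω) s θ z - thetaDeriv ηs s θ z‖ₑ)
    (fun n => (n : ℝ) ^ (-g))) ∧
  LittleOP μ
    (fun n ω => ⨆ θ ∈ N, ⨆ z ∈ Icc (0 : ℝ) 1,
      ‖thetaDeriv (ηh n ω) 3 θ z - thetaDeriv ηs 3 θ z‖ₑ)
    (fun _ => 1) ∧
  (∀ s ≤ 1, LittleOP μ
    (fun n ω => ⨆ z ∈ Icc (0 : ℝ) 1,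
      ‖derivWithin (fun u => thetaDeriv (ηh n ω) s θ₀ u) (Icc 0 1) z -
        derivWithin (fun u => thetaDeriv ηs s θ₀ u) (Icc 0 1) z‖ₑ)
    (fun n => (n : ℝ) ^ (-δ)))

/-- The general condition on the criterion functions `Sh n` (based on the estimated curve) and
`S n` (based on the least favorable curve) with the neighborhood `N` of `θ₀` and the exponent `g`;
the derivatives that occur in it exist on `N`, with probability tending to one. -/
def ConditionG {d : ℕ} {Ω : Type*} [MeasurableSpace Ω] (μ : Measure Ω)
    (Sh S : ℕ → Ω → EuclideanSpace ℝ (Fin d) → ℝ)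
    (θ₀ : EuclideanSpace ℝ (Fin d)) (N : Set (EuclideanSpace ℝ (Fin d))) (g : ℝ) : Prop :=
  (1 / 4 < g ∧ g ≤ 1 / 2) ∧
  WithProbTendingToOne μ
    (fun n ω => ThriceDifferentiableOn (Sh n ω) N ∧ ThriceDifferentiableOn (S n ω) N) ∧
  BigOP μ
    (fun n ω => ‖(1 / n : ℝ) • iteratedFDeriv ℝ 1 (Sh n ω) θ₀ -
      (1 / n : ℝ) • iteratedFDeriv ℝ 1 (S n ω) θ₀‖ₑ)
    (fun n => (n : ℝ) ^ (-(2 * g))) ∧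
  BigOP μ
    (fun n ω => ⨆ θ ∈ N, ‖(1 / n : ℝ) • iteratedFDeriv ℝ 2 (Sh n ω) θ -
      (1 / n : ℝ) • iteratedFDeriv ℝ 2 (S n ω) θ‖ₑ)
    (fun n => (n : ℝ) ^ (-g)) ∧
  BigOP μ
    (fun n ω => ⨆ θ ∈ N, ‖(1 / n : ℝ) • iteratedFDeriv ℝ 3 (Sh n ω) θ‖ₑ)
    (fun _ => 1)

end

/-!
Write `η` for the least favourable curve and `η̂` for its estimate. Since `η(θ)` maximizes the
expected log-likelihood, the nuisance score along it is orthogonal to every `C²` function of `Z`;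
differentiating this identity in `θ`, the derivative of the score along the curve is orthogonal to
them too. Hence the terms of `Ŝₙ⁽¹⁾(θ₀) - Sₙ⁽¹⁾(θ₀)` that are linear in `η̂ - η` and in its
`θ`-derivative are `n` times averages of `mᵢ F(Zᵢ)`, where the `mᵢ` are centered given the `Zᵢ`
and `F` is `C¹` but random. Summation by parts bounds such an average by the `C¹`-norm of `F` times
averages of `mᵢ` and `mᵢ 1{u ≤ Zᵢ}`, which have order `n^(-1/2)`, so the linear terms have order
`n^(-δ) n^(-1/2) ≤ n^(-2g)`. The remainder is quadratic in the `C¹`-distance of the curves, hence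
also of order `n^(-2g)`. The second and third derivatives only need the chain rule and the square
integrable envelope of the derivatives of the log-likelihood.
-/

section StochasticOrder

variable {Ω : Type*} [MeasurableSpace Ω] {μ : Measure Ω} {G G' : ℕ → Ω → Prop}
  {R R' R₁ R₂ : ℕ → Ω → ℝ≥0∞} {r r' r₁ r₂ : ℕ → ℝ}

theorem withProbTendingToOne_of_ae (hG : ∀ᵐ ω ∂μ, ∀ n, G n ω) : WithProbTendingToOne μ G := by
  have hnull : ∀ n, μ {ω | ¬ G n ω} = 0 := fun n => ae_all_iff.1 hG n
  simpa only [WithProbTendingToOne, hnull] using tendsto_const_nhds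

theorem WithProbTendingToOne.mono (h : WithProbTendingToOne μ G)
    (hle : ∀ n ω, G n ω → G' n ω) : WithProbTendingToOne μ G' :=
  tendsto_of_tendsto_of_tendsto_of_le_of_le tendsto_const_nhds h (fun _ => zero_le)
    fun n => measure_mono fun ω hω hG => hω (hle n ω hG)

theorem WithProbTendingToOne.and (h : WithProbTendingToOne μ G)
    (h' : WithProbTendingToOne μ G') : WithProbTendingToOne μ fun n ω => G n ω ∧ G' n ω := by
  have hadd : Tendsto (fun n => μ {ω | ¬ G n ω} + μ {ω | ¬ G' n ω}) atTop (𝓝 0) := by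
    simpa using Tendsto.add h h'
  refine tendsto_of_tendsto_of_tendsto_of_le_of_le tendsto_const_nhds hadd (fun _ => zero_le)
    fun n => (measure_mono fun ω hω => ?_).trans (measure_union_le _ _)
  exact not_and_or.1 hω

theorem LittleOP.bigOP (h : LittleOP μ R r) : BigOP μ R r := fun _ hε =>
  ⟨1, ((h 1 one_pos).eventually_lt_const (ENNReal.ofReal_pos.2 hε)).mono fun _ hn => hn.le⟩

theorem LittleOP.withProbTendingToOne_le (h : LittleOP μ R r) {c : ℝ} (hc : 0 < c) :
    WithProbTendingToOne μ fun n ω => R n ω ≤ ENNReal.ofReal (c * r n) := by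
  simpa only [WithProbTendingToOne, not_le] using h c hc

theorem LittleOP.of_le (h : LittleOP μ R r) (hle : ∀ n ω, R' n ω ≤ R n ω) : LittleOP μ R' r :=
  fun c hc => tendsto_of_tendsto_of_tendsto_of_le_of_le tendsto_const_nhds (h c hc)
    (fun _ => zero_le) fun n => measure_mono fun ω hω => lt_of_lt_of_le hω (hle n ω)

theorem BigOP.mono (h : BigOP μ R r) (hG : WithProbTendingToOne μ G)
    (hle : ∀ n ω, G n ω → R' n ω ≤ R n ω) : BigOP μ R' r := by
  intro ε hε
  obtain ⟨M, hM⟩ := h (ε / 2) (half_pos hε)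
  have hG' := hG.eventually_lt_const (ENNReal.ofReal_pos.2 (half_pos hε))
  refine ⟨M, ?_⟩
  filter_upwards [hM, hG'] with n hn hGn
  calc μ {ω | ENNReal.ofReal (M * r n) < R' n ω}
      ≤ μ {ω | ENNReal.ofReal (M * r n) < R n ω} + μ {ω | ¬ G n ω} := by
        refine (measure_mono fun ω hω => ?_).trans (measure_union_le _ _)
        by_cases hGω : G n ω
        · exact Or.inl (lt_of_lt_of_le hω (hle n ω hGω))
        · exact Or.inr hGω
    _ ≤ ENNReal.ofReal (ε / 2) + ENNReal.ofReal (ε / 2) := add_le_add hn hGn.le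
    _ = ENNReal.ofReal ε := by
        rw [← ENNReal.ofReal_add (half_pos hε).le (half_pos hε).le, add_halves]

theorem BigOP.of_le (h : BigOP μ R r) (hle : ∀ n ω, R' n ω ≤ R n ω) : BigOP μ R' r :=
  h.mono (G := fun _ _ => True) (withProbTendingToOne_of_ae (by simp)) fun n ω _ => hle n ω

theorem BigOP.mono_rate (h : BigOP μ R r) (hr : ∀ n, 0 ≤ r n) (hle : ∀ᶠ n in atTop, r n ≤ r' n) :
    BigOP μ R r' := by
  intro ε hε
  obtain ⟨M, hM⟩ := h ε hε
  refine ⟨|M|, ?_⟩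
  filter_upwards [hM, hle] with n hn hrn
  refine (measure_mono fun ω hω => lt_of_le_of_lt (ENNReal.ofReal_le_ofReal ?_) hω).trans hn
  calc M * r n ≤ |M| * r n := mul_le_mul_of_nonneg_right (le_abs_self M) (hr n)
    _ ≤ |M| * r' n := mul_le_mul_of_nonneg_left hrn (abs_nonneg M)

theorem BigOP.of_forall_le (h₁ : BigOP μ R₁ r₁) (h₂ : BigOP μ R₂ r₂) (hr₁ : ∀ n, 0 ≤ r₁ n)
    (hr₂ : ∀ n, 0 ≤ r₂ n)
    (hR : ∀ M, 0 ≤ M → ∃ M', ∀ n ω, R₁ n ω ≤ ENNReal.ofReal (M * r₁ n) →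
      R₂ n ω ≤ ENNReal.ofReal (M * r₂ n) → R n ω ≤ ENNReal.ofReal (M' * r n)) :
    BigOP μ R r := by
  intro ε hε
  obtain ⟨M₁, hM₁⟩ := h₁ (ε / 2) (half_pos hε)
  obtain ⟨M₂, hM₂⟩ := h₂ (ε / 2) (half_pos hε)
  obtain ⟨M', hM'⟩ := hR (max (max M₁ M₂) 0) (le_max_right _ _)
  refine ⟨M', ?_⟩
  filter_upwards [hM₁, hM₂] with n hn₁ hn₂
  have hsub : {ω | ENNReal.ofReal (M' * r n) < R n ω} ⊆
      {ω | ENNReal.ofReal (M₁ * r₁ n) < R₁ n ω} ∪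
        {ω | ENNReal.ofReal (M₂ * r₂ n) < R₂ n ω} := by
    intro ω hω
    by_contra hout
    simp only [mem_union, mem_ofPred_eq, not_or, not_lt] at hout hω
    refine hω.not_ge (hM' n ω (hout.1.trans ?_) (hout.2.trans ?_)) <;>
      refine ENNReal.ofReal_le_ofReal (mul_le_mul_of_nonneg_right ?_ (by simp only [hr₁, hr₂]))
    · exact (le_max_left _ _).trans (le_max_left _ _)
    · exact (le_max_right _ _).trans (le_max_left _ _)
  calc μ {ω | ENNReal.ofReal (M' * r n) < R n ω}
      ≤ ENNReal.ofReal (ε / 2) + ENNReal.ofReal (ε / 2) :=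
        (measure_mono hsub).trans ((measure_union_le _ _).trans (add_le_add hn₁ hn₂))
    _ = ENNReal.ofReal ε := by
        rw [← ENNReal.ofReal_add (half_pos hε).le (half_pos hε).le, add_halves]

theorem BigOP.add (h₁ : BigOP μ R₁ r) (h₂ : BigOP μ R₂ r) (hr : ∀ n, 0 ≤ r n) :
    BigOP μ (fun n ω => R₁ n ω + R₂ n ω) r := by
  refine h₁.of_forall_le h₂ hr hr fun M hM => ⟨M + M, fun n ω hR₁ hR₂ => ?_⟩
  rw [add_mul, ENNReal.ofReal_add (mul_nonneg hM (hr n)) (mul_nonneg hM (hr n))]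
  exact add_le_add hR₁ hR₂

theorem BigOP.mul (h₁ : BigOP μ R₁ r₁) (h₂ : BigOP μ R₂ r₂) (hr₁ : ∀ n, 0 ≤ r₁ n)
    (hr₂ : ∀ n, 0 ≤ r₂ n) : BigOP μ (fun n ω => R₁ n ω * R₂ n ω) (fun n => r₁ n * r₂ n) := by
  refine h₁.of_forall_le h₂ hr₁ hr₂ fun M hM => ⟨M * M, fun n ω hR₁ hR₂ => ?_⟩
  rw [mul_mul_mul_comm, ENNReal.ofReal_mul (mul_nonneg hM (hr₁ n))]
  exact mul_le_mul' hR₁ hR₂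

theorem bigOP_const {c : ℝ≥0∞} (hc : c ≠ ∞) : BigOP μ (fun _ _ => c) (fun _ => 1) :=
  fun ε _ => ⟨c.toReal, Eventually.of_forall fun n => by simp [hc]⟩

theorem bigOP_zero (r : ℕ → ℝ) : BigOP μ (fun _ _ => 0) r :=
  fun ε _ => ⟨0, Eventually.of_forall fun n => by simp⟩

theorem BigOP.sum {ι : Type*} {s : Finset ι} {R : ι → ℕ → Ω → ℝ≥0∞} (hr : ∀ n, 0 ≤ r n)
    (h : ∀ i ∈ s, BigOP μ (R i) r) : BigOP μ (fun n ω => ∑ i ∈ s, R i n ω) r := by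
  induction s using Finset.cons_induction with
  | empty => simpa only [Finset.sum_empty] using bigOP_zero r
  | cons i s hi ih =>
    simp only [Finset.sum_cons]
    exact (h i (Finset.mem_cons_self i s)).add
      (ih fun j hj => h j (Finset.mem_cons_of_mem hj)) hr

theorem BigOP.withProbTendingToOne_le (h : BigOP μ R r) (hr : Tendsto r atTop (𝓝 0)) {c : ℝ}
    (hc : 0 < c) : WithProbTendingToOne μ fun n ω => R n ω ≤ ENNReal.ofReal c := by
  refine ENNReal.tendsto_nhds_zero.2 fun ε hε => ?_
  obtain ⟨ε', hε'0, hε'⟩ := ENNReal.lt_iff_exists_nnreal_btwn.1 hε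
  obtain ⟨M, hM⟩ := h ε' (by exact_mod_cast hε'0)
  have hMr : Tendsto (fun n => M * r n) atTop (𝓝 0) := by simpa using hr.const_mul M
  filter_upwards [hM, hMr.eventually_lt_const hc] with n hn hrn
  refine (measure_mono fun ω hω => ?_).trans (hn.trans (by simpa using hε'.le))
  exact (ENNReal.ofReal_le_ofReal hrn.le).trans_lt (not_le.1 hω)

theorem bigOP_of_lintegral_le {C : ℝ≥0∞} (hC : C ≠ ∞) (hR : ∀ n, AEMeasurable (R n) μ)
    (hr : ∀ᶠ n in atTop, 0 < r n)
    (h : ∀ n, ∫⁻ ω, R n ω ∂μ ≤ C * ENNReal.ofReal (r n)) : BigOP μ R r := by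
  intro ε hε
  refine ⟨C.toReal / ε + 1, ?_⟩
  filter_upwards [hr] with n hn
  set a := (C.toReal / ε + 1) * r n with ha
  have ha0 : 0 < a := by positivity
  have hCa : C.toReal * r n ≤ a * ε := by
    rw [ha, mul_right_comm, add_mul, div_mul_cancel₀ _ hε.ne']
    exact mul_le_mul_of_nonneg_right (by linarith) hn.le
  have hmarkov := mul_meas_ge_le_lintegral₀ (hR n) (ENNReal.ofReal a)
  refine (ENNReal.mul_le_mul_iff_right (by simpa using ha0) ENNReal.ofReal_ne_top).1 ?_
  calc ENNReal.ofReal a * μ {ω | ENNReal.ofReal a < R n ω}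
      ≤ ENNReal.ofReal a * μ {ω | ENNReal.ofReal a ≤ R n ω} :=
        mul_le_mul_right (measure_mono (ofPred_subset_ofPred.2 fun _ => le_of_lt)) _
    _ ≤ C * ENNReal.ofReal (r n) := hmarkov.trans (h n)
    _ = ENNReal.ofReal (C.toReal * r n) := by
        rw [ENNReal.ofReal_mul ENNReal.toReal_nonneg, ENNReal.ofReal_toReal hC]
    _ ≤ ENNReal.ofReal a * ENNReal.ofReal ε := by
        rw [← ENNReal.ofReal_mul ha0.le]
        exact ENNReal.ofReal_le_ofReal hCa

end StochasticOrder

section IteratedDerivatives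

set_option maxSynthPendingDepth 3

variable {E F : Type*} [NormedAddCommGroup E] [NormedSpace ℝ E] [NormedAddCommGroup F]
  [NormedSpace ℝ F] {N : Set E}

theorem differentiableOn_iteratedFDeriv_zero_iff {f : E → F} :
    DifferentiableOn ℝ (iteratedFDeriv ℝ 0 f) N ↔ DifferentiableOn ℝ f N := by
  have hcurry : iteratedFDeriv ℝ 0 f = ⇑(continuousMultilinearCurryFin0 ℝ E F).symm ∘ f :=
    iteratedFDeriv_zero_eq_comp
  rw [hcurry]
  exact (continuousMultilinearCurryFin0 ℝ E F).symm.comp_differentiableOn_iff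

theorem differentiableOn_iteratedFDeriv_succ_iff {f : E → F} {k : ℕ} :
    DifferentiableOn ℝ (iteratedFDeriv ℝ (k + 1) f) N ↔
      DifferentiableOn ℝ (iteratedFDeriv ℝ k (fderiv ℝ f)) N := by
  have hcurry : iteratedFDeriv ℝ (k + 1) f =
      ⇑(continuousMultilinearCurryRightEquiv' ℝ k E F).symm ∘ iteratedFDeriv ℝ k (fderiv ℝ f) :=
    funext fun x => iteratedFDeriv_succ_eq_comp_right
  rw [hcurry]
  exact LinearIsometryEquiv.comp_differentiableOn_iff _

theorem norm_iteratedFDeriv_zero_sub (f g : E → F) (x : E) :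
    ‖iteratedFDeriv ℝ 0 f x - iteratedFDeriv ℝ 0 g x‖ = ‖f x - g x‖ := by
  simp only [iteratedFDeriv_zero_eq_comp, Function.comp_apply, ← map_sub,
    LinearIsometryEquiv.norm_map]

theorem norm_iteratedFDeriv_succ_sub (f g : E → F) (k : ℕ) (x : E) :
    ‖iteratedFDeriv ℝ (k + 1) f x - iteratedFDeriv ℝ (k + 1) g x‖ =
      ‖iteratedFDeriv ℝ k (fderiv ℝ f) x - iteratedFDeriv ℝ k (fderiv ℝ g) x‖ := by
  simp only [iteratedFDeriv_succ_eq_comp_right, Function.comp_apply, ← dist_eq_norm]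
  exact LinearIsometryEquiv.dist_map _ _ _

theorem iteratedFDeriv_sum_of_differentiableOn {ι : Type*} {s : Finset ι} {f : ι → E → F}
    (hN : IsOpen N) {m : ℕ} (h : ∀ i ∈ s, ∀ k < m, DifferentiableOn ℝ (iteratedFDeriv ℝ k (f i)) N)
    {k : ℕ} (hk : k ≤ m) {x : E} (hx : x ∈ N) :
    iteratedFDeriv ℝ k (fun y => ∑ i ∈ s, f i y) x = ∑ i ∈ s, iteratedFDeriv ℝ k (f i) x := by
  induction k generalizing x with
  | zero =>
    ext v
    simp
  | succ k ih =>
    have hev : iteratedFDeriv ℝ k (fun y => ∑ i ∈ s, f i y) =ᶠ[𝓝 x]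
        fun y => ∑ i ∈ s, iteratedFDeriv ℝ k (f i) y := by
      filter_upwards [hN.mem_nhds hx] with y hy using ih (by omega) hy
    ext v
    rw [iteratedFDeriv_succ_apply_left, hev.fderiv_eq,
      fderiv_fun_sum fun i hi => (h i hi k hk).differentiableAt (hN.mem_nhds hx)]
    simp only [sum_apply, iteratedFDeriv_succ_apply_left]

theorem differentiableOn_iteratedFDeriv_sum {ι : Type*} {s : Finset ι} {f : ι → E → F}
    (hN : IsOpen N) {m : ℕ} (h : ∀ i ∈ s, ∀ k < m, DifferentiableOn ℝ (iteratedFDeriv ℝ k (f i)) N)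
    {k : ℕ} (hk : k < m) :
    DifferentiableOn ℝ (iteratedFDeriv ℝ k fun y => ∑ i ∈ s, f i y) N :=
  (DifferentiableOn.fun_sum fun i hi => h i hi k hk).congr fun _ hx =>
    iteratedFDeriv_sum_of_differentiableOn hN h hk.le hx

end IteratedDerivatives

section ThreeDerivatives

set_option maxSynthPendingDepth 3

variable {E F G : Type*} [NormedAddCommGroup E] [NormedSpace ℝ E] [NormedAddCommGroup F]
  [NormedSpace ℝ F] [NormedAddCommGroup G] [NormedSpace ℝ G] {N : Set E}

/-- The functions `f₁`, `f₂`, `f₃` are the first three derivatives of `f` on `N`, as nested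
continuous linear maps; the third one need not be continuous. -/
structure HasThreeFDerivOn (f : E → F) (f₁ : E → E →L[ℝ] F) (f₂ : E → E →L[ℝ] E →L[ℝ] F)
    (f₃ : E → E →L[ℝ] E →L[ℝ] E →L[ℝ] F) (N : Set E) : Prop where
  first : ∀ x ∈ N, HasFDerivAt f (f₁ x) x
  second : ∀ x ∈ N, HasFDerivAt f₁ (f₂ x) x
  third : ∀ x ∈ N, HasFDerivAt f₂ (f₃ x) x

namespace HasThreeFDerivOn

variable {f : E → F} {f₁ : E → E →L[ℝ] F} {f₂ : E → E →L[ℝ] E →L[ℝ] F}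
  {f₃ : E → E →L[ℝ] E →L[ℝ] E →L[ℝ] F}

theorem fderiv_eq (h : HasThreeFDerivOn f f₁ f₂ f₃ N) {x : E} (hx : x ∈ N) :
    fderiv ℝ f x = f₁ x :=
  (h.first x hx).fderiv

theorem fderiv_fderiv_eq (h : HasThreeFDerivOn f f₁ f₂ f₃ N) (hN : IsOpen N) {x : E}
    (hx : x ∈ N) : fderiv ℝ (fderiv ℝ f) x = f₂ x := by
  have hev : fderiv ℝ f =ᶠ[𝓝 x] f₁ := by
    filter_upwards [hN.mem_nhds hx] with y hy using h.fderiv_eq hy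
  rw [hev.fderiv_eq, (h.second x hx).fderiv]

theorem fderiv_fderiv_fderiv_eq (h : HasThreeFDerivOn f f₁ f₂ f₃ N) (hN : IsOpen N) {x : E}
    (hx : x ∈ N) : fderiv ℝ (fderiv ℝ (fderiv ℝ f)) x = f₃ x := by
  have hev : fderiv ℝ (fderiv ℝ f) =ᶠ[𝓝 x] f₂ := by
    filter_upwards [hN.mem_nhds hx] with y hy using h.fderiv_fderiv_eq hN hy
  rw [hev.fderiv_eq, (h.third x hx).fderiv]

theorem norm_iteratedFDeriv_three (h : HasThreeFDerivOn f f₁ f₂ f₃ N) (hN : IsOpen N) {x : E}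
    (hx : x ∈ N) : ‖iteratedFDeriv ℝ 3 f x‖ = ‖f₃ x‖ := by
  rw [← norm_iteratedFDeriv_fderiv, ← norm_iteratedFDeriv_fderiv, ← norm_iteratedFDeriv_fderiv,
    norm_iteratedFDeriv_zero, h.fderiv_fderiv_fderiv_eq hN hx]

theorem differentiableOn_iteratedFDeriv (h : HasThreeFDerivOn f f₁ f₂ f₃ N) (hN : IsOpen N)
    {k : ℕ} (hk : k < 3) : DifferentiableOn ℝ (iteratedFDeriv ℝ k f) N := by
  interval_cases k
  · rw [differentiableOn_iteratedFDeriv_zero_iff]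
    exact fun x hx => (h.first x hx).differentiableAt.differentiableWithinAt
  · rw [differentiableOn_iteratedFDeriv_succ_iff, differentiableOn_iteratedFDeriv_zero_iff]
    exact fun x hx => ((h.second x hx).differentiableAt.differentiableWithinAt).congr
      (fun y hy => h.fderiv_eq hy) (h.fderiv_eq hx)
  · rw [differentiableOn_iteratedFDeriv_succ_iff, differentiableOn_iteratedFDeriv_succ_iff,
      differentiableOn_iteratedFDeriv_zero_iff]
    exact fun x hx => ((h.third x hx).differentiableAt.differentiableWithinAt).congr
      (fun y hy => h.fderiv_fderiv_eq hN hy) (h.fderiv_fderiv_eq hN hx)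

end HasThreeFDerivOn

theorem hasThreeFDerivOn_of_differentiableOn {f : E → F} (hN : IsOpen N)
    (h : ∀ k < 3, DifferentiableOn ℝ (iteratedFDeriv ℝ k f) N) :
    HasThreeFDerivOn f (fderiv ℝ f) (fderiv ℝ (fderiv ℝ f))
      (fderiv ℝ (fderiv ℝ (fderiv ℝ f))) N := by
  have h₀ : DifferentiableOn ℝ f N :=
    differentiableOn_iteratedFDeriv_zero_iff.1 (h 0 (by norm_num))
  have h₁ : DifferentiableOn ℝ (fderiv ℝ f) N :=
    differentiableOn_iteratedFDeriv_zero_iff.1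
      (differentiableOn_iteratedFDeriv_succ_iff.1 (h 1 (by norm_num)))
  have h₂ : DifferentiableOn ℝ (fderiv ℝ (fderiv ℝ f)) N :=
    differentiableOn_iteratedFDeriv_zero_iff.1 (differentiableOn_iteratedFDeriv_succ_iff.1
      (differentiableOn_iteratedFDeriv_succ_iff.1 (h 2 (by norm_num))))
  exact ⟨fun x hx => (h₀.differentiableAt (hN.mem_nhds hx)).hasFDerivAt,
    fun x hx => (h₁.differentiableAt (hN.mem_nhds hx)).hasFDerivAt,
    fun x hx => (h₂.differentiableAt (hN.mem_nhds hx)).hasFDerivAt⟩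

theorem hasThreeFDerivOn_of_contDiffOn {f : E → F} (hN : IsOpen N) (h : ContDiffOn ℝ 3 f N) :
    HasThreeFDerivOn f (fderiv ℝ f) (fderiv ℝ (fderiv ℝ f))
      (fderiv ℝ (fderiv ℝ (fderiv ℝ f))) N :=
  hasThreeFDerivOn_of_differentiableOn hN fun _ hk x hx =>
    ((h.contDiffAt (hN.mem_nhds hx)).differentiableAt_iteratedFDeriv
      (by exact_mod_cast hk)).differentiableWithinAt

/-- The second derivative of a composition, in terms of the first two derivatives `A`, `B` of the
outer function and `a`, `b` of the inner one: `(u, v) ↦ A (b u v) + B (a u) (a v)`. -/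
noncomputable def secondFDerivComp (A : G →L[ℝ] F) (B : G →L[ℝ] G →L[ℝ] F) (a : E →L[ℝ] G)
    (b : E →L[ℝ] E →L[ℝ] G) : E →L[ℝ] E →L[ℝ] F :=
  (ContinuousLinearMap.compL ℝ E G F A).comp b +
    ((ContinuousLinearMap.compL ℝ E G F).flip a).comp (B.comp a)

theorem secondFDerivComp_apply (A : G →L[ℝ] F) (B : G →L[ℝ] G →L[ℝ] F) (a : E →L[ℝ] G)
    (b : E →L[ℝ] E →L[ℝ] G) (u v : E) :
    secondFDerivComp A B a b u v = A (b u v) + B (a u) (a v) := rfl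

theorem norm_secondFDerivComp_sub_le (A A' : G →L[ℝ] F) (B B' : G →L[ℝ] G →L[ℝ] F)
    (a a' : E →L[ℝ] G) (b b' : E →L[ℝ] E →L[ℝ] G) :
    ‖secondFDerivComp A' B' a' b' - secondFDerivComp A B a b‖ ≤
      ‖A' - A‖ * ‖b'‖ + ‖A‖ * ‖b' - b‖ +
        (‖B' - B‖ * ‖a'‖ * ‖a'‖ + ‖B‖ * ‖a' - a‖ * ‖a'‖ + ‖B‖ * ‖a‖ * ‖a' - a‖) := by
  refine ContinuousLinearMap.opNorm_le_bound₂ _ (by positivity) fun u v => ?_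
  have htelescope : (secondFDerivComp A' B' a' b' - secondFDerivComp A B a b) u v =
      (A' - A) (b' u v) + A ((b' - b) u v) +
        ((B' - B) (a' u) (a' v) + B ((a' - a) u) (a' v) + B (a u) ((a' - a) v)) := by
    simp only [sub_apply, secondFDerivComp_apply, map_sub]
    abel
  have hlin : ∀ (S : G →L[ℝ] F) (T : E →L[ℝ] E →L[ℝ] G),
      ‖S (T u v)‖ ≤ ‖S‖ * (‖T‖ * ‖u‖ * ‖v‖) := fun S T =>
    S.le_opNorm_of_le (T.le_opNorm₂ u v)
  have hbilin : ∀ (S : G →L[ℝ] G →L[ℝ] F) (s t : E →L[ℝ] G),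
      ‖S (s u) (t v)‖ ≤ ‖S‖ * (‖s‖ * ‖u‖) * (‖t‖ * ‖v‖) := fun S s t =>
    (S.le_opNorm₂ _ _).trans (by gcongr <;> exact ContinuousLinearMap.le_opNorm _ _)
  rw [htelescope]
  refine (norm_add_le_of_le (norm_add_le_of_le (hlin _ _) (hlin _ _))
    (norm_add_le_of_le (norm_add_le_of_le (hbilin _ _ _) (hbilin _ _ _)) (hbilin _ _ _))).trans
      (le_of_eq ?_)
  ring

theorem norm_fderiv_clm_comp_le {H K : Type*} [NormedAddCommGroup H] [NormedSpace ℝ H]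
    [NormedAddCommGroup K] [NormedSpace ℝ K] {c : E → G →L[ℝ] H} {c' : E →L[ℝ] G →L[ℝ] H}
    {d : E → K →L[ℝ] G} {d' : E →L[ℝ] K →L[ℝ] G} {x : E} (hc : HasFDerivAt c c' x)
    (hd : HasFDerivAt d d' x) :
    ‖fderiv ℝ (fun y => (c y).comp (d y)) x‖ ≤ ‖c x‖ * ‖d'‖ + ‖c'‖ * ‖d x‖ := by
  rw [(hc.clm_comp hd).fderiv]
  refine norm_add_le_of_le ?_ ?_ <;>
    refine ContinuousLinearMap.opNorm_le_bound₂ _ (by positivity) fun u v => ?_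
  · calc ‖c x (d' u v)‖ ≤ ‖c x‖ * (‖d'‖ * ‖u‖ * ‖v‖) :=
          (c x).le_opNorm_of_le (d'.le_opNorm₂ u v)
      _ = ‖c x‖ * ‖d'‖ * ‖u‖ * ‖v‖ := by ring
  · calc ‖c' u (d x v)‖ ≤ ‖c'‖ * ‖u‖ * (‖d x‖ * ‖v‖) :=
          (c'.le_opNorm₂ _ _).trans (by gcongr; exact (d x).le_opNorm v)
      _ = ‖c'‖ * ‖d x‖ * ‖u‖ * ‖v‖ := by ring

section SecondFDerivComp

variable {A : E → G →L[ℝ] F} {A' : E →L[ℝ] G →L[ℝ] F} {B : E → G →L[ℝ] G →L[ℝ] F}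
  {B' : E →L[ℝ] G →L[ℝ] G →L[ℝ] F} {a : E → E →L[ℝ] G} {a' : E →L[ℝ] E →L[ℝ] G}
  {b : E → E →L[ℝ] E →L[ℝ] G} {b' : E →L[ℝ] E →L[ℝ] E →L[ℝ] G} {x : E}

theorem differentiableAt_secondFDerivComp (hA : HasFDerivAt A A' x) (hB : HasFDerivAt B B' x)
    (ha : HasFDerivAt a a' x) (hb : HasFDerivAt b b' x) :
    DifferentiableAt ℝ (fun y => secondFDerivComp (A y) (B y) (a y) (b y)) x :=
  ((((ContinuousLinearMap.compL ℝ E G F).hasFDerivAt.comp x hA).clm_comp hb).add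
    (((ContinuousLinearMap.compL ℝ E G F).flip.hasFDerivAt.comp x ha).clm_comp
      (hB.clm_comp ha))).differentiableAt

theorem norm_fderiv_secondFDerivComp_le (hA : HasFDerivAt A A' x) (hB : HasFDerivAt B B' x)
    (ha : HasFDerivAt a a' x) (hb : HasFDerivAt b b' x) :
    ‖fderiv ℝ (fun y => secondFDerivComp (A y) (B y) (a y) (b y)) x‖ ≤
      ‖A x‖ * ‖b'‖ + ‖A'‖ * ‖b x‖ +
        (‖a x‖ * (‖B x‖ * ‖a'‖ + ‖B'‖ * ‖a x‖) + ‖a'‖ * (‖B x‖ * ‖a x‖)) := by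
  set post := ContinuousLinearMap.compL ℝ E G F
  have hpost : ‖post‖ ≤ 1 := ContinuousLinearMap.norm_compL_le ℝ E G F
  have hpre : ‖post.flip‖ ≤ 1 := by rwa [ContinuousLinearMap.opNorm_flip]
  have hpost_apply : ‖post (A x)‖ ≤ ‖A x‖ := by
    simpa using post.le_of_opNorm_le hpost (A x)
  have hpre_apply : ‖post.flip (a x)‖ ≤ ‖a x‖ := by
    simpa using post.flip.le_of_opNorm_le hpre (a x)
  have hpost_comp : ‖post.comp A'‖ ≤ ‖A'‖ :=
    (post.opNorm_comp_le A').trans (mul_le_of_le_one_left (norm_nonneg _) hpost)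
  have hpre_comp : ‖post.flip.comp a'‖ ≤ ‖a'‖ :=
    (post.flip.opNorm_comp_le a').trans (mul_le_of_le_one_left (norm_nonneg _) hpre)
  have hpostA : HasFDerivAt (fun y => post (A y)) (post.comp A') x :=
    post.hasFDerivAt.comp x hA
  have hprea : HasFDerivAt (fun y => post.flip (a y)) (post.flip.comp a') x :=
    post.flip.hasFDerivAt.comp x ha
  have hBa := hB.clm_comp ha
  calc ‖fderiv ℝ (fun y => secondFDerivComp (A y) (B y) (a y) (b y)) x‖
      ≤ ‖fderiv ℝ (fun y => (post (A y)).comp (b y)) x‖ +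
          ‖fderiv ℝ (fun y => (post.flip (a y)).comp ((B y).comp (a y))) x‖ := by
        refine le_of_eq_of_le (congrArg norm ?_) (norm_add_le _ _)
        exact fderiv_fun_add (hpostA.clm_comp hb).differentiableAt
          (hprea.clm_comp hBa).differentiableAt
    _ ≤ (‖post (A x)‖ * ‖b'‖ + ‖post.comp A'‖ * ‖b x‖) +
          (‖post.flip (a x)‖ * ‖fderiv ℝ (fun y => (B y).comp (a y)) x‖ +
            ‖post.flip.comp a'‖ * ‖(B x).comp (a x)‖) :=
        add_le_add (norm_fderiv_clm_comp_le hpostA hb)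
          (norm_fderiv_clm_comp_le hprea hBa.differentiableAt.hasFDerivAt)
    _ ≤ ‖A x‖ * ‖b'‖ + ‖A'‖ * ‖b x‖ +
          (‖a x‖ * (‖B x‖ * ‖a'‖ + ‖B'‖ * ‖a x‖) + ‖a'‖ * (‖B x‖ * ‖a x‖)) := by
        gcongr
        · exact norm_fderiv_clm_comp_le hB ha
        · exact ContinuousLinearMap.opNorm_comp_le _ _

end SecondFDerivComp

namespace HasThreeFDerivOn

variable {f : G → F} {F₁ : G → G →L[ℝ] F} {F₂ : G → G →L[ℝ] G →L[ℝ] F}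
  {F₃ : G → G →L[ℝ] G →L[ℝ] G →L[ℝ] F} {U : Set G} {p : E → G} {p₁ : E → E →L[ℝ] G}
  {p₂ : E → E →L[ℝ] E →L[ℝ] G} {p₃ : E → E →L[ℝ] E →L[ℝ] E →L[ℝ] G}

theorem comp (hf : HasThreeFDerivOn f F₁ F₂ F₃ U) (hp : HasThreeFDerivOn p p₁ p₂ p₃ N)
    (hpU : MapsTo p N U) :
    HasThreeFDerivOn (fun x => f (p x)) (fun x => (F₁ (p x)).comp (p₁ x))
      (fun x => secondFDerivComp (F₁ (p x)) (F₂ (p x)) (p₁ x) (p₂ x))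
      (fderiv ℝ fun x => secondFDerivComp (F₁ (p x)) (F₂ (p x)) (p₁ x) (p₂ x)) N := by
  have hF₁ : ∀ x ∈ N, HasFDerivAt (fun x => F₁ (p x)) ((F₂ (p x)).comp (p₁ x)) x :=
    fun x hx => (hf.second _ (hpU hx)).comp x (hp.first x hx)
  refine ⟨fun x hx => (hf.first _ (hpU hx)).comp x (hp.first x hx),
    fun x hx => (hF₁ x hx).clm_comp (hp.second x hx), fun x hx => ?_⟩
  exact (differentiableAt_secondFDerivComp (hF₁ x hx)
    ((hf.third _ (hpU hx)).comp x (hp.first x hx)) (hp.second x hx) (hp.third x hx)).hasFDerivAt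

theorem norm_comp_third_le (hf : HasThreeFDerivOn f F₁ F₂ F₃ U)
    (hp : HasThreeFDerivOn p p₁ p₂ p₃ N) {x : E} (hx : x ∈ N) (hpx : p x ∈ U) :
    ‖fderiv ℝ (fun x => secondFDerivComp (F₁ (p x)) (F₂ (p x)) (p₁ x) (p₂ x)) x‖ ≤
      ‖F₃ (p x)‖ * ‖p₁ x‖ ^ 3 + 3 * ‖F₂ (p x)‖ * ‖p₁ x‖ * ‖p₂ x‖ + ‖F₁ (p x)‖ * ‖p₃ x‖ := by
  have hF₁ : HasFDerivAt (fun x => F₁ (p x)) ((F₂ (p x)).comp (p₁ x)) x :=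
    (hf.second _ hpx).comp x (hp.first x hx)
  have hF₂ : HasFDerivAt (fun x => F₂ (p x)) ((F₃ (p x)).comp (p₁ x)) x :=
    (hf.third _ hpx).comp x (hp.first x hx)
  have hF₁_norm : ‖(F₂ (p x)).comp (p₁ x)‖ ≤ ‖F₂ (p x)‖ * ‖p₁ x‖ :=
    ContinuousLinearMap.opNorm_comp_le _ _
  have hF₂_norm : ‖(F₃ (p x)).comp (p₁ x)‖ ≤ ‖F₃ (p x)‖ * ‖p₁ x‖ :=
    ContinuousLinearMap.opNorm_comp_le _ _
  calc ‖fderiv ℝ (fun x => secondFDerivComp (F₁ (p x)) (F₂ (p x)) (p₁ x) (p₂ x)) x‖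
      ≤ ‖F₁ (p x)‖ * ‖p₃ x‖ + ‖(F₂ (p x)).comp (p₁ x)‖ * ‖p₂ x‖ +
          (‖p₁ x‖ * (‖F₂ (p x)‖ * ‖p₂ x‖ + ‖(F₃ (p x)).comp (p₁ x)‖ * ‖p₁ x‖) +
            ‖p₂ x‖ * (‖F₂ (p x)‖ * ‖p₁ x‖)) :=
        norm_fderiv_secondFDerivComp_le hF₁ hF₂ (hp.second x hx) (hp.third x hx)
    _ ≤ ‖F₁ (p x)‖ * ‖p₃ x‖ + ‖F₂ (p x)‖ * ‖p₁ x‖ * ‖p₂ x‖ +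
          (‖p₁ x‖ * (‖F₂ (p x)‖ * ‖p₂ x‖ + ‖F₃ (p x)‖ * ‖p₁ x‖ * ‖p₁ x‖) +
            ‖p₂ x‖ * (‖F₂ (p x)‖ * ‖p₁ x‖)) := by gcongr
    _ = ‖F₃ (p x)‖ * ‖p₁ x‖ ^ 3 + 3 * ‖F₂ (p x)‖ * ‖p₁ x‖ * ‖p₂ x‖ + ‖F₁ (p x)‖ * ‖p₃ x‖ := by
        ring

end HasThreeFDerivOn

end ThreeDerivatives

section Bounded

set_option maxSynthPendingDepth 3

variable {F G : Type*} [NormedAddCommGroup F] [NormedSpace ℝ F] [NormedAddCommGroup G]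
  [NormedSpace ℝ G]

/-- The function `f` is of class `C³` on `U`, and its derivatives of order at most three are bounded
by `A` there. With `f` a log-likelihood, `A` is the value of an envelope at the observation. -/
structure IsC3BoundedOn (f : G → F) (U : Set G) (A : ℝ) : Prop where
  contDiffOn : ContDiffOn ℝ 3 f U
  norm_iteratedFDeriv_le : ∀ k ≤ 3, ∀ p ∈ U, ‖iteratedFDeriv ℝ k f p‖ ≤ A

namespace IsC3BoundedOn

variable {f : G → F} {U : Set G} {A : ℝ} {p a b : G}

theorem nonneg (h : IsC3BoundedOn f U A) (hp : p ∈ U) : 0 ≤ A :=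
  (norm_nonneg _).trans (h.norm_iteratedFDeriv_le 0 (by norm_num) p hp)

theorem norm_le (h : IsC3BoundedOn f U A) (hp : p ∈ U) : ‖f p‖ ≤ A := by
  simpa using h.norm_iteratedFDeriv_le 0 (by norm_num) p hp

theorem norm_fderiv_le (h : IsC3BoundedOn f U A) (hp : p ∈ U) : ‖fderiv ℝ f p‖ ≤ A := by
  simpa [← norm_iteratedFDeriv_fderiv] using h.norm_iteratedFDeriv_le 1 (by norm_num) p hp

theorem norm_fderiv_fderiv_le (h : IsC3BoundedOn f U A) (hp : p ∈ U) :
    ‖fderiv ℝ (fderiv ℝ f) p‖ ≤ A := by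
  simpa [← norm_iteratedFDeriv_fderiv] using h.norm_iteratedFDeriv_le 2 (by norm_num) p hp

theorem norm_fderiv_fderiv_fderiv_le (h : IsC3BoundedOn f U A) (hp : p ∈ U) :
    ‖fderiv ℝ (fderiv ℝ (fderiv ℝ f)) p‖ ≤ A := by
  simpa [← norm_iteratedFDeriv_fderiv] using h.norm_iteratedFDeriv_le 3 le_rfl p hp

theorem hasThreeFDerivOn (h : IsC3BoundedOn f U A) (hU : IsOpen U) :
    HasThreeFDerivOn f (fderiv ℝ f) (fderiv ℝ (fderiv ℝ f))
      (fderiv ℝ (fderiv ℝ (fderiv ℝ f))) U :=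
  hasThreeFDerivOn_of_contDiffOn hU h.contDiffOn

theorem isSymmSndFDerivAt (h : IsC3BoundedOn f U A) (hU : IsOpen U) (hp : p ∈ U) :
    IsSymmSndFDerivAt ℝ f p :=
  (h.contDiffOn.contDiffAt (hU.mem_nhds hp)).isSymmSndFDerivAt
    (by rw [minSmoothness_of_isRCLikeNormedField]; norm_num)

theorem norm_fderiv_sub_le (h : IsC3BoundedOn f U A) (hU : IsOpen U) (hab : segment ℝ a b ⊆ U) :
    ‖fderiv ℝ f b - fderiv ℝ f a‖ ≤ A * ‖b - a‖ :=
  (convex_segment a b).norm_image_sub_le_of_norm_hasFDerivWithin_le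
    (fun p hp => ((h.hasThreeFDerivOn hU).second p (hab hp)).hasFDerivWithinAt)
    (fun _ hp => h.norm_fderiv_fderiv_le (hab hp)) (left_mem_segment ℝ a b)
    (right_mem_segment ℝ a b)

theorem norm_fderiv_fderiv_sub_le (h : IsC3BoundedOn f U A) (hU : IsOpen U)
    (hab : segment ℝ a b ⊆ U) :
    ‖fderiv ℝ (fderiv ℝ f) b - fderiv ℝ (fderiv ℝ f) a‖ ≤ A * ‖b - a‖ :=
  (convex_segment a b).norm_image_sub_le_of_norm_hasFDerivWithin_le
    (fun p hp => ((h.hasThreeFDerivOn hU).third p (hab hp)).hasFDerivWithinAt)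
    (fun _ hp => h.norm_fderiv_fderiv_fderiv_le (hab hp)) (left_mem_segment ℝ a b)
    (right_mem_segment ℝ a b)

theorem norm_fderiv_sub_sub_le (h : IsC3BoundedOn f U A) (hU : IsOpen U)
    (hab : segment ℝ a b ⊆ U) :
    ‖fderiv ℝ f b - fderiv ℝ f a - fderiv ℝ (fderiv ℝ f) a (b - a)‖ ≤ A * ‖b - a‖ ^ 2 := by
  have hA : 0 ≤ A := h.nonneg (hab (left_mem_segment ℝ a b))
  have hvariation : ∀ p ∈ segment ℝ a b,
      ‖fderiv ℝ (fderiv ℝ f) p - fderiv ℝ (fderiv ℝ f) a‖ ≤ A * ‖b - a‖ := by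
    intro p hp
    have hap : segment ℝ a p ⊆ U :=
      ((convex_segment a b).segment_subset (left_mem_segment ℝ a b) hp).trans hab
    refine (h.norm_fderiv_fderiv_sub_le hU hap).trans (mul_le_mul_of_nonneg_left ?_ hA)
    obtain ⟨t, ht, rfl⟩ := (segment_eq_image' ℝ a b).subset hp
    rw [add_sub_cancel_left, norm_smul, Real.norm_of_nonneg ht.1]
    exact mul_le_of_le_one_left (norm_nonneg _) ht.2
  have hTaylor := (convex_segment a b).norm_image_sub_le_of_norm_hasFDerivWithin_le'
    (fun p hp => ((h.hasThreeFDerivOn hU).second p (hab hp)).hasFDerivWithinAt) hvariation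
    (left_mem_segment ℝ a b) (right_mem_segment ℝ a b)
  rwa [mul_assoc, ← sq] at hTaylor

end IsC3BoundedOn

end Bounded

section Graph

theorem norm_zero_mk {E V : Type*} [SeminormedAddCommGroup E] [SeminormedAddCommGroup V] (v : V) :
    ‖((0 : E), v)‖ = ‖v‖ := by
  rw [Prod.norm_mk, norm_zero, max_eq_right (norm_nonneg v)]

theorem norm_mk_sub_mk_left {E V : Type*} [SeminormedAddCommGroup E] [SeminormedAddCommGroup V]
    (x : E) (v w : V) : ‖(x, w) - (x, v)‖ = ‖w - v‖ := by
  rw [Prod.mk_sub_mk, sub_self, norm_zero_mk]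

set_option maxSynthPendingDepth 3

variable {E V F : Type*} [NormedAddCommGroup E] [NormedSpace ℝ E] [NormedAddCommGroup V]
  [NormedSpace ℝ V] [NormedAddCommGroup F] [NormedSpace ℝ F]

theorem hasDerivAt_add_smul (x e : E) (t : ℝ) : HasDerivAt (fun t : ℝ => x + t • e) e t := by
  simpa using ((hasDerivAt_id t).smul_const e).const_add x

theorem hasDerivAt_add_smul_prodMk {q : E → V} {x e : E} {t : ℝ}
    (hq : DifferentiableAt ℝ q (x + t • e)) :
    HasDerivAt (fun t : ℝ => (x + t • e, q (x + t • e))) (e, fderiv ℝ q (x + t • e) e) t :=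
  (hasDerivAt_add_smul x e t).prodMk (hq.hasFDerivAt.comp_hasDerivAt
    (f := fun t : ℝ => x + t • e) t (hasDerivAt_add_smul x e t))

theorem norm_id_prod_le (l : E →L[ℝ] V) : ‖(ContinuousLinearMap.id ℝ E).prod l‖ ≤ 1 + ‖l‖ := by
  rw [ContinuousLinearMap.opNorm_prod, Prod.norm_mk]
  exact max_le (ContinuousLinearMap.norm_id_le.trans (by simp)) (by simp)

theorem norm_mk_apply_le {l : E →L[ℝ] V} {C : ℝ} (hl : ‖l‖ ≤ C) (e : E) :
    ‖(e, l e)‖ ≤ (1 + C) * ‖e‖ :=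
  (((ContinuousLinearMap.id ℝ E).prod l).le_opNorm e).trans
    (by gcongr; exact (norm_id_prod_le l).trans (by linarith))

theorem norm_id_prod_sub_le (l l' : E →L[ℝ] V) :
    ‖(ContinuousLinearMap.id ℝ E).prod l' - (ContinuousLinearMap.id ℝ E).prod l‖ ≤ ‖l' - l‖ := by
  refine ContinuousLinearMap.opNorm_le_bound _ (norm_nonneg _) fun u => ?_
  change ‖(u, l' u) - (u, l u)‖ ≤ _
  rw [norm_mk_sub_mk_left]
  exact (l' - l).le_opNorm u

variable (E V) in
/-- Postcomposition with `v ↦ (0, v)`: the derivative of a linear map into `V` gives that of the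
linear map whose graph it is. -/
noncomputable def inrComp : (E →L[ℝ] V) →L[ℝ] E →L[ℝ] E × V :=
  ContinuousLinearMap.compL ℝ E V (E × V) (ContinuousLinearMap.inr ℝ E V)

variable (E V) in
/-- Postcomposition of a bilinear map with `v ↦ (0, v)`. -/
noncomputable def inrComp₂ : (E →L[ℝ] E →L[ℝ] V) →L[ℝ] E →L[ℝ] E →L[ℝ] E × V :=
  ContinuousLinearMap.compL ℝ E (E →L[ℝ] V) (E →L[ℝ] E × V) (inrComp E V)

theorem norm_inrComp_comp_le {K : Type*} [NormedAddCommGroup K] [NormedSpace ℝ K]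
    (T : K →L[ℝ] E →L[ℝ] V) : ‖(inrComp E V).comp T‖ ≤ ‖T‖ := by
  refine ContinuousLinearMap.opNorm_le_bound₂ _ (norm_nonneg _) fun u v => ?_
  change ‖((0 : E), T u v)‖ ≤ _
  rw [norm_zero_mk]
  exact T.le_opNorm₂ u v

theorem norm_inrComp₂_comp_le (T : E →L[ℝ] E →L[ℝ] E →L[ℝ] V) :
    ‖(inrComp₂ E V).comp T‖ ≤ ‖T‖ :=
  ContinuousLinearMap.opNorm_le_bound _ (norm_nonneg _) fun u =>
    (norm_inrComp_comp_le (T u)).trans (T.le_opNorm u)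

theorem HasThreeFDerivOn.graph {q : E → V} {q₁ : E → E →L[ℝ] V} {q₂ : E → E →L[ℝ] E →L[ℝ] V}
    {q₃ : E → E →L[ℝ] E →L[ℝ] E →L[ℝ] V} {N : Set E} (h : HasThreeFDerivOn q q₁ q₂ q₃ N) :
    HasThreeFDerivOn (fun x => (x, q x)) (fun x => (ContinuousLinearMap.id ℝ E).prod (q₁ x))
      (fun x => (inrComp E V).comp (q₂ x)) (fun x => (inrComp₂ E V).comp (q₃ x)) N := by
  refine ⟨fun x hx => (hasFDerivAt_id x).prodMk (h.first x hx), fun x hx => ?_, fun x hx =>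
    (inrComp₂ E V).hasFDerivAt.comp x (h.third x hx)⟩
  have hsplit : (fun x => (ContinuousLinearMap.id ℝ E).prod (q₁ x)) =
      fun x => ContinuousLinearMap.inl ℝ E V + inrComp E V (q₁ x) := by
    funext y
    ext u <;> simp [inrComp]
  rw [hsplit]
  exact ((inrComp E V).hasFDerivAt.comp x (h.second x hx)).const_add _

theorem norm_secondFDerivComp_sub_le_of_le {S S' : V →L[ℝ] F} {T T' : V →L[ℝ] V →L[ℝ] F}
    {a a' : E →L[ℝ] V} {b b' : E →L[ℝ] E →L[ℝ] V} {A s ρ : ℝ} (hs : 1 ≤ s) (hρ : 0 ≤ ρ)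
    (hS : ‖S‖ ≤ A) (hT : ‖T‖ ≤ A) (hSS : ‖S' - S‖ ≤ A * ρ) (hTT : ‖T' - T‖ ≤ A * ρ)
    (ha : ‖a‖ ≤ s) (ha' : ‖a'‖ ≤ s) (hb' : ‖b'‖ ≤ s) (haa : ‖a' - a‖ ≤ ρ) (hbb : ‖b' - b‖ ≤ ρ) :
    ‖secondFDerivComp S' T' a' b' - secondFDerivComp S T a b‖ ≤ A * (5 * s ^ 2) * ρ := by
  have hA : 0 ≤ A := (norm_nonneg _).trans hS
  calc ‖secondFDerivComp S' T' a' b' - secondFDerivComp S T a b‖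
      ≤ ‖S' - S‖ * ‖b'‖ + ‖S‖ * ‖b' - b‖ +
          (‖T' - T‖ * ‖a'‖ * ‖a'‖ + ‖T‖ * ‖a' - a‖ * ‖a'‖ + ‖T‖ * ‖a‖ * ‖a' - a‖) :=
        norm_secondFDerivComp_sub_le _ _ _ _ _ _ _ _
    _ ≤ A * ρ * s + A * ρ + (A * ρ * s * s + A * ρ * s + A * s * ρ) := by gcongr
    _ = A * (s ^ 2 + 3 * s + 1) * ρ := by ring
    _ ≤ A * (5 * s ^ 2) * ρ := by
        gcongr
        nlinarith

namespace IsC3BoundedOn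

variable {f : E × V → F} {U : Set (E × V)} {A : ℝ} {q q' : E → V} {N : Set E} {x : E}

theorem hasThreeFDerivOn_graph (h : IsC3BoundedOn f U A) (hU : IsOpen U) (hN : IsOpen N)
    (hq : ∀ k < 3, DifferentiableOn ℝ (iteratedFDeriv ℝ k q) N)
    (hmaps : ∀ x ∈ N, (x, q x) ∈ U) :
    HasThreeFDerivOn (fun x => f (x, q x))
      (fun x => (fderiv ℝ f (x, q x)).comp ((ContinuousLinearMap.id ℝ E).prod (fderiv ℝ q x)))
      (fun x => secondFDerivComp (fderiv ℝ f (x, q x)) (fderiv ℝ (fderiv ℝ f) (x, q x))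
        ((ContinuousLinearMap.id ℝ E).prod (fderiv ℝ q x))
        ((inrComp E V).comp (fderiv ℝ (fderiv ℝ q) x)))
      (fderiv ℝ fun x => secondFDerivComp (fderiv ℝ f (x, q x)) (fderiv ℝ (fderiv ℝ f) (x, q x))
        ((ContinuousLinearMap.id ℝ E).prod (fderiv ℝ q x))
        ((inrComp E V).comp (fderiv ℝ (fderiv ℝ q) x))) N :=
  (h.hasThreeFDerivOn hU).comp (hasThreeFDerivOn_of_differentiableOn hN hq).graph hmaps

theorem norm_iteratedFDeriv_three_graph_le (h : IsC3BoundedOn f U A) (hU : IsOpen U)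
    (hN : IsOpen N) (hq : ∀ k < 3, DifferentiableOn ℝ (iteratedFDeriv ℝ k q) N)
    (hmaps : ∀ x ∈ N, (x, q x) ∈ U) (hx : x ∈ N) {C : ℝ}
    (hC : ∀ k, 1 ≤ k → k ≤ 3 → ‖iteratedFDeriv ℝ k q x‖ ≤ C) :
    ‖iteratedFDeriv ℝ 3 (fun x => f (x, q x)) x‖ ≤ A * (5 * (1 + C) ^ 3) := by
  have h₁ : ‖fderiv ℝ q x‖ ≤ C := by
    simpa [← norm_iteratedFDeriv_fderiv] using hC 1 le_rfl (by norm_num)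
  have h₂ : ‖fderiv ℝ (fderiv ℝ q) x‖ ≤ C := by
    simpa [← norm_iteratedFDeriv_fderiv] using hC 2 (by norm_num) (by norm_num)
  have h₃ : ‖fderiv ℝ (fderiv ℝ (fderiv ℝ q)) x‖ ≤ C := by
    simpa [← norm_iteratedFDeriv_fderiv] using hC 3 (by norm_num) le_rfl
  have hp₁ := (norm_id_prod_le (fderiv ℝ q x)).trans (add_le_add_right h₁ 1)
  have hp₂ := (norm_inrComp_comp_le (fderiv ℝ (fderiv ℝ q) x)).trans h₂
  have hp₃ := (norm_inrComp₂_comp_le (fderiv ℝ (fderiv ℝ (fderiv ℝ q)) x)).trans h₃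
  have hC₀ : 0 ≤ C := (norm_nonneg _).trans h₁
  have hA : 0 ≤ A := h.nonneg (hmaps x hx)
  have hf₁ := h.norm_fderiv_le (hmaps x hx)
  have hf₂ := h.norm_fderiv_fderiv_le (hmaps x hx)
  have hf₃ := h.norm_fderiv_fderiv_fderiv_le (hmaps x hx)
  rw [(h.hasThreeFDerivOn_graph hU hN hq hmaps).norm_iteratedFDeriv_three hN hx]
  refine ((h.hasThreeFDerivOn hU).norm_comp_third_le
    (hasThreeFDerivOn_of_differentiableOn hN hq).graph hx (hmaps x hx)).trans ?_
  calc _ ≤ A * (1 + C) ^ 3 + 3 * A * (1 + C) * C + A * C := by gcongr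
    _ ≤ A * (5 * (1 + C) ^ 3) := by
        have hpoly : (1 + C) ^ 3 + 3 * (1 + C) * C + C ≤ 5 * (1 + C) ^ 3 := by
          nlinarith [pow_nonneg hC₀ 3, sq_nonneg C]
        nlinarith [mul_le_mul_of_nonneg_left hpoly hA]

theorem norm_iteratedFDeriv_two_graph_sub_le (h : IsC3BoundedOn f U A) (hU : IsOpen U)
    (hN : IsOpen N) (hq : ∀ k < 3, DifferentiableOn ℝ (iteratedFDeriv ℝ k q) N)
    (hq' : ∀ k < 3, DifferentiableOn ℝ (iteratedFDeriv ℝ k q') N)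
    (hmaps : ∀ x ∈ N, (x, q x) ∈ U) (hmaps' : ∀ x ∈ N, (x, q' x) ∈ U) (hx : x ∈ N)
    (hseg : segment ℝ (x, q x) (x, q' x) ⊆ U) {C ρ : ℝ}
    (hC : ∀ k ≤ 2, ‖iteratedFDeriv ℝ k q x‖ ≤ C)
    (hρ : ∀ k ≤ 2, ‖iteratedFDeriv ℝ k q' x - iteratedFDeriv ℝ k q x‖ ≤ ρ) :
    ‖iteratedFDeriv ℝ 2 (fun x => f (x, q' x)) x - iteratedFDeriv ℝ 2 (fun x => f (x, q x)) x‖ ≤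
      A * (5 * (1 + C + ρ) ^ 2) * ρ := by
  have hρ₀ : ‖q' x - q x‖ ≤ ρ := by
    simpa only [norm_iteratedFDeriv_zero_sub] using hρ 0 (by norm_num)
  have hρ₁ : ‖fderiv ℝ q' x - fderiv ℝ q x‖ ≤ ρ := by
    simpa only [norm_iteratedFDeriv_succ_sub, norm_iteratedFDeriv_zero_sub]
      using hρ 1 (by norm_num)
  have hρ₂ : ‖fderiv ℝ (fderiv ℝ q') x - fderiv ℝ (fderiv ℝ q) x‖ ≤ ρ := by
    simpa only [norm_iteratedFDeriv_succ_sub, norm_iteratedFDeriv_zero_sub] using hρ 2 le_rfl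
  have hC₁ : ‖fderiv ℝ q x‖ ≤ C := by
    simpa [← norm_iteratedFDeriv_fderiv] using hC 1 (by norm_num)
  have hC₂ : ‖fderiv ℝ (fderiv ℝ q) x‖ ≤ C := by
    simpa [← norm_iteratedFDeriv_fderiv] using hC 2 le_rfl
  have hA : 0 ≤ A := h.nonneg (hmaps x hx)
  have hC₀ : 0 ≤ C := (norm_nonneg _).trans hC₁
  have hρ_nonneg : 0 ≤ ρ := (norm_nonneg _).trans hρ₀
  have hq'₁ : ‖fderiv ℝ q' x‖ ≤ C + ρ :=
    (norm_le_norm_add_norm_sub' _ _).trans (add_le_add hC₁ hρ₁)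
  have hq'₂ : ‖fderiv ℝ (fderiv ℝ q') x‖ ≤ C + ρ :=
    (norm_le_norm_add_norm_sub' _ _).trans (add_le_add hC₂ hρ₂)
  have hstep : A * ‖(x, q' x) - (x, q x)‖ ≤ A * ρ := by
    rw [norm_mk_sub_mk_left]
    gcongr
  rw [norm_iteratedFDeriv_succ_sub, norm_iteratedFDeriv_succ_sub, norm_iteratedFDeriv_zero_sub,
    (h.hasThreeFDerivOn_graph hU hN hq hmaps).fderiv_fderiv_eq hN hx,
    (h.hasThreeFDerivOn_graph hU hN hq' hmaps').fderiv_fderiv_eq hN hx]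
  refine norm_secondFDerivComp_sub_le_of_le (by linarith) hρ_nonneg
    (h.norm_fderiv_le (hmaps x hx)) (h.norm_fderiv_fderiv_le (hmaps x hx))
    ((h.norm_fderiv_sub_le hU hseg).trans hstep)
    ((h.norm_fderiv_fderiv_sub_le hU hseg).trans hstep)
    ((norm_id_prod_le _).trans (by linarith)) ((norm_id_prod_le _).trans (by linarith))
    ((norm_inrComp_comp_le _).trans (by linarith)) ((norm_id_prod_sub_le _ _).trans hρ₁) ?_
  rw [← ContinuousLinearMap.comp_sub]
  exact (norm_inrComp_comp_le _).trans hρ₂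

theorem fderiv_graph_apply (h : IsC3BoundedOn f U A) (hU : IsOpen U) (hq : DifferentiableAt ℝ q x)
    (hx : (x, q x) ∈ U) (e : E) :
    fderiv ℝ (fun x => f (x, q x)) x e = fderiv ℝ f (x, q x) (e, fderiv ℝ q x e) :=
  congr($(((((h.hasThreeFDerivOn hU).first _ hx).comp x
    ((hasFDerivAt_id x).prodMk hq.hasFDerivAt)).fderiv)) e)

theorem norm_fderiv_graph_sub_sub_le (h : IsC3BoundedOn f U A) (hU : IsOpen U)
    (hq : DifferentiableAt ℝ q x) (hq' : DifferentiableAt ℝ q' x)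
    (hseg : segment ℝ (x, q x) (x, q' x) ⊆ U) {C ρ : ℝ} (hC : ‖fderiv ℝ q x‖ ≤ C)
    (hρ₀ : ‖q' x - q x‖ ≤ ρ) (hρ₁ : ‖fderiv ℝ q' x - fderiv ℝ q x‖ ≤ ρ) (e : E) :
    ‖fderiv ℝ (fun x => f (x, q' x)) x e - fderiv ℝ (fun x => f (x, q x)) x e -
        (fderiv ℝ f (x, q x) (0, fderiv ℝ q' x e - fderiv ℝ q x e) +
          fderiv ℝ (fderiv ℝ f) (x, q x) (0, q' x - q x) (e, fderiv ℝ q x e))‖ ≤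
      A * (2 + C) * ρ ^ 2 * ‖e‖ := by
  have hx : (x, q x) ∈ U := hseg (left_mem_segment ℝ _ _)
  have hA : 0 ≤ A := h.nonneg hx
  have hρ : 0 ≤ ρ := (norm_nonneg _).trans hρ₀
  set P := fderiv ℝ f (x, q x)
  set P' := fderiv ℝ f (x, q' x)
  set T := fderiv ℝ (fderiv ℝ f) (x, q x)
  set l := fderiv ℝ q x
  set l' := fderiv ℝ q' x
  have hsplit : P' (e, l' e) - P (e, l e) - (P (0, l' e - l e) + T (0, q' x - q x) (e, l e)) =
      (P' - P - T (0, q' x - q x)) (e, l e) + (P' - P) (0, l' e - l e) := by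
    have hvec : (e, l' e) = (e, l e) + (0, l' e - l e) := by simp
    rw [hvec]
    simp only [sub_apply, map_add]
    abel
  have hTaylor : ‖P' - P - T (0, q' x - q x)‖ ≤ A * ρ ^ 2 := by
    have hbound := h.norm_fderiv_sub_sub_le hU hseg
    rw [norm_mk_sub_mk_left, Prod.mk_sub_mk, sub_self] at hbound
    exact hbound.trans (by gcongr)
  have hincrement : ‖P' - P‖ ≤ A * ρ := by
    refine (h.norm_fderiv_sub_le hU hseg).trans ?_
    rw [norm_mk_sub_mk_left]
    gcongr
  have hvec₁ : ‖(e, l e)‖ ≤ (1 + C) * ‖e‖ := norm_mk_apply_le hC e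
  have hvec₂ : ‖((0 : E), l' e - l e)‖ ≤ ρ * ‖e‖ := by
    rw [norm_zero_mk]
    exact (l' - l).le_of_opNorm_le hρ₁ e
  rw [h.fderiv_graph_apply hU hq hx, h.fderiv_graph_apply hU hq' (hseg (right_mem_segment ℝ _ _)),
    hsplit]
  calc ‖(P' - P - T (0, q' x - q x)) (e, l e) + (P' - P) (0, l' e - l e)‖
      ≤ A * ρ ^ 2 * ((1 + C) * ‖e‖) + A * ρ * (ρ * ‖e‖) :=
        norm_add_le_of_le
          (((P' - P - T (0, q' x - q x)).le_opNorm _).trans (by gcongr))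
          (((P' - P).le_opNorm _).trans (by gcongr))
    _ = A * (2 + C) * ρ ^ 2 * ‖e‖ := by ring

end IsC3BoundedOn

end Graph

section EmpiricalProcess

variable {Ω 𝒳 : Type*} [MeasurableSpace Ω] [MeasurableSpace 𝒳] {μ : Measure Ω} {P : Measure 𝒳}
  {X : ℕ → Ω → 𝒳}

theorem lintegral_enorm_sum_le_sqrt_sum_integral_sq [IsProbabilityMeasure μ] {ι : Type*}
    {s : Finset ι} {ξ : ι → Ω → ℝ} (hξ : ∀ i ∈ s, MemLp (ξ i) 2 μ)
    (hindep : Set.Pairwise s fun i j => IndepFun (ξ i) (ξ j) μ)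
    (hmean : ∀ i ∈ s, ∫ ω, ξ i ω ∂μ = 0) :
    ∫⁻ ω, ‖∑ i ∈ s, ξ i ω‖ₑ ∂μ ≤ ENNReal.ofReal (√(∑ i ∈ s, ∫ ω, ξ i ω ^ 2 ∂μ)) := by
  have hsum : MemLp (∑ i ∈ s, ξ i) 2 μ := memLp_finsetSum' s hξ
  have hsum_mean : ∫ ω, (∑ i ∈ s, ξ i) ω ∂μ = 0 := by
    simp only [Finset.sum_apply]
    rw [integral_finsetSum s fun i hi => (hξ i hi).integrable one_le_two]
    exact Finset.sum_eq_zero hmean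
  have hvar : ∫ ω, (∑ i ∈ s, ξ i) ω ^ 2 ∂μ = ∑ i ∈ s, ∫ ω, ξ i ω ^ 2 ∂μ := by
    rw [← variance_of_integral_eq_zero hsum.aemeasurable hsum_mean,
      IndepFun.variance_sum hξ hindep]
    exact Finset.sum_congr rfl fun i hi =>
      variance_of_integral_eq_zero (hξ i hi).aemeasurable (hmean i hi)
  calc ∫⁻ ω, ‖∑ i ∈ s, ξ i ω‖ₑ ∂μ
      = eLpNorm (∑ i ∈ s, ξ i) 1 μ := by
        simp only [eLpNorm_one_eq_lintegral_enorm, Finset.sum_apply]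
    _ ≤ eLpNorm (∑ i ∈ s, ξ i) 2 μ :=
        eLpNorm_le_eLpNorm_of_exponent_le one_le_two hsum.aestronglyMeasurable
    _ = ENNReal.ofReal (√(∑ i ∈ s, ∫ ω, ξ i ω ^ 2 ∂μ)) := by
        rw [hsum.eLpNorm_eq_integral_rpow_norm (by norm_num) (by norm_num), ← hvar,
          Real.sqrt_eq_rpow]
        norm_num

theorem lintegral_enorm_sum_comp_le [IsProbabilityMeasure μ] (hX : ∀ i, Measurable (X i))
    (hind : Pairwise fun i j => IndepFun (X i) (X j) μ) (hlaw : ∀ i, μ.map (X i) = P)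
    {m : 𝒳 → ℝ} (hm : MemLp m 2 P) (hmean : ∫ x, m x ∂P = 0) (n : ℕ) :
    ∫⁻ ω, ‖∑ i ∈ Finset.range n, m (X i ω)‖ₑ ∂μ ≤
      ENNReal.ofReal (√(n * ∫ x, m x ^ 2 ∂P)) := by
  have hmp : ∀ i, MeasurePreserving (X i) μ P := fun i => ⟨hX i, hlaw i⟩
  have hmX : ∀ i, AEMeasurable m (μ.map (X i)) := fun i => hlaw i ▸ hm.aemeasurable
  have hintegral : ∀ i, ∀ f : 𝒳 → ℝ, AEStronglyMeasurable f P →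
      ∫ ω, f (X i ω) ∂μ = ∫ x, f x ∂P := fun i f hf => by
    rw [← hlaw i, integral_map (hX i).aemeasurable (hlaw i ▸ hf)]
  refine (lintegral_enorm_sum_le_sqrt_sum_integral_sq (ξ := fun i ω => m (X i ω))
    (fun i _ => hm.comp_measurePreserving (hmp i))
    (fun i _ j _ hij => (hind hij).comp₀ (hX i).aemeasurable (hX j).aemeasurable (hmX i) (hmX j))
    fun i _ => (hintegral i m hm.aestronglyMeasurable).trans hmean).trans_eq ?_
  simp only [hintegral _ (fun x => m x ^ 2) (hm.aestronglyMeasurable.pow 2), Finset.sum_const,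
    Finset.card_range, nsmul_eq_mul]

theorem bigOP_enorm_one_div_mul_of_lintegral_le {R : ℕ → Ω → ℝ≥0∞} {σ : ℝ}
    (hR : ∀ n, AEMeasurable (R n) μ)
    (hle : ∀ n : ℕ, ∫⁻ ω, R n ω ∂μ ≤ ENNReal.ofReal (√(n * σ))) :
    BigOP μ (fun n ω => ‖(1 / n : ℝ)‖ₑ * R n ω) fun n => (n : ℝ) ^ (-(1 / 2) : ℝ) := by
  refine bigOP_of_lintegral_le (C := ENNReal.ofReal (√σ)) ENNReal.ofReal_ne_top
    (fun n => (hR n).const_mul _) ?_ fun n => ?_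
  · filter_upwards [eventually_gt_atTop 0] with n hn
    exact Real.rpow_pos_of_pos (Nat.cast_pos.2 hn) _
  rw [lintegral_const_mul' _ _ enorm_ne_top, Real.enorm_of_nonneg (by positivity)]
  refine (mul_le_mul_right (hle n) _).trans_eq ?_
  rw [← ENNReal.ofReal_mul (by positivity), ← ENNReal.ofReal_mul (by positivity),
    Real.sqrt_mul n.cast_nonneg, Real.rpow_neg n.cast_nonneg, ← Real.sqrt_eq_rpow, ← mul_assoc,
    one_div_mul_eq_div, Real.sqrt_div_self, mul_comm]

theorem bigOP_average (hX : ∀ i, Measurable (X i)) (hlaw : ∀ i, μ.map (X i) = P) {A : 𝒳 → ℝ}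
    (hA : Integrable A P) :
    BigOP μ (fun n ω => ‖(1 / n : ℝ)‖ₑ * ∑ i ∈ Finset.range n, ‖A (X i ω)‖ₑ) fun _ => 1 := by
  have hmeas : ∀ i, AEMeasurable (fun ω => ‖A (X i ω)‖ₑ) μ := fun i =>
    (hA.aestronglyMeasurable.enorm.comp_quasiMeasurePreserving
      (MeasurePreserving.quasiMeasurePreserving ⟨hX i, hlaw i⟩))
  have hlint : ∀ i, ∫⁻ ω, ‖A (X i ω)‖ₑ ∂μ = ∫⁻ x, ‖A x‖ₑ ∂P := fun i => by
    rw [← hlaw i, lintegral_map' (hlaw i ▸ hA.aestronglyMeasurable.enorm) (hX i).aemeasurable]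
  refine bigOP_of_lintegral_le (C := ∫⁻ x, ‖A x‖ₑ ∂P) hA.hasFiniteIntegral.ne
    (fun n => (Finset.aemeasurable_fun_sum _ fun i _ => hmeas i).const_mul _)
    (Eventually.of_forall fun _ => one_pos) fun n => ?_
  rw [lintegral_const_mul' _ _ enorm_ne_top, lintegral_finsetSum' _ fun i _ => hmeas i]
  simp only [hlint, Finset.sum_const, Finset.card_range, nsmul_eq_mul, ENNReal.ofReal_one, mul_one]
  rw [← mul_assoc, ← Real.enorm_natCast, ← enorm_mul, one_div]
  refine mul_le_of_le_one_left' ?_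
  rw [Real.enorm_eq_ofReal (by positivity)]
  exact ENNReal.ofReal_le_one.2 (inv_mul_le_one (a := (n : ℝ)))

theorem indicator_Iic_mul_eq (f : ℝ → ℝ) (z : ℝ) :
    (fun u => (if u ≤ z then 1 else 0) * f u) = (Iic z).indicator f := by
  ext u
  simp only [indicator_apply, mem_Iic, ite_mul, one_mul, zero_mul]

theorem eq_add_integral_step_mul_derivWithin {f : ℝ → ℝ} (hf : ContDiffOn ℝ 1 f (Icc 0 1))
    {z : ℝ} (hz : z ∈ Icc (0 : ℝ) 1) :
    f z = f 0 + ∫ u in Icc (0 : ℝ) 1, (if u ≤ z then 1 else 0) * derivWithin f (Icc 0 1) u := by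
  obtain ⟨hdiff, hcont⟩ := (contDiffOn_one_iff_derivWithin (uniqueDiffOn_Icc zero_lt_one)).1 hf
  have hsub : Icc 0 z ⊆ Icc (0 : ℝ) 1 := Icc_subset_Icc_right hz.2
  have hftc : ∫ u in (0 : ℝ)..z, derivWithin f (Icc 0 1) u = f z - f 0 := by
    refine intervalIntegral.integral_eq_sub_of_hasDerivAt_of_le hz.1 (hf.continuousOn.mono hsub)
      (fun x hx => ?_) ((uIcc_of_le hz.1 ▸ hcont.mono hsub).intervalIntegrable)
    exact (hdiff x (hsub (Ioo_subset_Icc_self hx))).hasDerivWithinAt.hasDerivAt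
      (Icc_mem_nhds hx.1 (hx.2.trans_le hz.2))
  have hinter : Icc 0 1 ∩ Iic z = Icc 0 z := by
    rw [← Ici_inter_Iic, inter_assoc, Iic_inter_Iic, min_eq_right hz.2, Ici_inter_Iic]
  rw [indicator_Iic_mul_eq, setIntegral_indicator measurableSet_Iic, hinter,
    integral_Icc_eq_integral_Ioc, ← intervalIntegral.integral_of_le hz.1, hftc,
    add_sub_cancel]

theorem sum_mul_eq_add_integral {ι : Type*} (s : Finset ι) (a z : ι → ℝ)
    (hz : ∀ i ∈ s, z i ∈ Icc (0 : ℝ) 1) {f : ℝ → ℝ} (hf : ContDiffOn ℝ 1 f (Icc 0 1)) :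
    ∑ i ∈ s, a i * f (z i) = f 0 * ∑ i ∈ s, a i +
      ∫ u in Icc (0 : ℝ) 1, (∑ i ∈ s, a i * (if u ≤ z i then 1 else 0)) *
        derivWithin f (Icc 0 1) u := by
  have hcont := ((contDiffOn_one_iff_derivWithin (uniqueDiffOn_Icc zero_lt_one)).1 hf).2
  have hint : ∀ i ∈ s, IntegrableOn
      (fun u => a i * ((if u ≤ z i then 1 else 0) * derivWithin f (Icc 0 1) u)) (Icc 0 1) :=
    fun i _ => Integrable.const_mul
      (indicator_Iic_mul_eq _ (z i) ▸ hcont.integrableOn_Icc.indicator measurableSet_Iic) _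
  simp only [Finset.sum_mul, mul_assoc]
  rw [integral_finsetSum s hint, Finset.mul_sum, ← Finset.sum_add_distrib]
  refine Finset.sum_congr rfl fun i hi => ?_
  rw [integral_const_mul, eq_add_integral_step_mul_derivWithin hf (hz i hi), mul_add,
    mul_comm (a i) (f 0)]

theorem enorm_sum_mul_le {ι : Type*} (s : Finset ι) (a z : ι → ℝ)
    (hz : ∀ i ∈ s, z i ∈ Icc (0 : ℝ) 1) {f : ℝ → ℝ} (hf : ContDiffOn ℝ 1 f (Icc 0 1)) :
    ‖∑ i ∈ s, a i * f (z i)‖ₑ ≤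
      (⨆ u ∈ Icc (0 : ℝ) 1, ‖f u‖ₑ) * ‖∑ i ∈ s, a i‖ₑ +
        (⨆ u ∈ Icc (0 : ℝ) 1, ‖derivWithin f (Icc 0 1) u‖ₑ) *
          ∫⁻ u in Icc (0 : ℝ) 1, ‖∑ i ∈ s, a i * (if u ≤ z i then 1 else 0)‖ₑ := by
  have hfin : ⨆ u ∈ Icc (0 : ℝ) 1, ‖derivWithin f (Icc 0 1) u‖ₑ ≠ ∞ := by
    obtain ⟨C, hC⟩ := isCompact_Icc.exists_bound_of_continuousOn
      ((contDiffOn_one_iff_derivWithin (uniqueDiffOn_Icc zero_lt_one)).1 hf).2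
    refine ne_top_of_le_ne_top (ENNReal.ofReal_ne_top (r := C)) (iSup₂_le fun u hu => ?_)
    exact (ofReal_norm _).symm.trans_le (ENNReal.ofReal_le_ofReal (hC u hu))
  rw [sum_mul_eq_add_integral s a z hz hf]
  refine (enorm_add_le _ _).trans (add_le_add ?_ ?_)
  · rw [enorm_mul]
    gcongr
    exact le_iSup₂_of_le 0 (left_mem_Icc.2 zero_le_one) le_rfl
  · refine (enorm_integral_le_lintegral_enorm _).trans ?_
    rw [← lintegral_const_mul' _ _ hfin]
    refine setLIntegral_mono' measurableSet_Icc fun u hu => ?_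
    rw [enorm_mul, mul_comm]
    gcongr
    exact le_iSup₂_of_le u hu le_rfl

variable {m : 𝒳 → ℝ} {Z : 𝒳 → ℝ}

theorem lintegral_enorm_sum_step_le [IsProbabilityMeasure μ] (hX : ∀ i, Measurable (X i))
    (hind : Pairwise fun i j => IndepFun (X i) (X j) μ) (hlaw : ∀ i, μ.map (X i) = P)
    (hZ : Measurable Z) (hm : MemLp m 2 P) (u : ℝ)
    (hmean : ∫ x, m x * (if u ≤ Z x then 1 else 0) ∂P = 0) (n : ℕ) :
    ∫⁻ ω, ‖∑ i ∈ Finset.range n, m (X i ω) * (if u ≤ Z (X i ω) then 1 else 0)‖ₑ ∂μ ≤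
      ENNReal.ofReal (√(n * ∫ x, m x ^ 2 ∂P)) := by
  have hstep : Measurable fun x => if u ≤ Z x then (1 : ℝ) else 0 :=
    Measurable.ite (measurableSet_le measurable_const hZ) measurable_const measurable_const
  have hle : ∀ x, ‖m x * (if u ≤ Z x then (1 : ℝ) else 0)‖ ≤ ‖m x‖ := fun x => by
    split_ifs <;> simp
  have hmem : MemLp (fun x => m x * (if u ≤ Z x then (1 : ℝ) else 0)) 2 P :=
    hm.mono (hm.aestronglyMeasurable.mul hstep.aestronglyMeasurable) (ae_of_all _ hle)
  refine (lintegral_enorm_sum_comp_le hX hind hlaw hmem hmean n).trans ?_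
  gcongr ENNReal.ofReal (√(n * ?_))
  exact integral_mono hmem.integrable_sq hm.integrable_sq fun x => sq_le_sq.2 (hle x)

theorem aemeasurable_enorm_sum_step [SFinite μ] (hX : ∀ i, Measurable (X i))
    (hlaw : ∀ i, μ.map (X i) = P) (hZ : Measurable Z) (hm : AEMeasurable m P) (n : ℕ)
    (κ : Measure ℝ) [SFinite κ] :
    AEMeasurable (fun p : Ω × ℝ =>
      ‖∑ i ∈ Finset.range n, m (X i p.1) * (if p.2 ≤ Z (X i p.1) then 1 else 0)‖ₑ)
      (μ.prod κ) := by
  refine (Finset.aemeasurable_fun_sum _ fun i _ => ?_).enorm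
  have hmX : AEMeasurable (fun ω => m (X i ω)) μ :=
    hm.comp_quasiMeasurePreserving (MeasurePreserving.quasiMeasurePreserving ⟨hX i, hlaw i⟩)
  have hstep : Measurable fun p : Ω × ℝ => if p.2 ≤ Z (X i p.1) then (1 : ℝ) else 0 :=
    Measurable.ite (measurableSet_le measurable_snd (hZ.comp ((hX i).comp measurable_fst)))
      measurable_const measurable_const
  exact hmX.comp_fst.mul hstep.aemeasurable

/-- The test function `F n ω` may depend on the sample: summation by parts moves its randomness out
of the sum, where only the step functions `1{u ≤ Z}` remain. -/
theorem bigOP_enorm_average_mul [IsProbabilityMeasure μ] (hX : ∀ i, Measurable (X i))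
    (hind : Pairwise fun i j => IndepFun (X i) (X j) μ) (hlaw : ∀ i, μ.map (X i) = P)
    (hZ : Measurable Z) (hZ01 : ∀ x, Z x ∈ Icc (0 : ℝ) 1) (hm : MemLp m 2 P)
    (hmean : ∀ u, ∫ x, m x * (if u ≤ Z x then 1 else 0) ∂P = 0)
    {F : ℕ → Ω → ℝ → ℝ} {r : ℕ → ℝ} (hr : ∀ n, 0 ≤ r n)
    (hF : WithProbTendingToOne μ fun n ω => ContDiffOn ℝ 1 (F n ω) (Icc 0 1))
    (hF0 : BigOP μ (fun n ω => ⨆ u ∈ Icc (0 : ℝ) 1, ‖F n ω u‖ₑ) r)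
    (hF1 : BigOP μ (fun n ω => ⨆ u ∈ Icc (0 : ℝ) 1, ‖derivWithin (F n ω) (Icc 0 1) u‖ₑ) r) :
    BigOP μ (fun n ω => ‖(1 / n : ℝ) * ∑ i ∈ Finset.range n, m (X i ω) * F n ω (Z (X i ω))‖ₑ)
      fun n => r n * (n : ℝ) ^ (-(1 / 2) : ℝ) := by
  have hstep := lintegral_enorm_sum_step_le hX hind hlaw hZ hm
  have hmeas := fun n => aemeasurable_enorm_sum_step hX hlaw hZ hm.aemeasurable n
    (volume.restrict (Icc 0 1))
  have hmean0 : ∫ x, m x ∂P = 0 := by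
    simpa only [(hZ01 _).1, if_true, mul_one] using hmean 0
  have hsum := bigOP_enorm_one_div_mul_of_lintegral_le (μ := μ)
    (fun n => (Finset.aemeasurable_fun_sum (Finset.range n) fun i _ =>
      hm.aemeasurable.comp_quasiMeasurePreserving
        (MeasurePreserving.quasiMeasurePreserving ⟨hX i, hlaw i⟩)).enorm)
    (lintegral_enorm_sum_comp_le hX hind hlaw hm hmean0)
  have hsteps := bigOP_enorm_one_div_mul_of_lintegral_le (μ := μ)
    (R := fun n ω => ∫⁻ u in Icc (0 : ℝ) 1,
      ‖∑ i ∈ Finset.range n, m (X i ω) * (if u ≤ Z (X i ω) then 1 else 0)‖ₑ)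
    (σ := ∫ x, m x ^ 2 ∂P) (fun n => (hmeas n).lintegral_prod_right') fun n => by
      rw [lintegral_lintegral_swap (hmeas n)]
      refine (lintegral_mono fun u => hstep u (hmean u) n).trans_eq ?_
      simp
  have hrate : ∀ n : ℕ, 0 ≤ (n : ℝ) ^ (-(1 / 2) : ℝ) := fun n => by positivity
  refine ((hF0.mul hsum hr hrate).add (hF1.mul hsteps hr hrate) fun n =>
    mul_nonneg (hr n) (hrate n)).mono hF fun n ω hFω => ?_
  rw [enorm_mul, mul_left_comm, mul_left_comm _ ‖(1 / n : ℝ)‖ₑ, ← mul_add]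
  exact mul_le_mul_right (enorm_sum_mul_le _ (fun i => m (X i ω)) (fun i => Z (X i ω))
    (fun i _ => hZ01 _) hFω) _

end EmpiricalProcess

section DifferentiationUnderIntegral

variable {𝒳 : Type*} [MeasurableSpace 𝒳] {P : Measure 𝒳}

theorem aestronglyMeasurable_of_hasDerivAt {F : ℝ → 𝒳 → ℝ} {F' : 𝒳 → ℝ} {t₀ : ℝ}
    (hF : ∀ᶠ t in 𝓝 t₀, AEStronglyMeasurable (F t) P)
    (hd : ∀ᵐ x ∂P, HasDerivAt (fun t => F t x) (F' x) t₀) : AEStronglyMeasurable F' P := by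
  classical
  refine aestronglyMeasurable_of_tendsto_ae (𝓝[≠] t₀)
    (f := fun t x => if AEStronglyMeasurable (F t) P then slope (fun s => F s x) t₀ t else 0)
    (fun t => ?_) ?_
  · by_cases ht : AEStronglyMeasurable (F t) P
    · simp only [ht, if_true, slope_def_module]
      exact (ht.sub hF.self_of_nhds).const_smul ((t - t₀)⁻¹)
    · simp only [ht, if_false]
      exact aestronglyMeasurable_const
  · filter_upwards [hd] with x hx
    refine (hasDerivAt_iff_tendsto_slope.1 hx).congr' ?_
    filter_upwards [nhdsWithin_le_nhds hF] with t ht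
    rw [if_pos ht]

theorem hasDerivAt_integral_comp_of_norm_le {G : Type*} [NormedAddCommGroup G] [NormedSpace ℝ G]
    {f : 𝒳 → G → ℝ} {f' : 𝒳 → G → G →L[ℝ] ℝ} {c c' : ℝ → 𝒳 → G} {U : Set G} {bound : 𝒳 → ℝ}
    {B ε : ℝ} (hε : 0 < ε)
    (hf : ∀ᵐ x ∂P, ∀ p ∈ U, HasFDerivAt (f x) (f' x p) p ∧ ‖f' x p‖ ≤ bound x)
    (hbound : Integrable bound P)
    (hc : ∀ x, ∀ t ∈ Metric.ball 0 ε,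
      c t x ∈ U ∧ HasDerivAt (fun t => c t x) (c' t x) t ∧ ‖c' t x‖ ≤ B)
    (hmeas : ∀ t ∈ Metric.ball 0 ε, AEStronglyMeasurable (fun x => f x (c t x)) P)
    (hint : Integrable (fun x => f x (c 0 x)) P) :
    Integrable (fun x => f' x (c 0 x) (c' 0 x)) P ∧
      HasDerivAt (fun t => ∫ x, f x (c t x) ∂P) (∫ x, f' x (c 0 x) (c' 0 x) ∂P) 0 := by
  have hderiv : ∀ᵐ x ∂P, ∀ t ∈ Metric.ball 0 ε,
      HasDerivAt (fun t => f x (c t x)) (f' x (c t x) (c' t x)) t := by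
    filter_upwards [hf] with x hx t ht
    exact (hx _ (hc x t ht).1).1.comp_hasDerivAt t (hc x t ht).2.1
  have hderiv_le : ∀ᵐ x ∂P, ∀ t ∈ Metric.ball 0 ε, ‖f' x (c t x) (c' t x)‖ ≤ bound x * B := by
    filter_upwards [hf] with x hx t ht
    have hle := (hx _ (hc x t ht).1).2
    exact (ContinuousLinearMap.le_opNorm _ _).trans
      (mul_le_mul hle (hc x t ht).2.2 (norm_nonneg _) ((norm_nonneg _).trans hle))
  have hball := Metric.ball_mem_nhds (0 : ℝ) hε
  have hmeas' : ∀ᶠ t in 𝓝 0, AEStronglyMeasurable (fun x => f x (c t x)) P := by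
    filter_upwards [hball] with t ht using hmeas t ht
  exact hasDerivAt_integral_of_dominated_loc_of_deriv_le hball hmeas' hint
    (aestronglyMeasurable_of_hasDerivAt hmeas'
      (hderiv.mono fun x hx => hx 0 (Metric.mem_ball_self hε)))
    hderiv_le (hbound.mul_const B) hderiv

theorem tendsto_smoothTransition_mul_sub (u z : ℝ) :
    Tendsto (fun k : ℕ => Real.smoothTransition (k * (z - u) + 1)) atTop
      (𝓝 (if u ≤ z then 1 else 0)) := by
  split_ifs with hu
  · refine tendsto_const_nhds.congr fun k => (Real.smoothTransition.one_of_one_le ?_).symm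
    exact le_add_of_nonneg_left (mul_nonneg k.cast_nonneg (sub_nonneg.2 hu))
  · have hneg : z - u < 0 := sub_neg.2 (not_le.1 hu)
    have hlim : Tendsto (fun k : ℕ => (k : ℝ) * (z - u) + 1) atTop atBot :=
      tendsto_atBot_add_const_right _ _ (tendsto_natCast_atTop_atTop.atTop_mul_const_of_neg hneg)
    refine tendsto_const_nhds.congr' ?_
    filter_upwards [hlim.eventually_le_atBot 0] with k hk
    exact (Real.smoothTransition.zero_of_nonpos hk).symm

theorem integral_mul_step_eq_zero {m : 𝒳 → ℝ} {Z : 𝒳 → ℝ} (hm : Integrable m P)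
    (hZ : Measurable Z) (h : ∀ φ : ℝ → ℝ, ContDiff ℝ 2 φ → ∫ x, m x * φ (Z x) ∂P = 0) (u : ℝ) :
    ∫ x, m x * (if u ≤ Z x then 1 else 0) ∂P = 0 := by
  set φ : ℕ → ℝ → ℝ := fun k z => Real.smoothTransition (k * (z - u) + 1)
  have hφ : ∀ k, ContDiff ℝ 2 (φ k) := fun k =>
    (Real.smoothTransition.contDiff (n := 2)).comp (by fun_prop)
  have hlim : Tendsto (fun k => ∫ x, m x * φ k (Z x) ∂P) atTop
      (𝓝 (∫ x, m x * (if u ≤ Z x then 1 else 0) ∂P)) := by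
    refine tendsto_integral_of_dominated_convergence (fun x => ‖m x‖)
      (fun k => hm.aestronglyMeasurable.mul
        ((hφ k).continuous.measurable.comp hZ).aestronglyMeasurable) hm.norm
      (fun k => ae_of_all _ fun x => ?_)
      (ae_of_all _ fun x => (tendsto_smoothTransition_mul_sub u (Z x)).const_mul (m x))
    rw [norm_mul, Real.norm_of_nonneg (Real.smoothTransition.nonneg _)]
    exact mul_le_of_le_one_right (norm_nonneg _) (Real.smoothTransition.le_one _)
  simp only [h _ (hφ _)] at hlim
  exact tendsto_nhds_unique hlim tendsto_const_nhds

end DifferentiationUnderIntegral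

namespace CondParamModel

section Score

variable {d : ℕ} {𝒴 𝒲 : Type*} [MeasurableSpace 𝒴] [MeasurableSpace 𝒲]

/-- The interior of the set of all pairs `(θ, λ)`, on which the log-likelihood is smooth. -/
abbrev interiorParam (M : CondParamModel d 𝒴 𝒲) : Set (EuclideanSpace ℝ (Fin d) × ℝ) :=
  interior M.Θ ×ˢ interior M.H

/-- The log-likelihood of one observation as a function of the pair `(θ, λ)`, so that joint
derivatives can be taken. -/
noncomputable abbrev logDensity (M : CondParamModel d 𝒴 𝒲) (x : 𝒴 × (𝒲 × unitInterval)) :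
    EuclideanSpace ℝ (Fin d) × ℝ → ℝ :=
  fun p => M.loglik x p.1 p.2

/-- The score of one observation for the nuisance parameter: the partial derivative of the
log-likelihood in `λ`. -/
noncomputable def score (M : CondParamModel d 𝒴 𝒲) (x : 𝒴 × (𝒲 × unitInterval))
    (p : EuclideanSpace ℝ (Fin d) × ℝ) : ℝ :=
  fderiv ℝ (M.logDensity x) p (0, 1)

/-- The derivative at `θ` in the direction `e` of the score along the curve `η`. -/
noncomputable def scoreDeriv (M : CondParamModel d 𝒴 𝒲) (η : EuclideanSpace ℝ (Fin d) → ℝ → ℝ)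
    (θ e : EuclideanSpace ℝ (Fin d)) (x : 𝒴 × (𝒲 × unitInterval)) : ℝ :=
  fderiv ℝ (M.score x) (θ, η θ x.2.2) (e, fderiv ℝ (fun t => η t x.2.2) θ e)

variable {M : CondParamModel d 𝒴 𝒲} {θ₀ θ : EuclideanSpace ℝ (Fin d)} {η₀ η φ : ℝ → ℝ}
  {A : 𝒴 × (𝒲 × unitInterval) → ℝ}

theorem isOpen_interiorParam (M : CondParamModel d 𝒴 𝒲) : IsOpen M.interiorParam :=
  isOpen_interior.prod isOpen_interior

theorem ConditionK2.exists_isC3BoundedOn (h : M.ConditionK2 θ₀ η₀) :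
    ∃ A, MemLp A 2 (M.law θ₀ η₀) ∧
      ∀ᵐ x ∂(M.law θ₀ η₀), IsC3BoundedOn (M.logDensity x) M.interiorParam (A x) := by
  obtain ⟨-, hsmooth, henvelope⟩ := h
  choose A hA hAx using fun k : Fin 4 => henvelope k (by omega)
  refine ⟨fun x => ∑ k, |A k x|, memLp_finsetSum _ fun k _ => (hA k).abs, ?_⟩
  filter_upwards [hsmooth, ae_all_iff.2 hAx] with x hx hAx
  refine ⟨hx.of_le (by norm_num), fun k hk p hp => ?_⟩
  calc ‖iteratedFDeriv ℝ k (M.logDensity x) p‖ ≤ A ⟨k, by omega⟩ x :=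
        hAx ⟨k, by omega⟩ p.1 hp.1 p.2 hp.2
    _ ≤ |A ⟨k, by omega⟩ x| := le_abs_self _
    _ ≤ ∑ k, |A k x| := Finset.single_le_sum (f := fun k => |A k x|)
        (fun _ _ => abs_nonneg _) (Finset.mem_univ _)

theorem hasFDerivAt_score {x : 𝒴 × (𝒲 × unitInterval)} {p : EuclideanSpace ℝ (Fin d) × ℝ} {a : ℝ}
    (h : IsC3BoundedOn (M.logDensity x) M.interiorParam a) (hp : p ∈ M.interiorParam) :
    HasFDerivAt (M.score x) ((fderiv ℝ (fderiv ℝ (M.logDensity x)) p).flip (0, 1)) p :=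
  ((ContinuousLinearMap.apply ℝ ℝ ((0, 1) : EuclideanSpace ℝ (Fin d) × ℝ)).hasFDerivAt.comp p
    ((h.hasThreeFDerivOn M.isOpen_interiorParam).second p hp))

theorem abs_score_le {x : 𝒴 × (𝒲 × unitInterval)} {p : EuclideanSpace ℝ (Fin d) × ℝ} {a : ℝ}
    (h : IsC3BoundedOn (M.logDensity x) M.interiorParam a) (hp : p ∈ M.interiorParam) :
    |M.score x p| ≤ a := by
  have hle := (fderiv ℝ (M.logDensity x) p).le_opNorm (0, 1)
  rw [norm_zero_mk, norm_one, mul_one] at hle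
  exact hle.trans (h.norm_fderiv_le hp)

theorem norm_fderiv_score_le {x : 𝒴 × (𝒲 × unitInterval)} {p : EuclideanSpace ℝ (Fin d) × ℝ} {a : ℝ}
    (h : IsC3BoundedOn (M.logDensity x) M.interiorParam a) (hp : p ∈ M.interiorParam) :
    ‖fderiv ℝ (M.score x) p‖ ≤ a := by
  have hle := (fderiv ℝ (fderiv ℝ (M.logDensity x)) p).flip.le_opNorm (0, 1)
  rw [norm_zero_mk, norm_one, mul_one, ContinuousLinearMap.opNorm_flip] at hle
  rw [(hasFDerivAt_score h hp).fderiv]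
  exact hle.trans (h.norm_fderiv_fderiv_le hp)

theorem measurable_loglik_comp (hθ : θ ∈ M.Θ) (hη : ContinuousOn η (Icc 0 1))
    (hηH : ∀ z ∈ Icc (0 : ℝ) 1, η z ∈ M.H) :
    Measurable fun x : 𝒴 × (𝒲 × unitInterval) => M.loglik x θ (η x.2.2) := by
  have hcont : Continuous fun z : unitInterval => (⟨η z, hηH z z.2⟩ : M.H) :=
    (continuousOn_iff_continuous_domRestrict.1 hη).subtype_mk _
  have hmeas : Measurable fun x : 𝒴 × (𝒲 × unitInterval) =>
      (x, (⟨η x.2.2, hηH x.2.2 x.2.2.2⟩ : M.H)) :=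
    measurable_id.prodMk (hcont.measurable.comp (measurable_snd.comp measurable_snd))
  exact Real.measurable_log.comp ((M.measurable_lik θ hθ).comp hmeas).coe_nnreal_real

theorem integrable_loglik_comp (hA : Integrable A (M.law θ₀ η₀))
    (hreg : ∀ᵐ x ∂(M.law θ₀ η₀), IsC3BoundedOn (M.logDensity x) M.interiorParam (A x))
    (hθ : θ ∈ interior M.Θ) (hη : η ∈ M.nuisanceSpace) :
    Integrable (fun x => M.loglik x θ (η x.2.2)) (M.law θ₀ η₀) := by
  refine hA.mono' (measurable_loglik_comp (interior_subset hθ) hη.1.continuousOn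
    fun z hz => interior_subset (hη.2 z hz)).aestronglyMeasurable ?_
  filter_upwards [hreg] with x hx
  exact hx.norm_le (p := (θ, η x.2.2)) ⟨hθ, hη.2 _ x.2.2.2⟩

theorem exists_forall_norm_sub_lt_mem_interior (hη : η ∈ M.nuisanceSpace) :
    ∃ ρ > 0, ∀ z ∈ Icc (0 : ℝ) 1, ∀ l, ‖l - η z‖ < ρ → l ∈ interior M.H := by
  obtain ⟨ρ, hρ, hsub⟩ := (isCompact_Icc.image_of_continuousOn
    hη.1.continuousOn).exists_thickening_subset_open isOpen_interior
      (image_subset_iff.2 hη.2 : η '' Icc 0 1 ⊆ interior M.H)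
  refine ⟨ρ, hρ, fun z hz l hl => hsub (Metric.mem_thickening_iff.2
    ⟨η z, mem_image_of_mem η hz, ?_⟩)⟩
  rwa [dist_eq_norm]

theorem exists_forall_add_mul_mem_nuisanceSpace (hη : η ∈ M.nuisanceSpace)
    (hφ : ContDiffOn ℝ 2 φ (Icc 0 1)) :
    ∃ ε > 0, ∀ t ∈ Metric.ball (0 : ℝ) ε, (fun z => η z + t * φ z) ∈ M.nuisanceSpace := by
  obtain ⟨C, hC⟩ := isCompact_Icc.exists_bound_of_continuousOn hφ.continuousOn
  have hC0 : 0 ≤ C := (norm_nonneg _).trans (hC 0 (left_mem_Icc.2 zero_le_one))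
  obtain ⟨ρ, hρ, hmem⟩ := exists_forall_norm_sub_lt_mem_interior hη
  refine ⟨ρ / (C + 1), by positivity, fun t ht =>
    ⟨hη.1.add (contDiffOn_const.mul hφ), fun z hz => hmem z hz _ ?_⟩⟩
  rw [mem_ball_zero_iff, lt_div_iff₀ (by positivity)] at ht
  calc ‖η z + t * φ z - η z‖ = ‖t‖ * ‖φ z‖ := by rw [add_sub_cancel_left, norm_mul]
    _ ≤ ‖t‖ * (C + 1) := by gcongr; exact (hC z hz).trans (by linarith)
    _ < ρ := ht

theorem fderiv_logDensity_zero_mk (x : 𝒴 × (𝒲 × unitInterval))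
    (p : EuclideanSpace ℝ (Fin d) × ℝ) (v : ℝ) :
    fderiv ℝ (M.logDensity x) p (0, v) = M.score x p * v := by
  rw [score, mul_comm, ← smul_eq_mul, ← map_smul, Prod.smul_mk, smul_zero, smul_eq_mul, mul_one]

theorem hasDerivAt_integral_loglik_add_mul (hA : Integrable A (M.law θ₀ η₀))
    (hreg : ∀ᵐ x ∂(M.law θ₀ η₀), IsC3BoundedOn (M.logDensity x) M.interiorParam (A x))
    (hθ : θ ∈ interior M.Θ) (hη : η ∈ M.nuisanceSpace) (hφ : ContDiffOn ℝ 2 φ (Icc 0 1)) :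
    Integrable (fun x => M.score x (θ, η x.2.2) * φ x.2.2) (M.law θ₀ η₀) ∧
      HasDerivAt (fun t => ∫ x, M.loglik x θ (η x.2.2 + t * φ x.2.2) ∂(M.law θ₀ η₀))
        (∫ x, M.score x (θ, η x.2.2) * φ x.2.2 ∂(M.law θ₀ η₀)) 0 := by
  obtain ⟨C, hC⟩ := isCompact_Icc.exists_bound_of_continuousOn hφ.continuousOn
  obtain ⟨ε, hε, hnuisance⟩ := exists_forall_add_mul_mem_nuisanceSpace hη hφ
  have hint : ∀ t ∈ Metric.ball (0 : ℝ) ε,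
      Integrable (fun x => M.loglik x θ (η x.2.2 + t * φ x.2.2)) (M.law θ₀ η₀) :=
    fun t ht => integrable_loglik_comp (η := fun z => η z + t * φ z) hA hreg hθ (hnuisance t ht)
  have hline : ∀ x : 𝒴 × (𝒲 × unitInterval), ∀ t : ℝ,
      HasDerivAt (fun t => (θ, η x.2.2 + t * φ x.2.2)) (0, φ x.2.2) t := fun x t =>
    (hasDerivAt_const t θ).prodMk
      (((hasDerivAt_id t).mul_const (φ x.2.2)).const_add (η x.2.2) |>.congr_deriv (one_mul _))
  have hderiv := hasDerivAt_integral_comp_of_norm_le (P := M.law θ₀ η₀) (U := M.interiorParam)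
    (f := M.logDensity) (f' := fun x => fderiv ℝ (M.logDensity x))
    (c := fun t x => (θ, η x.2.2 + t * φ x.2.2)) (c' := fun _ x => (0, φ x.2.2)) (B := C) hε
    (hreg.mono fun x hx p hp => ⟨(hx.hasThreeFDerivOn M.isOpen_interiorParam).first p hp,
      hx.norm_fderiv_le hp⟩) hA
    (fun x t ht => ⟨⟨hθ, (hnuisance t ht).2 _ x.2.2.2⟩, hline x t,
      (norm_zero_mk (φ x.2.2)).trans_le (hC _ x.2.2.2)⟩)
    (fun t ht => (hint t ht).1) (hint 0 (Metric.mem_ball_self hε))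
  simpa only [fderiv_logDensity_zero_mk, zero_mul, add_zero] using hderiv

variable [IsFiniteMeasure (M.law θ₀ η₀)]

theorem IsLeastFavorableAt.integral_loglik_le (h : M.IsLeastFavorableAt θ₀ η₀ θ η) {η' : ℝ → ℝ}
    (hη' : η' ∈ M.nuisanceSpace) :
    ∫ x, M.loglik x θ (η' x.2.2) ∂(M.law θ₀ η₀) ≤ ∫ x, M.loglik x θ (η x.2.2) ∂(M.law θ₀ η₀) := by
  have hm : MeasurableSpace.comap (fun x : 𝒴 × (𝒲 × unitInterval) => x.2.2) inferInstance ≤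
      (inferInstance : MeasurableSpace (𝒴 × (𝒲 × unitInterval))) :=
    (measurable_snd.comp measurable_snd).comap_le
  have hle := integral_mono_ae integrable_condExp integrable_condExp (h.2 η' hη')
  rwa [integral_condExp hm, integral_condExp hm] at hle

theorem IsLeastFavorableAt.integral_score_mul_eq_zero (h : M.IsLeastFavorableAt θ₀ η₀ θ η)
    (hθ : θ ∈ interior M.Θ) (hA : Integrable A (M.law θ₀ η₀))
    (hreg : ∀ᵐ x ∂(M.law θ₀ η₀), IsC3BoundedOn (M.logDensity x) M.interiorParam (A x))
    (hφ : ContDiffOn ℝ 2 φ (Icc 0 1)) :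
    ∫ x, M.score x (θ, η x.2.2) * φ x.2.2 ∂(M.law θ₀ η₀) = 0 := by
  obtain ⟨ε, hε, hnuisance⟩ := exists_forall_add_mul_mem_nuisanceSpace h.1 hφ
  have hmax : IsLocalMax
      (fun t => ∫ x, M.loglik x θ (η x.2.2 + t * φ x.2.2) ∂(M.law θ₀ η₀)) 0 := by
    filter_upwards [Metric.ball_mem_nhds 0 hε] with t ht
    simpa only [zero_mul, add_zero] using h.integral_loglik_le (hnuisance t ht)
  exact hmax.hasDerivAt_eq_zero (hasDerivAt_integral_loglik_add_mul hA hreg hθ h.1 hφ).2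

theorem IsLeastFavorableAt.integral_scoreDeriv_mul_eq_zero
    {N : Set (EuclideanSpace ℝ (Fin d))} (hN : IsOpen N) (hθ₀ : θ₀ ∈ N) (hNΘ : N ⊆ interior M.Θ)
    {ηs : EuclideanSpace ℝ (Fin d) → ℝ → ℝ}
    (hηs : ∀ θ ∈ N, M.IsLeastFavorableAt θ₀ η₀ θ (ηs θ))
    (hdiff : ∀ θ ∈ N, ∀ z ∈ Icc (0 : ℝ) 1, DifferentiableAt ℝ (fun t => ηs t z) θ) {C : ℝ}
    (hC : ∀ θ ∈ N, ∀ z ∈ Icc (0 : ℝ) 1, ‖fderiv ℝ (fun t => ηs t z) θ‖ ≤ C)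
    (hA : Integrable A (M.law θ₀ η₀))
    (hreg : ∀ᵐ x ∂(M.law θ₀ η₀), IsC3BoundedOn (M.logDensity x) M.interiorParam (A x))
    (e : EuclideanSpace ℝ (Fin d)) (hφ : ContDiffOn ℝ 2 φ (Icc 0 1)) :
    Integrable (fun x => M.scoreDeriv ηs θ₀ e x * φ x.2.2) (M.law θ₀ η₀) ∧
      ∫ x, M.scoreDeriv ηs θ₀ e x * φ x.2.2 ∂(M.law θ₀ η₀) = 0 := by
  obtain ⟨D, hD⟩ := isCompact_Icc.exists_bound_of_continuousOn hφ.continuousOn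
  obtain ⟨ε, hε, hεN⟩ : ∃ ε > 0, ∀ t ∈ Metric.ball (0 : ℝ) ε, θ₀ + t • e ∈ N :=
    Metric.mem_nhds_iff.1 ((hasDerivAt_add_smul θ₀ e 0).continuousAt.preimage_mem_nhds
      (hN.mem_nhds (by simpa using hθ₀)))
  have hint := fun t (ht : t ∈ Metric.ball (0 : ℝ) ε) =>
    (hasDerivAt_integral_loglik_add_mul hA hreg (hNΘ (hεN t ht)) (hηs _ (hεN t ht)).1 hφ).1
  have hderiv := hasDerivAt_integral_comp_of_norm_le (P := M.law θ₀ η₀) (U := M.interiorParam)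
    (f := fun x p => M.score x p * φ x.2.2) (f' := fun x p => φ x.2.2 • fderiv ℝ (M.score x) p)
    (c := fun t x => (θ₀ + t • e, ηs (θ₀ + t • e) x.2.2))
    (c' := fun t x => (e, fderiv ℝ (fun t => ηs t x.2.2) (θ₀ + t • e) e))
    (bound := fun x => D * A x) (B := max ‖e‖ (C * ‖e‖)) hε
    (hreg.mono fun x hx p hp => ⟨(hasFDerivAt_score hx hp).differentiableAt.hasFDerivAt.mul_const _,
      (norm_smul _ _).trans_le (mul_le_mul (hD _ x.2.2.2) (norm_fderiv_score_le hx hp)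
        (norm_nonneg _) ((norm_nonneg _).trans (hD _ x.2.2.2)))⟩) (hA.const_mul D)
    (fun x t ht => ⟨⟨hNΘ (hεN t ht), (hηs _ (hεN t ht)).1.2 _ x.2.2.2⟩,
      hasDerivAt_add_smul_prodMk (hdiff _ (hεN t ht) _ x.2.2.2),
      max_le_max le_rfl (ContinuousLinearMap.le_of_opNorm_le _ (hC _ (hεN t ht) _ x.2.2.2) e)⟩)
    (fun t ht => (hint t ht).1) (hint 0 (Metric.mem_ball_self hε))
  have hconst : (fun t : ℝ => ∫ x, M.score x (θ₀ + t • e, ηs (θ₀ + t • e) x.2.2) * φ x.2.2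
      ∂(M.law θ₀ η₀)) =ᶠ[𝓝 0] fun _ => 0 := by
    filter_upwards [Metric.ball_mem_nhds 0 hε] with t ht using
      (hηs _ (hεN t ht)).integral_score_mul_eq_zero (hNΘ (hεN t ht)) hA hreg hφ
  have hzero := hderiv.2.unique ((hasDerivAt_const 0 0).congr_of_eventuallyEq hconst)
  simp only [zero_smul, add_zero, smul_apply, smul_eq_mul,
    mul_comm (φ _)] at hderiv hzero
  exact ⟨hderiv.1, hzero⟩

end Score

end CondParamModel

section Curves

variable {d : ℕ} {N N' : Set (EuclideanSpace ℝ (Fin d))} {θ : EuclideanSpace ℝ (Fin d)}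
  {η η' : EuclideanSpace ℝ (Fin d) → ℝ → ℝ} {s : ℕ} {z : ℝ}

/-- The uniform distance over `N × [0,1]` between the `s`-th derivatives in `θ` of two curves. -/
noncomputable def thetaDist (N : Set (EuclideanSpace ℝ (Fin d)))
    (η η' : EuclideanSpace ℝ (Fin d) → ℝ → ℝ) (s : ℕ) : ℝ≥0∞ :=
  ⨆ θ ∈ N, ⨆ z ∈ Icc (0 : ℝ) 1, ‖thetaDeriv η' s θ z - thetaDeriv η s θ z‖ₑ

/-- The uniform distance in `z` between the `z`-derivatives of the `s`-th derivatives in `θ` of two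
curves, at the point `θ`. -/
noncomputable def zDerivDist (θ : EuclideanSpace ℝ (Fin d))
    (η η' : EuclideanSpace ℝ (Fin d) → ℝ → ℝ) (s : ℕ) : ℝ≥0∞ :=
  ⨆ z ∈ Icc (0 : ℝ) 1, ‖derivWithin (fun u => thetaDeriv η' s θ u) (Icc 0 1) z -
    derivWithin (fun u => thetaDeriv η s θ u) (Icc 0 1) z‖ₑ

/-- The `C²`-distance in `θ` between two curves, uniformly in `z`. It controls the remainder
terms of the expansions of the profile log-likelihood. -/
noncomputable def curveDist (N : Set (EuclideanSpace ℝ (Fin d)))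
    (η η' : EuclideanSpace ℝ (Fin d) → ℝ → ℝ) : ℝ≥0∞ :=
  ∑ s ∈ Finset.range 3, thetaDist N η η' s

theorem thetaDist_mono (hN' : N' ⊆ N) : thetaDist N' η η' s ≤ thetaDist N η η' s :=
  biSup_mono hN'

theorem enorm_thetaDeriv_sub_le (hθ : θ ∈ N) (hz : z ∈ Icc (0 : ℝ) 1) :
    ‖thetaDeriv η' s θ z - thetaDeriv η s θ z‖ₑ ≤ thetaDist N η η' s :=
  (le_iSup₂ (f := fun z (_ : z ∈ Icc (0 : ℝ) 1) => ‖thetaDeriv η' s θ z - thetaDeriv η s θ z‖ₑ)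
    z hz).trans (le_iSup₂ (f := fun θ (_ : θ ∈ N) => ⨆ z ∈ Icc (0 : ℝ) 1,
      ‖thetaDeriv η' s θ z - thetaDeriv η s θ z‖ₑ) θ hθ)

theorem norm_thetaDeriv_sub_le {c : ℝ≥0∞} (hc : c ≠ ∞) (h : thetaDist N η η' s ≤ c) (hθ : θ ∈ N)
    (hz : z ∈ Icc (0 : ℝ) 1) : ‖thetaDeriv η' s θ z - thetaDeriv η s θ z‖ ≤ c.toReal := by
  rw [← toReal_enorm]
  exact ENNReal.toReal_mono hc ((enorm_thetaDeriv_sub_le hθ hz).trans h)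

theorem thetaDist_le_curveDist (hs : s ≤ 2) : thetaDist N η η' s ≤ curveDist N η η' :=
  Finset.single_le_sum (fun _ _ => zero_le) (Finset.mem_range.2 (by omega))

theorem thetaDeriv_zero_apply (v : Fin 0 → EuclideanSpace ℝ (Fin d)) :
    thetaDeriv η 0 θ z v = η θ z := rfl

theorem thetaDeriv_one_apply (v : Fin 1 → EuclideanSpace ℝ (Fin d)) :
    thetaDeriv η 1 θ z v = fderiv ℝ (fun t => η t z) θ (v 0) :=
  iteratedFDeriv_one_apply v

theorem norm_thetaDeriv_zero_sub :
    ‖thetaDeriv η' 0 θ z - thetaDeriv η 0 θ z‖ = ‖η' θ z - η θ z‖ :=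
  norm_iteratedFDeriv_zero_sub (fun t => η' t z) (fun t => η t z) θ

theorem norm_thetaDeriv_one : ‖thetaDeriv η 1 θ z‖ = ‖fderiv ℝ (fun t => η t z) θ‖ := by
  rw [thetaDeriv, ← norm_iteratedFDeriv_fderiv, norm_iteratedFDeriv_zero]

theorem norm_thetaDeriv_one_sub : ‖thetaDeriv η' 1 θ z - thetaDeriv η 1 θ z‖ =
    ‖fderiv ℝ (fun t => η' t z) θ - fderiv ℝ (fun t => η t z) θ‖ :=
  (norm_iteratedFDeriv_succ_sub (fun t => η' t z) (fun t => η t z) 0 θ).trans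
    (norm_iteratedFDeriv_zero_sub _ _ θ)

theorem ThriceDifferentiableOn.differentiableAt {f : EuclideanSpace ℝ (Fin d) → ℝ}
    (h : ThriceDifferentiableOn f N) (hN : IsOpen N) (hθ : θ ∈ N) : DifferentiableAt ℝ f θ :=
  (differentiableOn_iteratedFDeriv_zero_iff.1 (h 0 three_pos)).differentiableAt (hN.mem_nhds hθ)

namespace MixedDerivsExist

theorem mono (h : MixedDerivsExist η N) (hN' : N' ⊆ N) : MixedDerivsExist η N' :=
  ⟨fun z hz k hk => (h.1 z hz k hk).mono hN', fun θ hθ => h.2 θ (hN' hθ)⟩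

theorem contDiffOn_thetaDeriv (h : MixedDerivsExist η N) (hθ : θ ∈ N) (hs : s ≤ 1) :
    ContDiffOn ℝ 1 (fun z => thetaDeriv η s θ z) (Icc 0 1) := by
  have hdiff := h.2 θ hθ 0 s (by omega)
  have hdiff' := h.2 θ hθ 1 s (by omega)
  rw [iteratedDerivWithin_zero] at hdiff
  rw [iteratedDerivWithin_one] at hdiff'
  exact (contDiffOn_one_iff_derivWithin (uniqueDiffOn_Icc zero_lt_one)).2
    ⟨hdiff, hdiff'.continuousOn⟩

theorem contDiffOn_thetaDeriv_apply_sub (h : MixedDerivsExist η N) (h' : MixedDerivsExist η' N)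
    (hθ : θ ∈ N) (hs : s ≤ 1) (v : Fin s → EuclideanSpace ℝ (Fin d)) :
    ContDiffOn ℝ 1 (fun z => thetaDeriv η' s θ z v - thetaDeriv η s θ z v) (Icc 0 1) :=
  (ContinuousMultilinearMap.apply ℝ _ ℝ v).contDiff.comp_contDiffOn
    ((h'.contDiffOn_thetaDeriv hθ hs).sub (h.contDiffOn_thetaDeriv hθ hs))

theorem derivWithin_thetaDeriv_apply_sub (h : MixedDerivsExist η N) (h' : MixedDerivsExist η' N)
    (hθ : θ ∈ N) (hs : s ≤ 1) (v : Fin s → EuclideanSpace ℝ (Fin d)) (hz : z ∈ Icc (0 : ℝ) 1) :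
    derivWithin (fun z => thetaDeriv η' s θ z v - thetaDeriv η s θ z v) (Icc 0 1) z =
      (derivWithin (fun u => thetaDeriv η' s θ u) (Icc 0 1) z -
        derivWithin (fun u => thetaDeriv η s θ u) (Icc 0 1) z) v := by
  have hd := ((h.contDiffOn_thetaDeriv hθ hs).differentiableOn one_ne_zero z hz).hasDerivWithinAt
  have hd' := ((h'.contDiffOn_thetaDeriv hθ hs).differentiableOn one_ne_zero z hz).hasDerivWithinAt
  exact ((ContinuousMultilinearMap.apply ℝ _ ℝ v).hasFDerivAt.comp_hasDerivWithinAt z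
    (hd'.sub hd)).derivWithin (uniqueDiffOn_Icc zero_lt_one z hz)

end MixedDerivsExist

theorem iSup_enorm_thetaDeriv_apply_sub_le (hθ : θ ∈ N) {v : Fin s → EuclideanSpace ℝ (Fin d)}
    (hv : ‖v‖ ≤ 1) :
    ⨆ z ∈ Icc (0 : ℝ) 1, ‖thetaDeriv η' s θ z v - thetaDeriv η s θ z v‖ₑ ≤ thetaDist N η η' s :=
  iSup₂_le fun _ hz => (enorm_le_iff_norm_le.2 (ContinuousMultilinearMap.unit_le_opNorm
    (thetaDeriv η' s θ _ - thetaDeriv η s θ _) hv)).trans (enorm_thetaDeriv_sub_le hθ hz)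

theorem iSup_enorm_derivWithin_thetaDeriv_apply_sub_le (h : MixedDerivsExist η N)
    (h' : MixedDerivsExist η' N) (hθ : θ ∈ N) (hs : s ≤ 1)
    {v : Fin s → EuclideanSpace ℝ (Fin d)} (hv : ‖v‖ ≤ 1) :
    ⨆ z ∈ Icc (0 : ℝ) 1, ‖derivWithin (fun z => thetaDeriv η' s θ z v - thetaDeriv η s θ z v)
      (Icc 0 1) z‖ₑ ≤ zDerivDist θ η η' s :=
  iSup₂_mono fun z hz => by
    rw [h.derivWithin_thetaDeriv_apply_sub h' hθ hs v hz]
    exact enorm_le_iff_norm_le.2 (ContinuousMultilinearMap.unit_le_opNorm _ hv)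

theorem exists_ball_subset_forall_norm_sub_le (hN : IsOpen N) (hθ : θ ∈ N)
    (hdiff : ∀ t ∈ N, ∀ z ∈ Icc (0 : ℝ) 1, DifferentiableAt ℝ (fun t => η t z) t) {C : ℝ}
    (hC : ∀ t ∈ N, ∀ z ∈ Icc (0 : ℝ) 1, ‖fderiv ℝ (fun t => η t z) t‖ ≤ C) {ρ : ℝ} (hρ : 0 < ρ) :
    ∃ r > 0, Metric.ball θ r ⊆ N ∧
      ∀ t ∈ Metric.ball θ r, ∀ z ∈ Icc (0 : ℝ) 1, ‖η t z - η θ z‖ ≤ ρ := by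
  obtain ⟨r, hr, hrN⟩ := Metric.isOpen_iff.1 hN θ hθ
  have hC0 : 0 ≤ C := (norm_nonneg _).trans (hC θ hθ 0 (left_mem_Icc.2 zero_le_one))
  have hsub : Metric.ball θ (min r (ρ / (C + 1))) ⊆ Metric.ball θ r :=
    Metric.ball_subset_ball (min_le_left _ _)
  refine ⟨min r (ρ / (C + 1)), by positivity, hsub.trans hrN, fun t ht z hz => ?_⟩
  have hlt : ‖t - θ‖ * (C + 1) < ρ := by
    rw [← lt_div_iff₀ (by positivity), ← mem_ball_iff_norm]
    exact Metric.ball_subset_ball (min_le_right _ _) ht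
  calc ‖η t z - η θ z‖ ≤ C * ‖t - θ‖ :=
        (convex_ball θ r).norm_image_sub_le_of_norm_fderiv_le (𝕜 := ℝ) (f := fun t => η t z)
          (fun t ht => hdiff t (hrN ht) z hz) (fun t ht => hC t (hrN ht) z hz)
          (Metric.mem_ball_self hr) (hsub ht)
    _ ≤ ρ := by nlinarith [norm_nonneg (t - θ)]

end Curves

section Segments

theorem segment_mk_subset_prod {E V : Type*} [AddCommGroup E] [Module ℝ E] [AddCommGroup V]
    [Module ℝ V] {S : Set E} {T : Set V} {x : E} {a b : V} (hx : x ∈ S)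
    (h : segment ℝ a b ⊆ T) : segment ℝ (x, a) (x, b) ⊆ S ×ˢ T := by
  rw [← Prod.image_mk_segment_right]
  rintro _ ⟨y, hy, rfl⟩
  exact ⟨hx, h hy⟩

variable {d : ℕ} {𝒴 𝒲 : Type*} [MeasurableSpace 𝒴] [MeasurableSpace 𝒲]
  {M : CondParamModel d 𝒴 𝒲} {N : Set (EuclideanSpace ℝ (Fin d))} {θ₀ : EuclideanSpace ℝ (Fin d)}
  {ηs : EuclideanSpace ℝ (Fin d) → ℝ → ℝ}

/-- When `H` is not an interval, `η` can only be joined to `ηs` inside `H` if both curves stay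
close to `ηs θ₀`, which is why the neighborhood has to shrink. -/
theorem exists_isOpen_forall_segment_subset (hN : IsOpen N) (hθ₀ : θ₀ ∈ N)
    (hηs : ∀ θ ∈ N, ηs θ ∈ M.nuisanceSpace)
    (hdiff : ∀ θ ∈ N, ∀ z ∈ Icc (0 : ℝ) 1, DifferentiableAt ℝ (fun t => ηs t z) θ) {C : ℝ}
    (hC : ∀ θ ∈ N, ∀ z ∈ Icc (0 : ℝ) 1, ‖fderiv ℝ (fun t => ηs t z) θ‖ ≤ C) :
    ∃ N' ⊆ N, IsOpen N' ∧ θ₀ ∈ N' ∧ (M.H.OrdConnected → N' = N) ∧ ∃ ρ > 0,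
      ∀ η : EuclideanSpace ℝ (Fin d) → ℝ → ℝ, (∀ θ ∈ N, η θ ∈ M.nuisanceSpace) →
        thetaDist N ηs η 0 ≤ ENNReal.ofReal ρ →
        ∀ θ ∈ N', ∀ z ∈ Icc (0 : ℝ) 1, segment ℝ (ηs θ z) (η θ z) ⊆ interior M.H := by
  by_cases hH : M.H.OrdConnected
  · exact ⟨N, subset_rfl, hN, hθ₀, fun _ => rfl, 1, one_pos, fun η hη _ θ hθ z hz =>
      hH.convex.interior.segment_subset ((hηs θ hθ).2 z hz) ((hη θ hθ).2 z hz)⟩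
  obtain ⟨ρ, hρ, hmem⟩ := CondParamModel.exists_forall_norm_sub_lt_mem_interior (hηs θ₀ hθ₀)
  have hρ' : 0 < ρ / 3 := by positivity
  obtain ⟨r, hr, hrN, hnear⟩ := exists_ball_subset_forall_norm_sub_le hN hθ₀ hdiff hC hρ'
  refine ⟨Metric.ball θ₀ r, hrN, Metric.isOpen_ball, Metric.mem_ball_self hr,
    fun h => absurd h hH, ρ / 3, hρ', fun η _ hηρ θ hθ z hz l hl => hmem z hz l ?_⟩
  have hclose := norm_thetaDeriv_sub_le ENNReal.ofReal_ne_top hηρ (hrN hθ) hz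
  rw [norm_thetaDeriv_zero_sub, ENNReal.toReal_ofReal hρ'.le] at hclose
  calc ‖l - ηs θ₀ z‖ ≤ ‖l - ηs θ z‖ + ‖ηs θ z - ηs θ₀ z‖ := norm_sub_le_norm_sub_add_norm_sub ..
    _ ≤ ‖η θ z - ηs θ z‖ + ‖ηs θ z - ηs θ₀ z‖ := by
        gcongr
        exact norm_sub_le_of_mem_segment hl
    _ ≤ ρ / 3 + ρ / 3 := add_le_add hclose (hnear θ hθ z hz)
    _ < ρ := by linarith

end Segments

section Profile

theorem enorm_smul_sum_le {E : Type*} [NormedAddCommGroup E] [NormedSpace ℝ E] {n : ℕ}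
    {u : ℕ → E} {a : ℕ → ℝ} {B : ℝ} (c : ℝ) (h : ∀ i, ‖u i‖ ≤ a i * B) :
    ‖c • ∑ i ∈ Finset.range n, u i‖ₑ ≤
      (‖c‖ₑ * ∑ i ∈ Finset.range n, ‖a i‖ₑ) * ‖B‖ₑ := by
  rw [enorm_smul, mul_assoc, Finset.sum_mul]
  gcongr
  refine (enorm_sum_le _ _).trans (Finset.sum_le_sum fun i _ => ?_)
  rw [← enorm_mul]
  exact enorm_le_iff_norm_le.2 ((h i).trans (le_abs_self _))

namespace CondParamModel

variable {d : ℕ} {𝒴 𝒲 : Type*} [MeasurableSpace 𝒴] [MeasurableSpace 𝒲]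
  {M : CondParamModel d 𝒴 𝒲} {N : Set (EuclideanSpace ℝ (Fin d))} {θ : EuclideanSpace ℝ (Fin d)}
  {η η' : EuclideanSpace ℝ (Fin d) → ℝ → ℝ} {x : ℕ → 𝒴 × (𝒲 × unitInterval)} {a : ℕ → ℝ} {n : ℕ}
  {C ρ : ℝ}

/-- The curve `η` is three times differentiable in `θ` on `N`, and its graph stays in the interior
of the parameter space, so that log-likelihoods can be differentiated along it. -/
structure IsSmoothCurveOn (M : CondParamModel d 𝒴 𝒲)
    (η : EuclideanSpace ℝ (Fin d) → ℝ → ℝ) (N : Set (EuclideanSpace ℝ (Fin d))) : Prop where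
  thriceDifferentiableOn : ∀ z ∈ Icc (0 : ℝ) 1, ThriceDifferentiableOn (fun θ => η θ z) N
  mem_interiorParam : ∀ θ ∈ N, ∀ z ∈ Icc (0 : ℝ) 1, (θ, η θ z) ∈ M.interiorParam

namespace IsSmoothCurveOn

theorem thriceDifferentiableOn_loglik (hη : M.IsSmoothCurveOn η N) (hN : IsOpen N)
    {x : 𝒴 × (𝒲 × unitInterval)} {a : ℝ}
    (hx : IsC3BoundedOn (M.logDensity x) M.interiorParam a) :
    ThriceDifferentiableOn (fun θ => M.loglik x θ (η θ x.2.2)) N := fun _ hk =>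
  (hx.hasThreeFDerivOn_graph M.isOpen_interiorParam hN (hη.thriceDifferentiableOn _ x.2.2.2)
    fun θ hθ => hη.mem_interiorParam θ hθ _ x.2.2.2).differentiableOn_iteratedFDeriv hN hk

theorem thriceDifferentiableOn_profile (hη : M.IsSmoothCurveOn η N) (hN : IsOpen N)
    (hx : ∀ i, IsC3BoundedOn (M.logDensity (x i)) M.interiorParam (a i)) :
    ThriceDifferentiableOn (M.profile n x η) N := fun _ hk =>
  differentiableOn_iteratedFDeriv_sum hN
    (fun i _ => hη.thriceDifferentiableOn_loglik hN (hx i)) hk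

theorem iteratedFDeriv_profile (hη : M.IsSmoothCurveOn η N) (hN : IsOpen N)
    (hx : ∀ i, IsC3BoundedOn (M.logDensity (x i)) M.interiorParam (a i)) {k : ℕ} (hk : k ≤ 3)
    (hθ : θ ∈ N) :
    iteratedFDeriv ℝ k (M.profile n x η) θ = ∑ i ∈ Finset.range n,
      iteratedFDeriv ℝ k (fun θ => M.loglik (x i) θ (η θ (x i).2.2)) θ :=
  iteratedFDeriv_sum_of_differentiableOn hN
    (fun i _ => hη.thriceDifferentiableOn_loglik hN (hx i)) hk hθ

theorem fderiv_profile_apply (hη : M.IsSmoothCurveOn η N) (hN : IsOpen N)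
    (hx : ∀ i, IsC3BoundedOn (M.logDensity (x i)) M.interiorParam (a i)) (hθ : θ ∈ N)
    (e : EuclideanSpace ℝ (Fin d)) :
    fderiv ℝ (M.profile n x η) θ e = ∑ i ∈ Finset.range n,
      fderiv ℝ (fun θ => M.loglik (x i) θ (η θ (x i).2.2)) θ e := by
  simpa using congr($(hη.iteratedFDeriv_profile (n := n) hN hx (k := 1) (by norm_num) hθ)
    (fun _ => e))

theorem enorm_smul_iteratedFDeriv_three_profile_le (hη : M.IsSmoothCurveOn η N) (hN : IsOpen N)
    (hx : ∀ i, IsC3BoundedOn (M.logDensity (x i)) M.interiorParam (a i)) (hθ : θ ∈ N)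
    (hC : ∀ k, 1 ≤ k → k ≤ 3 → ∀ z ∈ Icc (0 : ℝ) 1, ‖thetaDeriv η k θ z‖ ≤ C) (c : ℝ) :
    ‖c • iteratedFDeriv ℝ 3 (M.profile n x η) θ‖ₑ ≤
      (‖c‖ₑ * ∑ i ∈ Finset.range n, ‖a i‖ₑ) * ‖5 * (1 + C) ^ 3‖ₑ := by
  rw [hη.iteratedFDeriv_profile hN hx le_rfl hθ]
  exact enorm_smul_sum_le c fun i =>
    (hx i).norm_iteratedFDeriv_three_graph_le M.isOpen_interiorParam hN
      (hη.thriceDifferentiableOn _ (x i).2.2.2)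
      (fun θ hθ => hη.mem_interiorParam θ hθ _ (x i).2.2.2) hθ
      fun k hk hk' => hC k hk hk' _ (x i).2.2.2

theorem enorm_smul_iteratedFDeriv_two_profile_sub_le (hη : M.IsSmoothCurveOn η N)
    (hη' : M.IsSmoothCurveOn η' N) (hN : IsOpen N)
    (hx : ∀ i, IsC3BoundedOn (M.logDensity (x i)) M.interiorParam (a i)) (hθ : θ ∈ N)
    (hseg : ∀ z ∈ Icc (0 : ℝ) 1, segment ℝ (θ, η θ z) (θ, η' θ z) ⊆ M.interiorParam)
    (hC : ∀ k ≤ 2, ∀ z ∈ Icc (0 : ℝ) 1, ‖thetaDeriv η k θ z‖ ≤ C)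
    (hρ : ∀ k ≤ 2, ∀ z ∈ Icc (0 : ℝ) 1, ‖thetaDeriv η' k θ z - thetaDeriv η k θ z‖ ≤ ρ) (c : ℝ) :
    ‖c • iteratedFDeriv ℝ 2 (M.profile n x η') θ - c • iteratedFDeriv ℝ 2 (M.profile n x η) θ‖ₑ ≤
      (‖c‖ₑ * ∑ i ∈ Finset.range n, ‖a i‖ₑ) * ‖5 * (1 + C + ρ) ^ 2 * ρ‖ₑ := by
  rw [hη.iteratedFDeriv_profile hN hx (by norm_num) hθ,
    hη'.iteratedFDeriv_profile hN hx (by norm_num) hθ, ← smul_sub, ← Finset.sum_sub_distrib]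
  refine enorm_smul_sum_le c fun i => ?_
  rw [← mul_assoc]
  exact (hx i).norm_iteratedFDeriv_two_graph_sub_le M.isOpen_interiorParam hN
    (hη.thriceDifferentiableOn _ (x i).2.2.2) (hη'.thriceDifferentiableOn _ (x i).2.2.2)
    (fun θ hθ => hη.mem_interiorParam θ hθ _ (x i).2.2.2)
    (fun θ hθ => hη'.mem_interiorParam θ hθ _ (x i).2.2.2) hθ (hseg _ (x i).2.2.2)
    (fun k hk => hC k hk _ (x i).2.2.2) fun k hk => hρ k hk _ (x i).2.2.2

end IsSmoothCurveOn

theorem norm_fderiv_loglik_sub_sub_le {x : 𝒴 × (𝒲 × unitInterval)} {a : ℝ}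
    (hx : IsC3BoundedOn (M.logDensity x) M.interiorParam a)
    (hη : DifferentiableAt ℝ (fun t => η t x.2.2) θ)
    (hη' : DifferentiableAt ℝ (fun t => η' t x.2.2) θ)
    (hseg : segment ℝ (θ, η θ x.2.2) (θ, η' θ x.2.2) ⊆ M.interiorParam)
    (hC : ‖thetaDeriv η 1 θ x.2.2‖ ≤ C)
    (hρ : ∀ k ≤ 1, ‖thetaDeriv η' k θ x.2.2 - thetaDeriv η k θ x.2.2‖ ≤ ρ)
    {e : EuclideanSpace ℝ (Fin d)} (he : ‖e‖ ≤ 1) :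
    ‖fderiv ℝ (fun θ => M.loglik x θ (η' θ x.2.2)) θ e -
        fderiv ℝ (fun θ => M.loglik x θ (η θ x.2.2)) θ e -
        (M.score x (θ, η θ x.2.2) *
            (thetaDeriv η' 1 θ x.2.2 (fun _ => e) - thetaDeriv η 1 θ x.2.2 (fun _ => e)) +
          M.scoreDeriv η θ e x *
            (thetaDeriv η' 0 θ x.2.2 (fun _ => e) - thetaDeriv η 0 θ x.2.2 (fun _ => e)))‖ ≤
      a * ((2 + C) * ρ ^ 2) := by
  have hp : (θ, η θ x.2.2) ∈ M.interiorParam := hseg (left_mem_segment ℝ _ _)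
  have ha : 0 ≤ a := hx.nonneg hp
  have hC₀ : 0 ≤ C := (norm_nonneg _).trans hC
  have hscore : ∀ v : ℝ, fderiv ℝ (fderiv ℝ (M.logDensity x)) (θ, η θ x.2.2) (0, v)
      (e, fderiv ℝ (fun t => η t x.2.2) θ e) = M.scoreDeriv η θ e x * v := fun v => by
    rw [scoreDeriv, (hasFDerivAt_score hx hp).fderiv, ContinuousLinearMap.flip_apply,
      (hx.isSymmSndFDerivAt M.isOpen_interiorParam hp).eq, mul_comm, ← smul_eq_mul, ← map_smul,
      Prod.smul_mk, smul_zero, smul_eq_mul, mul_one]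
  have hexp := hx.norm_fderiv_graph_sub_sub_le M.isOpen_interiorParam hη hη' hseg
    (norm_thetaDeriv_one.symm.trans_le hC)
    (norm_thetaDeriv_zero_sub.symm.trans_le (hρ 0 zero_le_one))
    (norm_thetaDeriv_one_sub.symm.trans_le (hρ 1 le_rfl)) e
  rw [hscore, fderiv_logDensity_zero_mk] at hexp
  simp only [thetaDeriv_one_apply, thetaDeriv_zero_apply]
  calc _ ≤ a * (2 + C) * ρ ^ 2 * ‖e‖ := hexp
    _ ≤ a * ((2 + C) * ρ ^ 2) := by
        rw [← mul_assoc]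
        exact mul_le_of_le_one_right (by positivity) he

theorem IsSmoothCurveOn.enorm_mul_fderiv_profile_sub_le (hη : M.IsSmoothCurveOn η N)
    (hη' : M.IsSmoothCurveOn η' N) (hN : IsOpen N)
    (hx : ∀ i, IsC3BoundedOn (M.logDensity (x i)) M.interiorParam (a i)) (hθ : θ ∈ N)
    (hseg : ∀ z ∈ Icc (0 : ℝ) 1, segment ℝ (θ, η θ z) (θ, η' θ z) ⊆ M.interiorParam)
    (hC : ∀ z ∈ Icc (0 : ℝ) 1, ‖thetaDeriv η 1 θ z‖ ≤ C)
    (hρ : ∀ k ≤ 1, ∀ z ∈ Icc (0 : ℝ) 1, ‖thetaDeriv η' k θ z - thetaDeriv η k θ z‖ ≤ ρ)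
    {e : EuclideanSpace ℝ (Fin d)} (he : ‖e‖ ≤ 1) (c : ℝ) :
    ‖c * (fderiv ℝ (M.profile n x η') θ e - fderiv ℝ (M.profile n x η) θ e)‖ₑ ≤
      ‖c * ∑ i ∈ Finset.range n, M.score (x i) (θ, η θ (x i).2.2) *
        (thetaDeriv η' 1 θ (x i).2.2 (fun _ => e) - thetaDeriv η 1 θ (x i).2.2 (fun _ => e))‖ₑ +
      ‖c * ∑ i ∈ Finset.range n, M.scoreDeriv η θ e (x i) *
        (thetaDeriv η' 0 θ (x i).2.2 (fun _ => e) - thetaDeriv η 0 θ (x i).2.2 (fun _ => e))‖ₑ +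
      (‖c‖ₑ * ∑ i ∈ Finset.range n, ‖a i‖ₑ) * ‖(2 + C) * ρ ^ 2‖ₑ := by
  rw [hη.fderiv_profile_apply hN hx hθ, hη'.fderiv_profile_apply hN hx hθ,
    ← Finset.sum_sub_distrib]
  have hrem := enorm_smul_sum_le (n := n) c fun i => norm_fderiv_loglik_sub_sub_le (hx i)
    ((hη.thriceDifferentiableOn _ (x i).2.2.2).differentiableAt hN hθ)
    ((hη'.thriceDifferentiableOn _ (x i).2.2.2).differentiableAt hN hθ) (hseg _ (x i).2.2.2)
    (hC _ (x i).2.2.2) (fun k hk => hρ k hk _ (x i).2.2.2) he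
  rw [Finset.sum_sub_distrib, Finset.sum_add_distrib, smul_eq_mul, mul_sub, mul_add] at hrem
  refine le_trans ?_ (add_le_add (enorm_add_le _ _) hrem)
  exact (enorm_add_le _ _).trans_eq' (by rw [add_sub_cancel])

end CondParamModel

end Profile

section Comparison

variable {d : ℕ} {𝒴 𝒲 : Type*} [MeasurableSpace 𝒴] [MeasurableSpace 𝒲]

namespace CondParamModel

/-- The event on which the profile log-likelihoods of the observations `x` along the curves `η` and
`η'` can be compared: the log-likelihoods of the observations are bounded by the envelope `A`, and
`η'` is smooth, close to `η` and joined to it by segments inside `H`. -/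
structure IsComparable (M : CondParamModel d 𝒴 𝒲) (A : 𝒴 × (𝒲 × unitInterval) → ℝ)
    (N : Set (EuclideanSpace ℝ (Fin d))) (η η' : EuclideanSpace ℝ (Fin d) → ℝ → ℝ)
    (x : ℕ → 𝒴 × (𝒲 × unitInterval)) : Prop where
  isC3BoundedOn : ∀ i, IsC3BoundedOn (M.logDensity (x i)) M.interiorParam (A (x i))
  mixedDerivsExist : MixedDerivsExist η' N
  thetaDist_le_one : ∀ s ≤ 3, thetaDist N η η' s ≤ 1
  segment_subset : ∀ θ ∈ N, ∀ z ∈ Icc (0 : ℝ) 1, segment ℝ (η θ z) (η' θ z) ⊆ interior M.H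

variable {M : CondParamModel d 𝒴 𝒲} {A : 𝒴 × (𝒲 × unitInterval) → ℝ}
  {N : Set (EuclideanSpace ℝ (Fin d))} {θ : EuclideanSpace ℝ (Fin d)}
  {η η' : EuclideanSpace ℝ (Fin d) → ℝ → ℝ} {x : ℕ → 𝒴 × (𝒲 × unitInterval)} {n : ℕ} {C : ℝ}

namespace IsComparable

theorem isSmoothCurveOn_left (h : M.IsComparable A N η η' x) (hNΘ : N ⊆ interior M.Θ)
    (hη : MixedDerivsExist η N) : M.IsSmoothCurveOn η N :=
  ⟨hη.1, fun θ hθ z hz => ⟨hNΘ hθ, h.segment_subset θ hθ z hz (left_mem_segment ℝ _ _)⟩⟩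

theorem isSmoothCurveOn_right (h : M.IsComparable A N η η' x) (hNΘ : N ⊆ interior M.Θ) :
    M.IsSmoothCurveOn η' N :=
  ⟨h.mixedDerivsExist.1, fun θ hθ z hz =>
    ⟨hNΘ hθ, h.segment_subset θ hθ z hz (right_mem_segment ℝ _ _)⟩⟩

theorem segment_mk_subset (h : M.IsComparable A N η η' x) (hNΘ : N ⊆ interior M.Θ) (hθ : θ ∈ N) :
    ∀ z ∈ Icc (0 : ℝ) 1, segment ℝ (θ, η θ z) (θ, η' θ z) ⊆ M.interiorParam := fun z hz =>
  segment_mk_subset_prod (hNΘ hθ) (h.segment_subset θ hθ z hz)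

theorem norm_thetaDeriv_right_le (h : M.IsComparable A N η η' x) {s : ℕ} (hs : s ≤ 3) (hθ : θ ∈ N)
    {z : ℝ} (hz : z ∈ Icc (0 : ℝ) 1) (hC : ‖thetaDeriv η s θ z‖ ≤ C) :
    ‖thetaDeriv η' s θ z‖ ≤ C + 1 := by
  have hdist := norm_thetaDeriv_sub_le ENNReal.one_ne_top (h.thetaDist_le_one s hs) hθ hz
  rw [ENNReal.toReal_one] at hdist
  simpa only [add_sub_cancel] using norm_add_le_of_le hC hdist

theorem curveDist_le (h : M.IsComparable A N η η' x) : curveDist N η η' ≤ 3 :=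
  calc curveDist N η η' ≤ ∑ _s ∈ Finset.range 3, 1 := Finset.sum_le_sum fun s hs =>
        h.thetaDist_le_one s (Finset.mem_range.1 hs).le
    _ = 3 := by simp

theorem curveDist_ne_top (h : M.IsComparable A N η η' x) : curveDist N η η' ≠ ∞ :=
  ne_top_of_le_ne_top ENNReal.ofNat_ne_top h.curveDist_le

theorem enorm_toReal_curveDist (h : M.IsComparable A N η η' x) :
    ‖(curveDist N η η').toReal‖ₑ = curveDist N η η' := by
  rw [Real.enorm_of_nonneg ENNReal.toReal_nonneg, ENNReal.ofReal_toReal h.curveDist_ne_top]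

theorem norm_thetaDeriv_sub_le_toReal_curveDist (h : M.IsComparable A N η η' x) {s : ℕ}
    (hs : s ≤ 2) (hθ : θ ∈ N) {z : ℝ} (hz : z ∈ Icc (0 : ℝ) 1) :
    ‖thetaDeriv η' s θ z - thetaDeriv η s θ z‖ ≤ (curveDist N η η').toReal :=
  norm_thetaDeriv_sub_le h.curveDist_ne_top (thetaDist_le_curveDist hs) hθ hz

theorem enorm_smul_iteratedFDeriv_three_profile_le (h : M.IsComparable A N η η' x) (hN : IsOpen N)
    (hNΘ : N ⊆ interior M.Θ) (hθ : θ ∈ N)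
    (hC : ∀ s ≤ 3, ∀ z ∈ Icc (0 : ℝ) 1, ‖thetaDeriv η s θ z‖ ≤ C) (c : ℝ) :
    ‖c • iteratedFDeriv ℝ 3 (M.profile n x η') θ‖ₑ ≤
      (‖c‖ₑ * ∑ i ∈ Finset.range n, ‖A (x i)‖ₑ) * ‖5 * (1 + (C + 1)) ^ 3‖ₑ :=
  (h.isSmoothCurveOn_right hNΘ).enorm_smul_iteratedFDeriv_three_profile_le hN h.isC3BoundedOn hθ
    (fun s _ hs z hz => h.norm_thetaDeriv_right_le hs hθ hz (hC s hs z hz)) c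

theorem enorm_smul_iteratedFDeriv_two_profile_sub_le (h : M.IsComparable A N η η' x) (hN : IsOpen N)
    (hNΘ : N ⊆ interior M.Θ) (hη : MixedDerivsExist η N) (hθ : θ ∈ N)
    (hC : ∀ s ≤ 3, ∀ z ∈ Icc (0 : ℝ) 1, ‖thetaDeriv η s θ z‖ ≤ C) (c : ℝ) :
    ‖c • iteratedFDeriv ℝ 2 (M.profile n x η') θ - c • iteratedFDeriv ℝ 2 (M.profile n x η) θ‖ₑ ≤
      (‖c‖ₑ * ∑ i ∈ Finset.range n, ‖A (x i)‖ₑ) * ‖5 * (1 + C + 3) ^ 2‖ₑ * curveDist N η η' := by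
  have hC₀ : 0 ≤ C :=
    (norm_nonneg _).trans (hC 0 (Nat.zero_le 3) 0 (left_mem_Icc.2 zero_le_one))
  have hρ : (curveDist N η η').toReal ≤ 3 :=
    ENNReal.toReal_mono ENNReal.ofNat_ne_top h.curveDist_le
  refine ((h.isSmoothCurveOn_left hNΘ hη).enorm_smul_iteratedFDeriv_two_profile_sub_le
    (h.isSmoothCurveOn_right hNΘ) hN h.isC3BoundedOn hθ (h.segment_mk_subset hNΘ hθ)
    (fun s hs => hC s (by omega))
    (fun s hs z hz => h.norm_thetaDeriv_sub_le_toReal_curveDist hs hθ hz) c).trans ?_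
  rw [enorm_mul _ (curveDist N η η').toReal, h.enorm_toReal_curveDist, ← mul_assoc]
  gcongr
  rw [enorm_le_iff_norm_le, Real.norm_of_nonneg (by positivity),
    Real.norm_of_nonneg (by positivity)]
  gcongr

theorem enorm_mul_fderiv_profile_sub_le (h : M.IsComparable A N η η' x) (hN : IsOpen N)
    (hNΘ : N ⊆ interior M.Θ) (hη : MixedDerivsExist η N) (hθ : θ ∈ N)
    (hC : ∀ s ≤ 3, ∀ z ∈ Icc (0 : ℝ) 1, ‖thetaDeriv η s θ z‖ ≤ C)
    {e : EuclideanSpace ℝ (Fin d)} (he : ‖e‖ ≤ 1) (c : ℝ) :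
    ‖c * (fderiv ℝ (M.profile n x η') θ e - fderiv ℝ (M.profile n x η) θ e)‖ₑ ≤
      ‖c * ∑ i ∈ Finset.range n, M.score (x i) (θ, η θ (x i).2.2) *
        (thetaDeriv η' 1 θ (x i).2.2 (fun _ => e) - thetaDeriv η 1 θ (x i).2.2 (fun _ => e))‖ₑ +
      ‖c * ∑ i ∈ Finset.range n, M.scoreDeriv η θ e (x i) *
        (thetaDeriv η' 0 θ (x i).2.2 (fun _ => e) - thetaDeriv η 0 θ (x i).2.2 (fun _ => e))‖ₑ +
      (‖c‖ₑ * ∑ i ∈ Finset.range n, ‖A (x i)‖ₑ) * ‖2 + C‖ₑ * curveDist N η η' ^ 2 := by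
  have hbound := (h.isSmoothCurveOn_left hNΘ hη).enorm_mul_fderiv_profile_sub_le (n := n)
    (h.isSmoothCurveOn_right hNΘ) hN h.isC3BoundedOn hθ (h.segment_mk_subset hNΘ hθ)
    (hC 1 (by norm_num))
    (fun s hs z hz => h.norm_thetaDeriv_sub_le_toReal_curveDist (by omega) hθ hz) he c
  rwa [enorm_mul (2 + C), enorm_pow, h.enorm_toReal_curveDist, ← mul_assoc] at hbound

end IsComparable

end CondParamModel

end Comparison

section Rates

theorem norm_le_sum_norm_apply_single {ι F : Type*} [Fintype ι] [DecidableEq ι]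
    [NormedAddCommGroup F] [NormedSpace ℝ F] (L : EuclideanSpace ℝ ι →L[ℝ] F) :
    ‖L‖ ≤ ∑ j, ‖L (EuclideanSpace.single j 1)‖ := by
  refine ContinuousLinearMap.opNorm_le_bound _ (by positivity) fun u => ?_
  have hu : ∑ j, u j • EuclideanSpace.single j (1 : ℝ) = u := by
    simpa using (EuclideanSpace.basisFun ι ℝ).sum_repr u
  calc ‖L u‖ = ‖∑ j, u j • L (EuclideanSpace.single j 1)‖ := by
        rw [← hu, map_sum]
        simp only [hu, map_smul]
    _ ≤ ∑ j, ‖u j • L (EuclideanSpace.single j 1)‖ := norm_sum_le _ _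
    _ ≤ ∑ j, ‖u‖ * ‖L (EuclideanSpace.single j 1)‖ := by
        gcongr with j
        rw [norm_smul]
        gcongr
        exact PiLp.norm_apply_le u j
    _ = (∑ j, ‖L (EuclideanSpace.single j 1)‖) * ‖u‖ := by rw [← Finset.mul_sum, mul_comm]

theorem enorm_smul_iteratedFDeriv_one_sub_le {ι : Type*} [Fintype ι] [DecidableEq ι]
    (f g : EuclideanSpace ℝ ι → ℝ) (c : ℝ) (x : EuclideanSpace ℝ ι) :
    ‖c • iteratedFDeriv ℝ 1 f x - c • iteratedFDeriv ℝ 1 g x‖ₑ ≤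
      ∑ j, ‖c * (fderiv ℝ f x (EuclideanSpace.single j 1) -
        fderiv ℝ g x (EuclideanSpace.single j 1))‖ₑ := by
  have hnorm : ‖iteratedFDeriv ℝ 1 f x - iteratedFDeriv ℝ 1 g x‖ₑ =
      ‖fderiv ℝ f x - fderiv ℝ g x‖ₑ := enorm_eq_iff_norm_eq.2
    ((norm_iteratedFDeriv_succ_sub f g 0 x).trans (norm_iteratedFDeriv_zero_sub _ _ x))
  simp only [← smul_sub, enorm_smul, enorm_mul, hnorm, ← Finset.mul_sum]
  gcongr
  calc ‖fderiv ℝ f x - fderiv ℝ g x‖ₑ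
      ≤ ‖∑ j, ‖(fderiv ℝ f x - fderiv ℝ g x) (EuclideanSpace.single j 1)‖‖ₑ :=
        enorm_le_iff_norm_le.2
          ((norm_le_sum_norm_apply_single _).trans (Real.le_norm_self _))
    _ ≤ ∑ j, ‖‖(fderiv ℝ f x - fderiv ℝ g x) (EuclideanSpace.single j 1)‖‖ₑ := enorm_sum_le _ _
    _ = _ := by simp only [enorm_norm, sub_apply]

theorem eventually_natCast_rpow_le {a b : ℝ} (h : a ≤ b) :
    ∀ᶠ n : ℕ in atTop, (n : ℝ) ^ a ≤ (n : ℝ) ^ b := by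
  filter_upwards [eventually_ge_atTop 1] with n hn
  exact Real.rpow_le_rpow_of_exponent_le (by exact_mod_cast hn) h

theorem eventually_natCast_rpow_mul_rpow_le {a b c : ℝ} (h : a + b ≤ c) :
    ∀ᶠ n : ℕ in atTop, (n : ℝ) ^ a * (n : ℝ) ^ b ≤ (n : ℝ) ^ c := by
  filter_upwards [eventually_natCast_rpow_le h, eventually_ge_atTop 1] with n hle hn
  rwa [← Real.rpow_add (by exact_mod_cast hn)]

end Rates

section Conditions

variable {d : ℕ} {Ω : Type*} [MeasurableSpace Ω] {μ : Measure Ω}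
  {ηs : EuclideanSpace ℝ (Fin d) → ℝ → ℝ} {ηh : ℕ → Ω → EuclideanSpace ℝ (Fin d) → ℝ → ℝ}
  {θ₀ : EuclideanSpace ℝ (Fin d)} {N N' : Set (EuclideanSpace ℝ (Fin d))} {g δ : ℝ}

theorem ConditionC1.mono (h : ConditionC1 μ ηs ηh N) (hN' : N' ⊆ N) : ConditionC1 μ ηs ηh N' :=
  ⟨h.1.mono hN', WithProbTendingToOne.mono h.2.1 fun _ _ hmixed => hmixed.mono hN',
    fun s hs => (h.2.2 s hs).imp fun _ hC θ hθ => hC θ (hN' hθ)⟩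

theorem ConditionC1.exists_forall_norm_thetaDeriv_le (h : ConditionC1 μ ηs ηh N) :
    ∃ C, ∀ s ≤ 3, ∀ θ ∈ N, ∀ z ∈ Icc (0 : ℝ) 1, ‖thetaDeriv ηs s θ z‖ ≤ C := by
  choose C hC using fun s : Fin 4 => h.2.2 s (by omega)
  refine ⟨∑ s, |C s|, fun s hs θ hθ z hz => ?_⟩
  calc ‖thetaDeriv ηs s θ z‖ ≤ C ⟨s, by omega⟩ := hC ⟨s, by omega⟩ θ hθ z hz
    _ ≤ |C ⟨s, by omega⟩| := le_abs_self _
    _ ≤ ∑ s, |C s| := Finset.single_le_sum (f := fun s => |C s|) (fun _ _ => abs_nonneg _)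
        (Finset.mem_univ _)

namespace ConditionC2

theorem mono (h : ConditionC2 μ ηs ηh θ₀ N g δ) (hN' : N' ⊆ N) :
    ConditionC2 μ ηs ηh θ₀ N' g δ := by
  obtain ⟨hg, hδ, hrate, hthird, hz⟩ := h
  exact ⟨hg, hδ, fun s hs => BigOP.of_le (hrate s hs) fun n ω => thetaDist_mono hN',
    LittleOP.of_le hthird fun n ω => thetaDist_mono hN', hz⟩

theorem bigOP_curveDist (h : ConditionC2 μ ηs ηh θ₀ N g δ) :
    BigOP μ (fun n ω => curveDist N ηs (ηh n ω)) fun n => (n : ℝ) ^ (-g) :=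
  BigOP.sum (fun n => Real.rpow_nonneg n.cast_nonneg _) fun s hs =>
    h.2.2.1 s (Nat.le_of_lt_succ (Finset.mem_range.1 hs))

theorem bigOP_thetaDist (h : ConditionC2 μ ηs ηh θ₀ N g δ) {s : ℕ} (hs : s ≤ 2) :
    BigOP μ (fun n ω => thetaDist N ηs (ηh n ω) s) fun n => (n : ℝ) ^ (-δ) :=
  (h.2.2.1 s hs).mono_rate (fun n => Real.rpow_nonneg n.cast_nonneg _)
    (eventually_natCast_rpow_le (neg_le_neg h.2.1.2))

theorem bigOP_zDerivDist (h : ConditionC2 μ ηs ηh θ₀ N g δ) {s : ℕ} (hs : s ≤ 1) :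
    BigOP μ (fun n ω => zDerivDist θ₀ ηs (ηh n ω) s) fun n => (n : ℝ) ^ (-δ) :=
  LittleOP.bigOP (h.2.2.2.2 s hs)

theorem withProbTendingToOne_thetaDist_le (h : ConditionC2 μ ηs ηh θ₀ N g δ) {s : ℕ} (hs : s ≤ 2)
    {c : ℝ} (hc : 0 < c) :
    WithProbTendingToOne μ fun n ω => thetaDist N ηs (ηh n ω) s ≤ ENNReal.ofReal c :=
  BigOP.withProbTendingToOne_le (h.2.2.1 s hs) ((tendsto_rpow_neg_atTop
    (by linarith [h.1.1])).comp tendsto_natCast_atTop_atTop) hc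

theorem withProbTendingToOne_thetaDist_le_one (h : ConditionC2 μ ηs ηh θ₀ N g δ) :
    WithProbTendingToOne μ fun n ω => ∀ s ≤ 3, thetaDist N ηs (ηh n ω) s ≤ 1 := by
  have hle := fun s (hs : s ≤ 2) => h.withProbTendingToOne_thetaDist_le hs one_pos
  have hle₃ := LittleOP.withProbTendingToOne_le h.2.2.2.1 one_pos
  refine (((hle 0 (by norm_num)).and (hle 1 (by norm_num))).and
    ((hle 2 le_rfl).and hle₃)).mono fun n ω hω s hs => ?_
  simp only [mul_one, ENNReal.ofReal_one] at hω
  interval_cases s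
  exacts [hω.1.1, hω.1.2, hω.2.1, hω.2.2]

end ConditionC2

end Conditions

namespace CondParamModel

section EmpiricalScores

variable {d : ℕ} {𝒴 𝒲 : Type*} [MeasurableSpace 𝒴] [MeasurableSpace 𝒲]
  {M : CondParamModel d 𝒴 𝒲} {N : Set (EuclideanSpace ℝ (Fin d))}
  {θ₀ θ : EuclideanSpace ℝ (Fin d)} {η₀ : ℝ → ℝ} {A : 𝒴 × (𝒲 × unitInterval) → ℝ}
  {ηs : EuclideanSpace ℝ (Fin d) → ℝ → ℝ} {C : ℝ} {e : EuclideanSpace ℝ (Fin d)}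

theorem measurable_covariate :
    Measurable fun x : 𝒴 × (𝒲 × unitInterval) => (x.2.2 : ℝ) :=
  measurable_subtype_coe.comp (measurable_snd.comp measurable_snd)

theorem abs_scoreDeriv_le {x : 𝒴 × (𝒲 × unitInterval)} {a : ℝ}
    (h : IsC3BoundedOn (M.logDensity x) M.interiorParam a)
    (hp : (θ, ηs θ x.2.2) ∈ M.interiorParam) (hC : ‖fderiv ℝ (fun t => ηs t x.2.2) θ‖ ≤ C)
    (he : ‖e‖ ≤ 1) : |M.scoreDeriv ηs θ e x| ≤ a * (1 + C) := by
  have hC₀ : 0 ≤ C := (norm_nonneg _).trans hC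
  have hdir : ‖(e, fderiv ℝ (fun t => ηs t x.2.2) θ e)‖ ≤ 1 + C :=
    max_le (he.trans (le_add_of_nonneg_right hC₀))
      (((ContinuousLinearMap.unit_le_opNorm _ e he).trans hC).trans (by linarith))
  have hscore := norm_fderiv_score_le h hp
  exact (ContinuousLinearMap.le_opNorm _ _).trans
    (mul_le_mul hscore hdir (norm_nonneg _) ((norm_nonneg _).trans hscore))

variable [IsFiniteMeasure (M.law θ₀ η₀)]

theorem memLp_score (hA : MemLp A 2 (M.law θ₀ η₀))
    (hreg : ∀ᵐ x ∂(M.law θ₀ η₀), IsC3BoundedOn (M.logDensity x) M.interiorParam (A x))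
    (hθ : θ ∈ interior M.Θ) {η : ℝ → ℝ} (hη : η ∈ M.nuisanceSpace) :
    MemLp (fun x => M.score x (θ, η x.2.2)) 2 (M.law θ₀ η₀) := by
  have hint := (hasDerivAt_integral_loglik_add_mul (hA.integrable one_le_two) hreg hθ hη
    (contDiffOn_const (c := 1))).1
  simp only [mul_one] at hint
  refine hA.mono hint.aestronglyMeasurable (hreg.mono fun x hx => ?_)
  exact (abs_score_le hx ⟨hθ, hη.2 _ x.2.2.2⟩).trans (le_abs_self _)

theorem memLp_scoreDeriv (hN : IsOpen N) (hθ₀ : θ₀ ∈ N) (hNΘ : N ⊆ interior M.Θ)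
    (hηs : ∀ θ ∈ N, M.IsLeastFavorableAt θ₀ η₀ θ (ηs θ))
    (hdiff : ∀ θ ∈ N, ∀ z ∈ Icc (0 : ℝ) 1, DifferentiableAt ℝ (fun t => ηs t z) θ)
    (hC : ∀ θ ∈ N, ∀ z ∈ Icc (0 : ℝ) 1, ‖fderiv ℝ (fun t => ηs t z) θ‖ ≤ C)
    (hA : MemLp A 2 (M.law θ₀ η₀))
    (hreg : ∀ᵐ x ∂(M.law θ₀ η₀), IsC3BoundedOn (M.logDensity x) M.interiorParam (A x))
    (he : ‖e‖ ≤ 1) : MemLp (M.scoreDeriv ηs θ₀ e) 2 (M.law θ₀ η₀) := by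
  have hint := (IsLeastFavorableAt.integral_scoreDeriv_mul_eq_zero hN hθ₀ hNΘ hηs hdiff hC
    (hA.integrable one_le_two) hreg e (contDiffOn_const (c := 1))).1
  simp only [mul_one] at hint
  refine (hA.mul_const (1 + C)).mono hint.aestronglyMeasurable (hreg.mono fun x hx => ?_)
  exact (abs_scoreDeriv_le hx ⟨hNΘ hθ₀, (hηs θ₀ hθ₀).1.2 _ x.2.2.2⟩ (hC θ₀ hθ₀ _ x.2.2.2)
    he).trans (le_abs_self _)

end EmpiricalScores

section Sample

variable {d : ℕ} {𝒴 𝒲 Ω : Type*} [MeasurableSpace 𝒴] [MeasurableSpace 𝒲] [MeasurableSpace Ω]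
  {M : CondParamModel d 𝒴 𝒲} {θ₀ : EuclideanSpace ℝ (Fin d)} {η₀ : ℝ → ℝ} {μ : Measure Ω}
  {X : ℕ → Ω → 𝒴 × (𝒲 × unitInterval)} {N : Set (EuclideanSpace ℝ (Fin d))}
  {ηs : EuclideanSpace ℝ (Fin d) → ℝ → ℝ} {ηh : ℕ → Ω → EuclideanSpace ℝ (Fin d) → ℝ → ℝ}
  {A : 𝒴 × (𝒲 × unitInterval) → ℝ} {g δ : ℝ}

namespace IsSample

theorem ae_forall (hX : M.IsSample θ₀ η₀ μ X) {p : 𝒴 × (𝒲 × unitInterval) → Prop}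
    (h : ∀ᵐ x ∂(M.law θ₀ η₀), p x) : ∀ᵐ ω ∂μ, ∀ i, p (X i ω) :=
  ae_all_iff.2 fun i => ae_of_ae_map (hX.1 i).aemeasurable (by rwa [hX.2.2 i])

theorem isProbabilityMeasure_law [IsProbabilityMeasure μ] (hX : M.IsSample θ₀ η₀ μ X) :
    IsProbabilityMeasure (M.law θ₀ η₀) :=
  hX.2.2 0 ▸ Measure.isProbabilityMeasure_map (hX.1 0).aemeasurable

theorem withProbTendingToOne_isComparable (hX : M.IsSample θ₀ η₀ μ X)
    (hreg : ∀ᵐ x ∂(M.law θ₀ η₀), IsC3BoundedOn (M.logDensity x) M.interiorParam (A x))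
    (hC1 : ConditionC1 μ ηs ηh N) (hC2 : ConditionC2 μ ηs ηh θ₀ N g δ)
    (hseg : WithProbTendingToOne μ fun n ω => ∀ θ ∈ N, ∀ z ∈ Icc (0 : ℝ) 1,
      segment ℝ (ηs θ z) (ηh n ω θ z) ⊆ interior M.H) :
    WithProbTendingToOne μ fun n ω => M.IsComparable A N ηs (ηh n ω) fun i => X i ω := by
  have hbdd := withProbTendingToOne_of_ae ((hX.ae_forall hreg).mono fun ω hω (_ : ℕ) => hω)
  exact ((hbdd.and hC1.2.1).and (hC2.withProbTendingToOne_thetaDist_le_one.and hseg)).mono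
    fun n ω h => ⟨h.1.1, h.1.2, h.2.1, h.2.2⟩

theorem bigOP_average_mul_enorm (hX : M.IsSample θ₀ η₀ μ X) (hA : Integrable A (M.law θ₀ η₀))
    (c : ℝ) :
    BigOP μ (fun n ω => (‖(1 / n : ℝ)‖ₑ * ∑ i ∈ Finset.range n, ‖A (X i ω)‖ₑ) * ‖c‖ₑ)
      fun _ => 1 := by
  simpa only [mul_one] using (bigOP_average hX.1 hX.2.2 hA).mul (bigOP_const enorm_ne_top)
    (fun _ => zero_le_one) (fun _ => zero_le_one)

theorem bigOP_average_mul_curveDist (hX : M.IsSample θ₀ η₀ μ X)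
    (hA : Integrable A (M.law θ₀ η₀)) (hC2 : ConditionC2 μ ηs ηh θ₀ N g δ) (c : ℝ) :
    BigOP μ (fun n ω => (‖(1 / n : ℝ)‖ₑ * ∑ i ∈ Finset.range n, ‖A (X i ω)‖ₑ) * ‖c‖ₑ *
      curveDist N ηs (ηh n ω)) fun n => (n : ℝ) ^ (-g) := by
  simpa only [one_mul] using (hX.bigOP_average_mul_enorm hA c).mul hC2.bigOP_curveDist
    (fun _ => zero_le_one) (fun n => Real.rpow_nonneg n.cast_nonneg _)

theorem bigOP_average_mul_curveDist_sq (hX : M.IsSample θ₀ η₀ μ X)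
    (hA : Integrable A (M.law θ₀ η₀)) (hC2 : ConditionC2 μ ηs ηh θ₀ N g δ) (c : ℝ) :
    BigOP μ (fun n ω => (‖(1 / n : ℝ)‖ₑ * ∑ i ∈ Finset.range n, ‖A (X i ω)‖ₑ) * ‖c‖ₑ *
      curveDist N ηs (ηh n ω) ^ 2) fun n => (n : ℝ) ^ (-(2 * g)) := by
  have hnonneg : ∀ n : ℕ, 0 ≤ (n : ℝ) ^ (-g) := fun n => Real.rpow_nonneg n.cast_nonneg _
  have hrate := (hX.bigOP_average_mul_curveDist hA hC2 c).mul hC2.bigOP_curveDist hnonneg hnonneg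
  simp only [mul_assoc, ← sq] at hrate ⊢
  refine hrate.mono_rate (fun n => sq_nonneg _) ?_
  simpa only [sq] using eventually_natCast_rpow_mul_rpow_le (a := -g) (b := -g) (by linarith)

theorem bigOP_average_mul_thetaDeriv_sub [IsProbabilityMeasure μ] (hX : M.IsSample θ₀ η₀ μ X)
    {m : 𝒴 × (𝒲 × unitInterval) → ℝ} (hm : MemLp m 2 (M.law θ₀ η₀))
    (hmean : ∀ φ : ℝ → ℝ, ContDiff ℝ 2 φ → ∫ x, m x * φ x.2.2 ∂(M.law θ₀ η₀) = 0)
    (hθ₀ : θ₀ ∈ N) (hC1 : ConditionC1 μ ηs ηh N) (hC2 : ConditionC2 μ ηs ηh θ₀ N g δ)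
    {s : ℕ} (hs : s ≤ 1) {v : Fin s → EuclideanSpace ℝ (Fin d)} (hv : ‖v‖ ≤ 1) :
    BigOP μ (fun n ω => ‖(1 / n : ℝ) * ∑ i ∈ Finset.range n, m (X i ω) *
        (thetaDeriv (ηh n ω) s θ₀ (X i ω).2.2 v - thetaDeriv ηs s θ₀ (X i ω).2.2 v)‖ₑ)
      fun n => (n : ℝ) ^ (-(2 * g)) := by
  have := hX.isProbabilityMeasure_law
  have hrate := bigOP_enorm_average_mul hX.1 (fun i j hij => hX.2.1.indepFun hij) hX.2.2
    measurable_covariate (fun x => x.2.2.2) hm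
    (integral_mul_step_eq_zero (hm.integrable one_le_two) measurable_covariate hmean)
    (F := fun n ω z => thetaDeriv (ηh n ω) s θ₀ z v - thetaDeriv ηs s θ₀ z v)
    (fun n => Real.rpow_nonneg n.cast_nonneg _)
    (WithProbTendingToOne.mono hC1.2.1 fun n ω h =>
      hC1.1.contDiffOn_thetaDeriv_apply_sub h hθ₀ hs v)
    ((hC2.bigOP_thetaDist (hs.trans one_le_two)).of_le fun n ω =>
      iSup_enorm_thetaDeriv_apply_sub_le hθ₀ hv)
    ((hC2.bigOP_zDerivDist hs).mono hC1.2.1 fun n ω h =>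
      iSup_enorm_derivWithin_thetaDeriv_apply_sub_le hC1.1 h hθ₀ hs hv)
  exact hrate.mono_rate (fun n => by positivity)
    (eventually_natCast_rpow_mul_rpow_le (by linarith [hC2.2.1.1]))

theorem bigOP_iteratedFDeriv_three_profile (hX : M.IsSample θ₀ η₀ μ X) (hN : IsOpen N)
    (hNΘ : N ⊆ interior M.Θ) (hA : Integrable A (M.law θ₀ η₀)) (hC1 : ConditionC1 μ ηs ηh N)
    (hcmp : WithProbTendingToOne μ fun n ω =>
      M.IsComparable A N ηs (ηh n ω) fun i => X i ω) :
    BigOP μ (fun n ω => ⨆ θ ∈ N, ‖(1 / n : ℝ) •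
      iteratedFDeriv ℝ 3 (M.profile n (fun i => X i ω) (ηh n ω)) θ‖ₑ) fun _ => 1 := by
  obtain ⟨C, hC⟩ := hC1.exists_forall_norm_thetaDeriv_le
  exact (hX.bigOP_average_mul_enorm hA _).mono hcmp fun n ω h => iSup₂_le fun θ hθ =>
    h.enorm_smul_iteratedFDeriv_three_profile_le hN hNΘ hθ (fun s hs => hC s hs θ hθ) _

theorem bigOP_iteratedFDeriv_two_profile_sub (hX : M.IsSample θ₀ η₀ μ X) (hN : IsOpen N)
    (hNΘ : N ⊆ interior M.Θ) (hA : Integrable A (M.law θ₀ η₀)) (hC1 : ConditionC1 μ ηs ηh N)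
    (hC2 : ConditionC2 μ ηs ηh θ₀ N g δ)
    (hcmp : WithProbTendingToOne μ fun n ω =>
      M.IsComparable A N ηs (ηh n ω) fun i => X i ω) :
    BigOP μ (fun n ω => ⨆ θ ∈ N,
        ‖(1 / n : ℝ) • iteratedFDeriv ℝ 2 (M.profile n (fun i => X i ω) (ηh n ω)) θ -
          (1 / n : ℝ) • iteratedFDeriv ℝ 2 (M.profile n (fun i => X i ω) ηs) θ‖ₑ)
      fun n => (n : ℝ) ^ (-g) := by
  obtain ⟨C, hC⟩ := hC1.exists_forall_norm_thetaDeriv_le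
  exact (hX.bigOP_average_mul_curveDist hA hC2 _).mono hcmp fun n ω h => iSup₂_le fun θ hθ =>
    h.enorm_smul_iteratedFDeriv_two_profile_sub_le hN hNΘ hC1.1 hθ (fun s hs => hC s hs θ hθ) _

theorem bigOP_fderiv_profile_sub [IsProbabilityMeasure μ] (hX : M.IsSample θ₀ η₀ μ X)
    (hN : IsOpen N) (hθ₀ : θ₀ ∈ N) (hNΘ : N ⊆ interior M.Θ)
    (hηs : ∀ θ ∈ N, M.IsLeastFavorableAt θ₀ η₀ θ (ηs θ)) (hA : MemLp A 2 (M.law θ₀ η₀))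
    (hreg : ∀ᵐ x ∂(M.law θ₀ η₀), IsC3BoundedOn (M.logDensity x) M.interiorParam (A x))
    (hC1 : ConditionC1 μ ηs ηh N) (hC2 : ConditionC2 μ ηs ηh θ₀ N g δ)
    (hcmp : WithProbTendingToOne μ fun n ω =>
      M.IsComparable A N ηs (ηh n ω) fun i => X i ω)
    {e : EuclideanSpace ℝ (Fin d)} (he : ‖e‖ ≤ 1) :
    BigOP μ (fun n ω => ‖(1 / n : ℝ) * (fderiv ℝ (M.profile n (fun i => X i ω) (ηh n ω)) θ₀ e -
        fderiv ℝ (M.profile n (fun i => X i ω) ηs) θ₀ e)‖ₑ)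
      fun n => (n : ℝ) ^ (-(2 * g)) := by
  have := hX.isProbabilityMeasure_law
  have hA₁ := hA.integrable one_le_two
  obtain ⟨C, hC⟩ := hC1.exists_forall_norm_thetaDeriv_le
  have hdiff : ∀ θ ∈ N, ∀ z ∈ Icc (0 : ℝ) 1, DifferentiableAt ℝ (fun t => ηs t z) θ :=
    fun θ hθ z hz => (hC1.1.1 z hz).differentiableAt hN hθ
  have hC' : ∀ θ ∈ N, ∀ z ∈ Icc (0 : ℝ) 1, ‖fderiv ℝ (fun t => ηs t z) θ‖ ≤ C :=
    fun θ hθ z hz => norm_thetaDeriv_one.symm.trans_le (hC 1 (by norm_num) θ hθ z hz)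
  have hscore := hX.bigOP_average_mul_thetaDeriv_sub
    (memLp_score hA hreg (hNΘ hθ₀) (hηs θ₀ hθ₀).1)
    (fun φ hφ => (hηs θ₀ hθ₀).integral_score_mul_eq_zero (hNΘ hθ₀) hA₁ hreg hφ.contDiffOn)
    hθ₀ hC1 hC2 le_rfl (v := fun _ => e) ((pi_norm_const_le e).trans he)
  have hscoreDeriv := hX.bigOP_average_mul_thetaDeriv_sub
    (memLp_scoreDeriv hN hθ₀ hNΘ hηs hdiff hC' hA hreg he)
    (fun φ hφ => (IsLeastFavorableAt.integral_scoreDeriv_mul_eq_zero hN hθ₀ hNΘ hηs hdiff hC' hA₁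
      hreg e hφ.contDiffOn).2)
    hθ₀ hC1 hC2 zero_le_one (v := fun _ => e) ((pi_norm_const_le e).trans he)
  have hnonneg : ∀ n : ℕ, 0 ≤ (n : ℝ) ^ (-(2 * g)) := fun n => Real.rpow_nonneg n.cast_nonneg _
  exact ((hscore.add hscoreDeriv hnonneg).add
    (hX.bigOP_average_mul_curveDist_sq hA₁ hC2 (2 + C)) hnonneg).mono hcmp fun n ω h =>
    h.enorm_mul_fderiv_profile_sub_le hN hNΘ hC1.1 hθ₀ (fun s hs => hC s hs θ₀ hθ₀) he _

theorem conditionG_profile [IsProbabilityMeasure μ] (hX : M.IsSample θ₀ η₀ μ X)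
    (hN : IsOpen N) (hθ₀ : θ₀ ∈ N) (hNΘ : N ⊆ interior M.Θ)
    (hηs : ∀ θ ∈ N, M.IsLeastFavorableAt θ₀ η₀ θ (ηs θ)) (hK2 : M.ConditionK2 θ₀ η₀)
    (hC1 : ConditionC1 μ ηs ηh N) (hC2 : ConditionC2 μ ηs ηh θ₀ N g δ)
    (hseg : WithProbTendingToOne μ fun n ω => ∀ θ ∈ N, ∀ z ∈ Icc (0 : ℝ) 1,
      segment ℝ (ηs θ z) (ηh n ω θ z) ⊆ interior M.H) :
    ConditionG μ (fun n ω => M.profile n (fun i => X i ω) (ηh n ω))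
      (fun n ω => M.profile n (fun i => X i ω) ηs) θ₀ N g := by
  have := hX.isProbabilityMeasure_law
  obtain ⟨A, hA, hreg⟩ := hK2.exists_isC3BoundedOn
  have hA₁ := hA.integrable one_le_two
  have hcmp := hX.withProbTendingToOne_isComparable hreg hC1 hC2 hseg
  refine ⟨hC2.1, hcmp.mono fun n ω h => ⟨?_, ?_⟩, ?_,
    hX.bigOP_iteratedFDeriv_two_profile_sub hN hNΘ hA₁ hC1 hC2 hcmp,
    hX.bigOP_iteratedFDeriv_three_profile hN hNΘ hA₁ hC1 hcmp⟩
  · exact (h.isSmoothCurveOn_right hNΘ).thriceDifferentiableOn_profile hN h.isC3BoundedOn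
  · exact (h.isSmoothCurveOn_left hNΘ hC1.1).thriceDifferentiableOn_profile hN h.isC3BoundedOn
  · exact (BigOP.sum (s := Finset.univ) (fun n => Real.rpow_nonneg n.cast_nonneg _) fun j _ =>
      hX.bigOP_fderiv_profile_sub hN hθ₀ hNΘ hηs hA hreg hC1 hC2 hcmp
        (e := EuclideanSpace.single j 1) (by simp)).of_le fun n ω =>
      enorm_smul_iteratedFDeriv_one_sub_le _ _ _ θ₀

end IsSample

end Sample

end CondParamModel

theorem theorem4_general {d : ℕ} {𝒴 𝒲 Ω : Type*} [MeasurableSpace 𝒴] [MeasurableSpace 𝒲]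
    [MeasurableSpace Ω] (M : CondParamModel d 𝒴 𝒲)
    (θ₀ : EuclideanSpace ℝ (Fin d)) (η₀ : ℝ → ℝ)
    (μ : Measure Ω) [IsProbabilityMeasure μ]
    (X : ℕ → Ω → 𝒴 × (𝒲 × unitInterval)) (hX : M.IsSample θ₀ η₀ μ X)
    (N : Set (EuclideanSpace ℝ (Fin d))) (hN : IsOpen N) (hθ₀ : θ₀ ∈ N) (hNΘ : N ⊆ M.Θ)
    (ηs : EuclideanSpace ℝ (Fin d) → ℝ → ℝ)
    (hηs : ∀ θ ∈ N, M.IsLeastFavorableAt θ₀ η₀ θ (ηs θ))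
    (ηh : ℕ → Ω → EuclideanSpace ℝ (Fin d) → ℝ → ℝ)
    (hηh : WithProbTendingToOne μ fun n ω => ∀ θ ∈ N, ηh n ω θ ∈ M.nuisanceSpace)
    (hK2 : M.ConditionK2 θ₀ η₀)
    (g δ : ℝ) (hC1 : ConditionC1 μ ηs ηh N) (hC2 : ConditionC2 μ ηs ηh θ₀ N g δ) :
    ∃ N' ⊆ N, IsOpen N' ∧ θ₀ ∈ N' ∧ (M.H.OrdConnected → N' = N) ∧
      ConditionG μ
        (fun n ω => M.profile n (fun i => X i ω) (ηh n ω))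
        (fun n ω => M.profile n (fun i => X i ω) ηs) θ₀ N' g := by
  obtain ⟨C, hC⟩ := hC1.exists_forall_norm_thetaDeriv_le
  obtain ⟨N', hN', hN'open, hθ₀', hH, ρ, hρ, hsegment⟩ :=
    exists_isOpen_forall_segment_subset hN hθ₀ (fun θ hθ => (hηs θ hθ).1)
      (fun θ hθ z hz => (hC1.1.1 z hz).differentiableAt hN hθ)
      (fun θ hθ z hz => norm_thetaDeriv_one.symm.trans_le (hC 1 (by norm_num) θ hθ z hz))
  have hseg : WithProbTendingToOne μ fun n ω => ∀ θ ∈ N', ∀ z ∈ Icc (0 : ℝ) 1,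
      segment ℝ (ηs θ z) (ηh n ω θ z) ⊆ interior M.H :=
    (WithProbTendingToOne.and hηh (hC2.withProbTendingToOne_thetaDist_le (Nat.zero_le 2) hρ)).mono
      fun n ω h => hsegment _ h.1 h.2
  exact ⟨N', hN', hN'open, hθ₀', hH, hX.conditionG_profile hN'open hθ₀'
    (hN'.trans (interior_maximal hNΘ hN)) (fun θ hθ => hηs θ (hN' hθ)) hK2 (hC1.mono hN')
    (hC2.mono hN') hseg⟩

theorem theorem4 {d : ℕ} {𝒴 𝒲 Ω : Type*} [MeasurableSpace 𝒴] [MeasurableSpace 𝒲]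
    [MeasurableSpace Ω] (M : CondParamModel d 𝒴 𝒲)
    (θ₀ : EuclideanSpace ℝ (Fin d)) (η₀ : ℝ → ℝ) (hη₀ : η₀ ∈ M.nuisanceSpace)
    (μ : Measure Ω) [IsProbabilityMeasure μ]
    (X : ℕ → Ω → 𝒴 × (𝒲 × unitInterval)) (hX : M.IsSample θ₀ η₀ μ X)
    (K : ℝ → ℝ) (hK : IsKernel K)
    (b : ℕ → ℝ) (hb_pos : ∀ n, 0 < b n) (hb : Tendsto b atTop (𝓝 0))
    (N : Set (EuclideanSpace ℝ (Fin d))) (hN : IsOpen N) (hθ₀ : θ₀ ∈ N) (hNΘ : N ⊆ M.Θ)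
    (ηs : EuclideanSpace ℝ (Fin d) → ℝ → ℝ)
    (hηs : ∀ θ ∈ N, M.IsLeastFavorableAt θ₀ η₀ θ (ηs θ))
    (ηh : ℕ → Ω → EuclideanSpace ℝ (Fin d) → ℝ → ℝ)
    (hηh : WithProbTendingToOne μ fun n ω =>
      ∀ θ ∈ N, M.IsKernelEstimateAt K (b n) n (fun i => X i ω) θ (ηh n ω θ))
    (hK1 : M.ConditionK1) (hK2 : M.ConditionK2 θ₀ η₀)
    (g δ : ℝ) (hC1 : ConditionC1 μ ηs ηh N) (hC2 : ConditionC2 μ ηs ηh θ₀ N g δ) :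
    ∃ N' ⊆ N, IsOpen N' ∧ θ₀ ∈ N' ∧ (M.H.OrdConnected → N' = N) ∧
      ConditionG μ
        (fun n ω => M.profile n (fun i => X i ω) (ηh n ω))
        (fun n ω => M.profile n (fun i => X i ω) ηs) θ₀ N' g :=
  theorem4_general M θ₀ η₀ μ X hX N hN hθ₀ hNΘ ηs hηs ηh
    (WithProbTendingToOne.mono hηh fun _ _ h θ hθ => (h θ hθ).1) hK2 g δ hC1 hC2
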